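/- **Setting.** Let $f:\mathbb R^p\to\mathbb R$, $g_\xi:\mathbb R^d\to\mathbb R^p$ be differentiable, with $f$ $l_f$-Lipschitz, $\nabla f$ $L_f$-Lipschitz, every $g_\xi$ $l_g$-Lipschitz and every Jacobian $g_\xi'$ $L_g$-Lipschitz (Frobenius norm). Consider the unregularized ($r\equiv 0$) problems of minimizing $F$ over $\mathbb R^d$: $$(\Sigma^1)\;\; F(x)=f\Big(\tfrac1n\sum_{i=1}^n g_i(x)\Big)\ (n\ge 1),\qquad (\mathbb E^1)\;\; F(x)=f(g(x)),\ g(x)=\mathbb E_\xi g_\xi(x),$$ with $F^*=\inf F>-\infty$; for $(\mathbb E^1)$ assume moreover $\mathbb E\|g_\xi(x)-g(x)\|^2\le\sigma_g^2$ and $\mathbb E\|g_\xi'(x)-g'(x)\|^2\le\sigma_{g'}^2$ for all $x$ (Frobenius norm for the Jacobians), $\sigma_g,\sigma_{g'}>0$. Put $L_F=l_g^2L_f+l_fL_g$, $G_0=2(l_g^4L_f^2+l_f^2L_g^2)$, $\sigma_0^2=2(l_g^2L_f^2\sigma_g^2+l_f^2\sigma_{g'}^2)$. **Algorithm (MVRC-1).**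 Given $x_0$, an epoch length $\tau\ge1$ and batch sizes $|\mathcal A_t|$, set $y_0=x_0$ and for $t=0,\dots,T-1$: $z_t=(1-\alpha_{t+1})y_t+\alpha_{t+1}x_t$. If $\tau\mid t$, let $\tilde g_t,\tilde g_t'$ be the averages over $\xi\in\mathcal A_t$ of $g_\xi(z_t),g'_\xi(z_t)$. Otherwise let $\tilde g_t=\tilde g_{t-1}+\frac1{|\mathcal A_t|}\sum_{\xi\in\mathcal A_t}(g_\xi(z_t)-g_\xi(z_{t-1}))$, and likewise $\tilde g_t'$. Then $x_{t+1}=\operatorname{prox}_{\lambda_t r}\big(x_t-\lambda_t\,\tilde g_t'^{\top}\nabla f(\tilde g_t)\big)$ (so $x_{t+1}=x_t-\lambda_t\,\tilde g_t'^{\top}\nabla f(\tilde g_t)$ for $r\equiv0$) and $y_{t+1}=z_t+\frac{\beta}{\lambda_t}(x_{t+1}-x_t)$. The output is $z_\zeta$, with $\zeta$ uniform on $\{0,\dots,T-1\}$. All batches and $\zeta$ are independent. Take $\alpha_t=\frac{2}{t+1}$, $\lambda_t\in[\beta,(1+\alpha_t)\beta]$, $0<\beta\le\big(2\sqrt{16L_F^2+6G_0}+8L_F\big)^{-1}$,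 and * for $(\Sigma^1)$: $\tau=\lfloor\sqrt n\rfloor$; $\mathcal A_t=\{1,\dots,n\}$ if $\tau\mid t$, otherwise $\mathcal A_t$ consists of $\lfloor\sqrt n\rfloor$ uniform samples from $\{1,\dots,n\}$, with or without replacement; * for $(\mathbb E^1)$, with an accuracy parameter $\epsilon>0$, $\epsilon^2\le2\sigma_0^2$: $\tau=\lfloor\sqrt{2\sigma_0^2\epsilon^{-2}}\rfloor$; $\mathcal A_t$ consists of i.i.d. copies of $\xi$, $\lceil2\sigma_0^2\epsilon^{-2}\rceil$ of them if $\tau\mid t$ and $\tau$ otherwise. **Gradient dominance.** Let $v>0$ and let $S\subseteq\mathbb R^d$ be a set that almost surely contains all points $z_t$ of the runs considered ($S=\mathbb R^d$ is allowed), with $F(x)-F^*\le\frac v2\|\nabla F(x)\|^2$ for all $x\in S$. **Restarts.** Run the algorithm $M$ times, independently; the first run starts at $x_0$, and each further run starts (with $y_{0,m+1}=x_{0,m+1}$) at a point selected uniformly from the $z_{0,m},\dots,z_{T-1,m}$ of the previous run. The output $\hat z$ is selected uniformly from the $z_{t,M}$ of the last run. **Theorem.** There are universal constants $c,K,C>0$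 and $\kappa\in(0,1]$ such that the following holds for all problems, parameters and starting points as above; write $\Delta=F(x_0)-F^*$. 1. *One run*, any $T\ge1$. For $(\Sigma^1)$: $\mathbb EF(z_\zeta)-F^*\le C\,\frac{v\Delta}{T\beta}$. For $(\mathbb E^1)$: $\mathbb EF(z_\zeta)-F^*\le C\big(v\epsilon^2+\frac{v\Delta}{T\beta}\big)$. 2. *Linear convergence.* With $T=\max\{\lceil cv/\beta\rceil,\tau\}$ and any number $M$ of runs: $\mathbb EF(\hat z)-F^*\le2^{-M}\Delta$ for $(\Sigma^1)$, and $\mathbb EF(\hat z)-F^*\le Cv\epsilon^2+2^{-M}\Delta$ for $(\mathbb E^1)$. 3. *Accuracy and sample complexity.* Let $0<\epsilon\le\frac12$ (and $\epsilon^2\le2\sigma_0^2$ for $(\mathbb E^1)$), $M=\lceil K\log\frac1\epsilon\rceil$, $T=\max\{\lceil cv/\beta\rceil,\tau\}$, where for $(\mathbb E^1)$ the parameter $\epsilon$ in $\tau$ and $|\mathcal A_t|$ is replaced by $\kappa\epsilon$. Then $\mathbb EF(\hat z)-F^*\le\epsilon^2\Delta$ for $(\Sigma^1)$ and $\mathbb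 EF(\hat z)-F^*\le\epsilon^2(v+\Delta)$ for $(\mathbb E^1)$. If also $\epsilon\Delta\le v$, then $\hat z$ is $\epsilon$-accurate: $\mathbb E\|\mathcal G_\eta(\hat z)\|\le\epsilon$ for every $\eta>0$, where $\mathcal G_\eta(x)=\frac1\eta\big(x-\operatorname{prox}_{\eta r}(x-\eta\nabla F(x))\big)$, which is $\nabla F(x)$ as $r\equiv0$. The total number of evaluations of the maps $g_\xi$ and $g_\xi'$ is at most * $C\,\big(n+\sqrt n\,\frac v\beta\big)\log\frac1\epsilon$ for $(\Sigma^1)$; * $C\,\frac{\sigma_0^2}{\beta}\,v\,\epsilon^{-2}\log\frac1\epsilon$ for $(\mathbb E^1)$, provided that $S$ contains a point that does not minimize $F$. -/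

import Mathlib

open MeasureTheory ProbabilityTheory
open scoped NNReal

namespace MVRC

noncomputable section

/-- `ℝᵏ` with the Euclidean norm. -/
abbrev Vec (k : ℕ) : Type := EuclideanSpace ℝ (Fin k)

/-- The Frobenius norm of (the matrix of) a linear map `ℝᵈ → ℝᵖ`: the root of the sum of the
squared norms of its columns. It is the norm put on Jacobian matrices. -/
def frobNorm {d p : ℕ} (J : Vec d →L[ℝ] Vec p) : ℝ :=
  √(∑ j : Fin d, ‖J (EuclideanSpace.single j (1 : ℝ))‖ ^ 2)

/-- The proximal mapping `prox_{lam r}(x) = argmin_u { r u + ‖u - x‖² / (2 lam) }`. -/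
def prox {d : ℕ} (r : Vec d → ℝ) (lam : ℝ) (x : Vec d) : Vec d :=
  Classical.epsilon fun y : Vec d =>
    IsMinOn (fun u : Vec d => r u + 1 / (2 * lam) * ‖u - x‖ ^ 2) Set.univ y

/-- The generalized gradient mapping
`G_lam(x) = (x - prox_{lam r}(x - lam ∇F(x))) / lam`. -/
def gradMap {d : ℕ} (r F : Vec d → ℝ) (lam : ℝ) (x : Vec d) : Vec d :=
  lam⁻¹ • (x - prox r lam (x - lam • gradient F x))

/-- `F* = inf_x F(x)`. -/
def Fstar {d : ℕ} (F : Vec d → ℝ) : ℝ := ⨅ x, F x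

/-! ### The algorithm MVRC-1 -/

/-- Regularizer, momentum parameters, step sizes, epoch length and the batch sizes `|A_t|`. -/
structure Params (d : ℕ) where
  r : Vec d → ℝ
  α : ℕ → ℝ
  β : ℕ → ℝ
  lam : ℕ → ℝ
  τ : ℕ
  b : ℕ → ℕ

/-- The variables of the algorithm at the beginning of iteration `t`: `x = x_t`, `y = y_t`, and
`z = z_{t-1}`, `gt`, `Jt` the estimates of `g` and of its Jacobian made in iteration `t - 1`.
`evals` counts the evaluations of the maps `g_ξ` and of their Jacobians `g_ξ'` made so far. -/
structure State (d p : ℕ) where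
  x : Vec d
  y : Vec d
  z : Vec d
  gt : Vec p
  Jt : Vec d →L[ℝ] Vec p
  evals : ℕ

/-- The average of `k` vectors. -/
def avg {k : ℕ} {V : Type*} [AddCommGroup V] [Module ℝ V] (h : Fin k → V) : V :=
  (k : ℝ)⁻¹ • ∑ i, h i

section Algorithm

variable {d p : ℕ} {Ξ : Type*}

/-- Iteration `t` of MVRC-1, with the batch `a` of samples. Per sample, a checkpoint iteration
evaluates `g_ξ` and `g_ξ'` at `z_t`, any other iteration evaluates both at `z_t` and `z_{t-1}`. -/
def step (P : Params d) (f : Vec p → ℝ) (g : Ξ → Vec d → Vec p)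
    (t : ℕ) (a : Fin (P.b t) → Ξ) (s : State d p) : State d p :=
  let z : Vec d := (1 - P.α (t + 1)) • s.y + P.α (t + 1) • s.x
  let gt : Vec p :=
    if t % P.τ = 0 then avg fun i => g (a i) z
    else s.gt + avg fun i => g (a i) z - g (a i) s.z
  let Jt : Vec d →L[ℝ] Vec p :=
    if t % P.τ = 0 then avg fun i => fderiv ℝ (g (a i)) z
    else s.Jt + avg fun i => fderiv ℝ (g (a i)) z - fderiv ℝ (g (a i)) s.z
  let gradEst : Vec d := ContinuousLinearMap.adjoint Jt (gradient f gt)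
  let x' : Vec d := prox P.r (P.lam t) (s.x - P.lam t • gradEst)
  { x := x'
    y := z + (P.β t / P.lam t) • (x' - s.x)
    z := z
    gt := gt
    Jt := Jt
    evals := s.evals + (if t % P.τ = 0 then 2 * P.b t else 4 * P.b t) }

/-- The state after `t` iterations from `x₀`, with the batches `a 0, a 1, …`. The initial `z`,
`gt`, `Jt` are placeholders that are never read, as iteration `0` is a checkpoint. -/
def run (P : Params d) (f : Vec p → ℝ) (g : Ξ → Vec d → Vec p)
    (a : (t : ℕ) → Fin (P.b t) → Ξ) (x₀ : Vec d) : ℕ → State d p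
  | 0 => { x := x₀, y := x₀, z := x₀, gt := 0, Jt := 0, evals := 0 }
  | t + 1 => step P f g t (a t) (run P f g a x₀ t)

/-- The point `z_t` of a run. -/
def zIter (P : Params d) (f : Vec p → ℝ) (g : Ξ → Vec d → Vec p)
    (a : (t : ℕ) → Fin (P.b t) → Ξ) (x₀ : Vec d) (t : ℕ) : Vec d :=
  (run P f g a x₀ (t + 1)).z

/-- MVRC-1 with restarts: the point `z_{ζ_m, m}` returned by the `m`-th run, where run `m + 1`
starts at the point that run `m` returned and the first run (number `0`) starts at `x₀`. Hence
`restart … m` is both the output of the first `m` runs and the initial point of run number `m`. -/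
def restart (P : Params d) (f : Vec p → ℝ) (g : Ξ → Vec d → Vec p)
    (a : ℕ → (t : ℕ) → Fin (P.b t) → Ξ) (ζ : ℕ → ℕ) (x₀ : Vec d) : ℕ → Vec d
  | 0 => x₀
  | m + 1 => zIter P f g (a m) (restart P f g a ζ x₀ m) (ζ m)

/-- The point `z_{t,m}` of run number `m`. -/
def zRestart (P : Params d) (f : Vec p → ℝ) (g : Ξ → Vec d → Vec p)
    (a : ℕ → (t : ℕ) → Fin (P.b t) → Ξ) (ζ : ℕ → ℕ) (x₀ : Vec d) (m t : ℕ) : Vec d :=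
  zIter P f g (a m) (restart P f g a ζ x₀ m) t

/-- Number of evaluations of the maps `g_ξ` and `g_ξ'` made by `M` runs of `T` iterations. -/
def totalEvals (P : Params d) (f : Vec p → ℝ) (g : Ξ → Vec d → Vec p)
    (a : ℕ → (t : ℕ) → Fin (P.b t) → Ξ) (ζ : ℕ → ℕ) (x₀ : Vec d) (T M : ℕ) : ℕ :=
  ∑ m ∈ Finset.range M, (run P f g (a m) (restart P f g a ζ x₀ m) T).evals

end Algorithm

/-! ### Randomness -/

/-- `A m t` is the random batch of iteration `t` of run `m`, and `ζ m` the index that selects the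
output of run `m`: it is uniform on `{0, …, T - 1}`, and all batches and indices are jointly
independent. The law of the batches is prescribed separately. -/
structure IsSampling {Ω Ξ : Type*} [MeasurableSpace Ω] [MeasurableSpace Ξ] (μ : Measure Ω)
    {b : ℕ → ℕ} (A : ℕ → (t : ℕ) → Ω → Fin (b t) → Ξ) (ζ : ℕ → Ω → ℕ) (T : ℕ) : Prop where
  measurable_A : ∀ m t, Measurable (A m t)
  measurable_ζ : ∀ m, Measurable (ζ m)
  law_ζ : ∀ m, μ.map (ζ m) = uniformOn (Set.Iio T)
  indep : iIndep (fun i : (ℕ × ℕ) ⊕ ℕ =>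
    Sum.elim (fun q : ℕ × ℕ => MeasurableSpace.comap (A q.1 q.2) inferInstance)
      (fun m : ℕ => MeasurableSpace.comap (ζ m) inferInstance) i) μ

/-- Sampling for the finite-sum problem with epoch length `τ`: at a checkpoint the batch is all of
`{1, …, n}` (in some order), otherwise it is drawn uniformly from `{1, …, n}`, with or without
replacement. -/
structure IsFiniteSumSampling {Ω : Type*} [MeasurableSpace Ω] (μ : Measure Ω) {n : ℕ} (τ : ℕ)
    {b : ℕ → ℕ} (A : ℕ → (t : ℕ) → Ω → Fin (b t) → Fin n) (ζ : ℕ → Ω → ℕ) (T : ℕ) : Prop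
    extends IsSampling μ A ζ T where
  full : ∀ m t, t % τ = 0 → ∀ ω, Function.Bijective (A m t ω)
  mini : ∀ m t, t % τ ≠ 0 →
    (μ.map (A m t) = Measure.pi fun _ => uniformOn Set.univ) ∨
    (μ.map (A m t) = uniformOn {a | Function.Injective a})

/-- Sampling for the online problem: every batch consists of independent samples from `D`. -/
structure IsOnlineSampling {Ω Ξ : Type*} [MeasurableSpace Ω] [MeasurableSpace Ξ] (μ : Measure Ω)
    (D : Measure Ξ) {b : ℕ → ℕ} (A : ℕ → (t : ℕ) → Ω → Fin (b t) → Ξ) (ζ : ℕ → Ω → ℕ) (T : ℕ) :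
    Prop extends IsSampling μ A ζ T where
  law_A : ∀ m t, μ.map (A m t) = Measure.pi fun _ => D

/-! ### Problems and assumptions -/

/-- `F(x) = f((1/n) ∑ g_i(x))`. -/
def finiteSumObj {d p n : ℕ} (f : Vec p → ℝ) (g : Fin n → Vec d → Vec p) (x : Vec d) : ℝ :=
  f (avg fun i => g i x)

/-- `g(x) = E_ξ g_ξ(x)`. -/
def meanMap {d p : ℕ} {Ξ : Type*} [MeasurableSpace Ξ] (D : Measure Ξ) (g : Ξ → Vec d → Vec p)
    (x : Vec d) : Vec p :=
  ∫ ξ, g ξ x ∂D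

/-- `F(x) = f(E_ξ g_ξ(x))`. -/
def onlineObj {d p : ℕ} {Ξ : Type*} [MeasurableSpace Ξ] (D : Measure Ξ) (f : Vec p → ℝ)
    (g : Ξ → Vec d → Vec p) (x : Vec d) : ℝ :=
  f (meanMap D g x)

/-- `f` and its gradient are Lipschitz, every `g_ξ` and its Jacobian matrix are Lipschitz, and the
objective `F` is bounded below. -/
structure Smooth {d p : ℕ} {Ξ : Type*} (f : Vec p → ℝ) (g : Ξ → Vec d → Vec p) (F : Vec d → ℝ)
    (lf Lf lg Lg : ℝ≥0) : Prop where
  f_diff : Differentiable ℝ f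
  f_lip : LipschitzWith lf f
  f_grad_lip : LipschitzWith Lf (gradient f)
  g_diff : ∀ ξ, Differentiable ℝ (g ξ)
  g_lip : ∀ ξ, LipschitzWith lg (g ξ)
  g_jac_lip : ∀ ξ x y, frobNorm (fderiv ℝ (g ξ) x - fderiv ℝ (g ξ) y) ≤ Lg * ‖x - y‖
  F_bdd : BddBelow (Set.range F)

/-- The variances of `g_ξ` and of `g_ξ'` are bounded by `σg²` and `σg'²`. -/
structure BoundedVariance {d p : ℕ} {Ξ : Type*} [MeasurableSpace Ξ] (D : Measure Ξ)
    (g : Ξ → Vec d → Vec p) (σg σg' : ℝ) : Prop where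
  measurable : ∀ x, Measurable fun ξ => g ξ x
  memLp : ∀ x, MemLp (fun ξ => g ξ x) 2 D
  pos : 0 < σg
  pos' : 0 < σg'
  var_g : ∀ x, ∫ ξ, ‖g ξ x - meanMap D g x‖ ^ 2 ∂D ≤ σg ^ 2
  var_jac : ∀ x, ∫ ξ, frobNorm (fderiv ℝ (g ξ) x - fderiv ℝ (meanMap D g) x) ^ 2 ∂D ≤ σg' ^ 2

/-- `F` is gradient dominant with parameter `v` at the points of `S`. -/
def GradDominantOn {d : ℕ} (F : Vec d → ℝ) (S : Set (Vec d)) (v : ℝ) : Prop :=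
  0 < v ∧ ∀ x ∈ S, F x - Fstar F ≤ v / 2 * ‖gradient F x‖ ^ 2

/-- `L_F = l_g² L_f + l_f L_g`. -/
def LF (lf Lf lg Lg : ℝ) : ℝ := lg ^ 2 * Lf + lf * Lg

/-- `G₀ = 2 (l_g⁴ L_f² + l_f² L_g²)`. -/
def G0 (lf Lf lg Lg : ℝ) : ℝ := 2 * (lg ^ 4 * Lf ^ 2 + lf ^ 2 * Lg ^ 2)

/-- `σ₀² = 2 (l_g² L_f² σ_g² + l_f² σ_{g'}²)`. -/
def sigma0Sq (lf Lf lg σg σg' : ℝ) : ℝ := 2 * (lg ^ 2 * Lf ^ 2 * σg ^ 2 + lf ^ 2 * σg' ^ 2)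

/-- The diminishing momentum `α_t = 2 / (t + 1)`. -/
def dimMomentum (t : ℕ) : ℝ := 2 / ((t : ℝ) + 1)

/-- `0 < β ≤ 1 / (2 √(16 L_F² + 6 G₀) + 8 L_F)` and `β ≤ lam_t ≤ (1 + α_t) β`. -/
structure StepSizes (lf Lf lg Lg β : ℝ) (lam : ℕ → ℝ) : Prop where
  pos : 0 < β
  le : β * (2 * √(16 * LF lf Lf lg Lg ^ 2 + 6 * G0 lf Lf lg Lg) + 8 * LF lf Lf lg Lg) ≤ 1
  lam_mem : ∀ t, lam t ∈ Set.Icc β ((1 + dimMomentum t) * β)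

/-- Finite-sum problem, `r ≡ 0`: `τ = ⌊√n⌋`, `|A_t| = n` at checkpoints and `⌊√n⌋` otherwise. -/
def finiteSumParams (d n : ℕ) (β : ℝ) (lam : ℕ → ℝ) : Params d where
  r := fun _ => 0
  α := dimMomentum
  β := fun _ => β
  lam := lam
  τ := Nat.sqrt n
  b := fun t => if t % Nat.sqrt n = 0 then n else Nat.sqrt n

/-- `τ = ⌊√(2 σ₀² ε⁻²)⌋`. -/
def onlineTau (s ε : ℝ) : ℕ := ⌊√(2 * s / ε ^ 2)⌋₊

/-- Online problem, `r ≡ 0`, with `s = σ₀²`: `τ = ⌊√(2 σ₀² ε⁻²)⌋`, `|A_t| = ⌈2 σ₀² ε⁻²⌉` at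
checkpoints and `⌊√(2 σ₀² ε⁻²)⌋` otherwise. -/
def onlineParams (d : ℕ) (s ε β : ℝ) (lam : ℕ → ℝ) : Params d where
  r := fun _ => 0
  α := dimMomentum
  β := fun _ => β
  lam := lam
  τ := onlineTau s ε
  b := fun t => if t % onlineTau s ε = 0 then ⌈2 * s / ε ^ 2⌉₊ else onlineTau s ε

/-- The random point `X` has expected optimality gap `E F(X) - F*` at most `δ`. -/
def GapLE {d : ℕ} {Ω : Type*} [MeasurableSpace Ω] (μ : Measure Ω) (F : Vec d → ℝ)
    (X : Ω → Vec d) (δ : ℝ) : Prop :=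
  Integrable (fun ω => F (X ω)) μ ∧ ∫ ω, F (X ω) ∂μ - Fstar F ≤ δ

/-- The random point `X` is `ε`-accurate: `E ‖G_η(X)‖ ≤ ε`, for every `η > 0` (for `r ≡ 0`). -/
def Accurate {d : ℕ} {Ω : Type*} [MeasurableSpace Ω] (μ : Measure Ω) (F : Vec d → ℝ)
    (X : Ω → Vec d) (ε : ℝ) : Prop :=
  ∀ η : ℝ, 0 < η → Integrable (fun ω => ‖gradMap (fun _ => 0) F η (X ω)‖) μ ∧
    ∫ ω, ‖gradMap (fun _ => 0) F η (X ω)‖ ∂μ ≤ ε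

end

end MVRC

/-! For `r ≡ 0` the proximal step is a plain step, so a run is an accelerated scheme along inexact
gradients `v t` (`IsScheme`). Its analysis is pathwise.

Descent of `F` from `x t` to `x (t + 1)`, with the gradient moved from `x t` to `z t` and
polarization of the inner product, gains multiples of `β ‖∇F (z t)‖²` and `β ‖v t‖²`. The cost is
the squared gradient error and the momentum gap `‖y t - x t‖²` (`IsScheme.objective_succ_le`). The
gap contracts, so the sums of `‖y t - x t‖²` and `‖z (t + 1) - z t‖²` are at most absolute multiples
of `β² ∑ ‖v t‖²`. The small step size lets the gained `‖v t‖²` pay for both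
(`IsScheme.sum_norm_sq_gradient_le`).

The gradient error is controlled by one vector: the errors of the estimates of `g` and of its
Jacobian, weighted and stacked. Between checkpoints this error changes by an increment that is
centred given the past, so its mean square grows by at most `G₀ / (2τ)` times `E ‖z (t + 1) - z
t‖²`. A checkpoint resets it, and over an epoch of length `τ` the factor `1 / τ` cancels
(`sum_le_of_epoch_recursion`). The accumulated growth is exactly what the pathwise estimate absorbs.
With `δ` the bound on the mean squared gradient error right after a checkpoint, one run gives `E
‖∇F(z_ζ)‖² ≤ 2 gap / (T β) + 3 δ` (`IsReducedSampling.integral_norm_gradient_sq_restart_succ_le`).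

Gradient dominance turns this into `gap' ≤ v gap / (T β) + 3 v δ / 2`. If `T β ≥ 2 v`, each run
halves the gap up to a multiple of `v δ` (`IsReducedSampling.gap_restart_le`). Accuracy follows from
the gradient bound of the last run, applied to the gap left by the earlier runs.

Both problems are treated together: the finite sum is the online problem for the uniform law on `Fin
n`, where checkpoints are exact and `δ = 0`. All sampling schemes enter through `BatchLaw`. -/

namespace MVRC

/-! ### Smooth functions -/

section Smoothness

variable {E : Type*} [NormedAddCommGroup E] [InnerProductSpace ℝ E]

/-- The descent lemma for a function with `L`-Lipschitz gradient. -/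
lemma le_add_inner_add_of_gradient_lipschitz [CompleteSpace E] {F : E → ℝ} {L : ℝ}
    (hF : Differentiable ℝ F)
    (hL : ∀ x y, ‖gradient F x - gradient F y‖ ≤ L * ‖x - y‖) (x y : E) :
    F y ≤ F x + inner ℝ (gradient F x) (y - x) + L / 2 * ‖y - x‖ ^ 2 := by
  set d := y - x with hd
  -- The difference of the two sides along the segment, up to a constant. The Lipschitz bound makes
  -- its derivative nonpositive, and `φ 1 ≤ φ 0` is the claim.
  set φ : ℝ → ℝ := fun s =>
    F (x + s • d) - s * inner ℝ (gradient F x) d - L / 2 * ‖d‖ ^ 2 * s ^ 2 with hφ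
  have hder : ∀ s, HasDerivAt φ
      (inner ℝ (gradient F (x + s • d)) d - inner ℝ (gradient F x) d - L * ‖d‖ ^ 2 * s) s := by
    intro s
    have h1 : HasDerivAt (fun s : ℝ => x + s • d) d s := by
      simpa using ((hasDerivAt_id s).smul_const d).const_add x
    have h2 : HasDerivAt (fun s : ℝ => F (x + s • d)) (inner ℝ (gradient F (x + s • d)) d) s := by
      have := ((hF (x + s • d)).hasGradientAt.hasFDerivAt).comp_hasDerivAt s h1
      rwa [InnerProductSpace.toDual_apply_apply] at this
    have h3 : HasDerivAt (fun s : ℝ => s * inner ℝ (gradient F x) d)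
        (inner ℝ (gradient F x) d) s := by
      simpa using (hasDerivAt_id s).mul_const (inner ℝ (gradient F x) d)
    have h4 : HasDerivAt (fun s : ℝ => L / 2 * ‖d‖ ^ 2 * s ^ 2) (L * ‖d‖ ^ 2 * s) s := by
      have := (hasDerivAt_pow 2 s).const_mul (L / 2 * ‖d‖ ^ 2)
      exact this.congr_deriv (by push_cast; ring)
    exact (h2.sub h3).sub h4
  have hanti : AntitoneOn φ (Set.Icc 0 1) := by
    refine antitoneOn_of_deriv_nonpos (convex_Icc 0 1)
      (fun s _ => (hder s).continuousAt.continuousWithinAt)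
      (fun s _ => (hder s).differentiableAt.differentiableWithinAt) ?_
    intro s hs
    rw [interior_Icc] at hs
    rw [(hder s).deriv, ← inner_sub_left]
    have h1 := real_inner_le_norm (gradient F (x + s • d) - gradient F x) d
    have h2 := hL (x + s • d) x
    rw [add_sub_cancel_left, norm_smul, Real.norm_of_nonneg hs.1.le] at h2
    nlinarith [norm_nonneg d, mul_le_mul_of_nonneg_right h2 (norm_nonneg d)]
  have := hanti (Set.left_mem_Icc.2 zero_le_one) (Set.right_mem_Icc.2 zero_le_one) zero_le_one
  simp only [hφ, one_smul, zero_smul, add_zero] at this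
  have hy : x + d = y := by simp [hd]
  rw [hy] at this
  linarith

/-- A gradient step controls the optimality gap from below. -/
lemma mul_norm_gradient_sq_le [CompleteSpace E] {F : E → ℝ} {L Fs β : ℝ}
    (hF : Differentiable ℝ F)
    (hL : ∀ x y, ‖gradient F x - gradient F y‖ ≤ L * ‖x - y‖) (hFs : ∀ x, Fs ≤ F x)
    (hβ : 0 < β) (hLβ : L * β ≤ 1) (x : E) :
    β / 2 * ‖gradient F x‖ ^ 2 ≤ F x - Fs := by
  have h := le_add_inner_add_of_gradient_lipschitz hF hL x (x - β • gradient F x)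
  have h' := hFs (x - β • gradient F x)
  rw [sub_sub_cancel_left, inner_neg_right, real_inner_smul_right, real_inner_self_eq_norm_sq,
    norm_neg, norm_smul, Real.norm_of_nonneg hβ.le] at h
  have : L / 2 * (β * ‖gradient F x‖) ^ 2 ≤ β / 2 * ‖gradient F x‖ ^ 2 := by
    have : L * β * (β / 2 * ‖gradient F x‖ ^ 2) ≤ 1 * (β / 2 * ‖gradient F x‖ ^ 2) := by gcongr
    linarith
  linarith

end Smoothness

/-! ### The accelerated scheme with inexact gradients -/

section Deterministic

variable {E : Type*} [NormedAddCommGroup E] [InnerProductSpace ℝ E]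

lemma dimMomentum_succ (t : ℕ) : dimMomentum (t + 1) = 2 / ((t : ℝ) + 2) := by
  unfold dimMomentum; push_cast; ring

lemma one_sub_dimMomentum_succ (t : ℕ) : 1 - dimMomentum (t + 1) = t / ((t : ℝ) + 2) := by
  rw [dimMomentum_succ]; field_simp; ring

/-- The iterates of the accelerated scheme along the directions `v t`. -/
structure IsScheme (β : ℝ) (lam : ℕ → ℝ) (x y z v : ℕ → E) : Prop where
  init : y 0 = x 0
  z_eq : ∀ t, z t = (1 - dimMomentum (t + 1)) • y t + dimMomentum (t + 1) • x t
  x_succ : ∀ t, x (t + 1) = x t - lam t • v t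
  y_succ : ∀ t, y (t + 1) = z t - β • v t
  β_pos : 0 < β
  lam_mem : ∀ t, lam t ∈ Set.Icc β ((1 + dimMomentum t) * β)

namespace IsScheme

variable {β : ℝ} {lam : ℕ → ℝ} {x y z v : ℕ → E}

lemma y_sub_x_succ (h : IsScheme β lam x y z v) (t : ℕ) :
    y (t + 1) - x (t + 1) = (t / ((t : ℝ) + 2)) • (y t - x t) + (lam t - β) • v t := by
  rw [h.y_succ, h.x_succ, h.z_eq, ← one_sub_dimMomentum_succ]
  module

lemma z_sub_x (h : IsScheme β lam x y z v) (t : ℕ) :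
    z t - x t = (t / ((t : ℝ) + 2)) • (y t - x t) := by
  rw [h.z_eq, ← one_sub_dimMomentum_succ]
  module

lemma z_succ_sub_z (h : IsScheme β lam x y z v) (t : ℕ) :
    z (t + 1) - z t = (((t : ℝ) + 1) / ((t : ℝ) + 3)) • (y (t + 1) - x (t + 1))
      + (x (t + 1) - y (t + 1)) - β • v t := by
  have e : ((t : ℝ) + 1) / ((t : ℝ) + 3) = 1 - dimMomentum (t + 1 + 1) := by
    rw [one_sub_dimMomentum_succ]; push_cast; ring_nf
  rw [e]
  conv_lhs => rw [h.z_eq (t + 1)]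
  have := h.y_succ t
  have hz : z t = y (t + 1) + β • v t := by rw [this]; abel
  rw [hz]
  module

/-- The gap is multiplied by `t / (t + 2)` and perturbed by `(lam t - β) • v t`. Convexity of the
square with weights `t / (t + 2)` and `2 / (t + 2)` gives the bound. The weights `t + 2` and `t` are
such that summation leaves one copy of `‖y t - x t‖²` per step. -/
lemma norm_sq_y_sub_x_succ_le (h : IsScheme β lam x y z v) (t : ℕ) :
    (t + 2) * ‖y (t + 1) - x (t + 1)‖ ^ 2 ≤ t * ‖y t - x t‖ ^ 2 + 8 * β ^ 2 * ‖v t‖ ^ 2 := by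
  have hβ := h.β_pos
  obtain ⟨hl1, hl2⟩ := h.lam_mem t
  have ht : (0 : ℝ) ≤ t := t.cast_nonneg
  set X := ‖y t - x t‖
  set Y := ‖v t‖
  have hX : 0 ≤ X := norm_nonneg _
  have hY : 0 ≤ Y := norm_nonneg _
  have hμ : (lam t - β) * (t + 1) ≤ 2 * β := by
    have : lam t - β ≤ 2 / ((t : ℝ) + 1) * β := by unfold dimMomentum at hl2; linarith
    calc _ ≤ 2 / ((t : ℝ) + 1) * β * (t + 1) := by gcongr
      _ = _ := by field_simp
  set μ := lam t - β
  have hμ0 : 0 ≤ μ := by simp only [μ]; linarith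
  have hn : ‖y (t + 1) - x (t + 1)‖ ≤ t / ((t : ℝ) + 2) * X + μ * Y := by
    rw [h.y_sub_x_succ]
    refine (norm_add_le _ _).trans ?_
    rw [norm_smul, norm_smul, Real.norm_of_nonneg (by positivity), Real.norm_of_nonneg hμ0]
  have h2 : (t + 2) * ‖y (t + 1) - x (t + 1)‖ ^ 2 ≤ (t + 2) * (t / ((t : ℝ) + 2) * X + μ * Y) ^ 2 := by
    gcongr
  refine h2.trans ?_
  have h3 : (t + 2) * (t / ((t : ℝ) + 2) * X + μ * Y) ^ 2
      ≤ t * X ^ 2 + (t + 2) ^ 2 / 2 * μ ^ 2 * Y ^ 2 := by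
    have : t * X ^ 2 + (t + 2) ^ 2 / 2 * μ ^ 2 * Y ^ 2 -
      (t + 2) * (t / ((t : ℝ) + 2) * X + μ * Y) ^ 2
        = t * (t + 2) / 2 * (μ * Y - 2 / (t + 2) * X) ^ 2 := by
      field_simp; ring
    have : 0 ≤ t * (t + 2) / 2 * (μ * Y - 2 / ((t : ℝ) + 2) * X) ^ 2 := by positivity
    linarith
  have h4 : (t + 2) ^ 2 / 2 * μ ^ 2 ≤ 8 * β ^ 2 := by
    -- From `(t + 1) μ ≤ 2 β` and `t + 2 ≤ 2 (t + 1)`.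
    have : (t + 2) * μ ≤ 4 * β := by nlinarith
    have : ((t + 2) * μ) ^ 2 ≤ (4 * β) ^ 2 := by gcongr
    nlinarith
  have h5 : (t + 2) ^ 2 / 2 * μ ^ 2 * Y ^ 2 ≤ 8 * β ^ 2 * Y ^ 2 := by gcongr
  linarith

lemma sum_norm_sq_y_sub_x_le (h : IsScheme β lam x y z v) (T : ℕ) :
    (T + 1) * ‖y T - x T‖ ^ 2 + ∑ t ∈ Finset.range T, ‖y t - x t‖ ^ 2
      ≤ 8 * β ^ 2 * ∑ t ∈ Finset.range T, ‖v t‖ ^ 2 := by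
  induction T with
  | zero => simp [h.init]
  | succ T ih =>
    rw [Finset.sum_range_succ, Finset.sum_range_succ, mul_add]
    have := h.norm_sq_y_sub_x_succ_le T
    push_cast
    linarith

/-- The increment of `z` is `-(2 / (t + 3)) (y - x) - β v`, with the gap taken at `t + 1`. In `10 =
2 + 8`, the `2` comes from `β v` and the `8` from the summed gaps. The index shift adds the gap at
`T`, which the boundary term of `sum_norm_sq_y_sub_x_le` covers. -/
lemma sum_norm_sq_z_succ_sub_z_le (h : IsScheme β lam x y z v) (T : ℕ) :
    ∑ t ∈ Finset.range T, ‖z (t + 1) - z t‖ ^ 2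
      ≤ 10 * β ^ 2 * ∑ t ∈ Finset.range T, ‖v t‖ ^ 2 := by
  have hβ := h.β_pos
  have h1 : ∀ t, ‖z (t + 1) - z t‖ ^ 2
      ≤ 2 * β ^ 2 * ‖v t‖ ^ 2 + ‖y (t + 1) - x (t + 1)‖ ^ 2 := by
    intro t
    have ht : (0 : ℝ) ≤ t := t.cast_nonneg
    have e : z (t + 1) - z t
        = -(2 / ((t : ℝ) + 3)) • (y (t + 1) - x (t + 1)) + -(β • v t) := by
      rw [h.z_succ_sub_z]
      have : -(2 / ((t : ℝ) + 3)) = (t + 1) / ((t : ℝ) + 3) - 1 := by field_simp; ring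
      rw [this]; module
    have hn : ‖z (t + 1) - z t‖ ≤ 2 / ((t : ℝ) + 3) * ‖y (t + 1) - x (t + 1)‖ + β * ‖v t‖ := by
      rw [e]
      refine (norm_add_le _ _).trans ?_
      rw [norm_smul, norm_neg, norm_neg, norm_smul, Real.norm_of_nonneg (by positivity),
        Real.norm_of_nonneg hβ.le]
    have hα : 2 / ((t : ℝ) + 3) ≤ 2 / 3 := by gcongr; linarith
    set W := ‖y (t + 1) - x (t + 1)‖
    have hW : 0 ≤ W := norm_nonneg _
    have hn' : ‖z (t + 1) - z t‖ ≤ 2 / 3 * W + β * ‖v t‖ := hn.trans (by gcongr)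
    have : ‖z (t + 1) - z t‖ ^ 2 ≤ (2 / 3 * W + β * ‖v t‖) ^ 2 := by gcongr
    nlinarith [sq_nonneg (2 / 3 * W - β * ‖v t‖), sq_nonneg W]
  have h2 := h.sum_norm_sq_y_sub_x_le T
  have h3 : ∑ t ∈ Finset.range T, ‖y (t + 1) - x (t + 1)‖ ^ 2
      = ∑ t ∈ Finset.range T, ‖y t - x t‖ ^ 2 + ‖y T - x T‖ ^ 2 := by
    have := Finset.sum_range_succ' (fun t => ‖y t - x t‖ ^ 2) T
    rw [Finset.sum_range_succ] at this
    simpa [h.init] using this.symm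
  have h4 := Finset.sum_le_sum (s := Finset.range T) fun t _ => h1 t
  rw [Finset.sum_add_distrib, ← Finset.mul_sum, h3] at h4
  have h5 : 0 ≤ (T : ℝ) * ‖y T - x T‖ ^ 2 := by positivity
  linarith

/-- One step of the scheme decreases the objective, up to the gradient error and the momentum. -/
lemma objective_succ_le (h : IsScheme β lam x y z v) {F : E → ℝ} {gF : E → E} {L : ℝ}
    (hL0 : 0 ≤ L) (hdesc : ∀ a b, F b ≤ F a + inner ℝ (gF a) (b - a) + L / 2 * ‖b - a‖ ^ 2)
    (hlip : ∀ a b, ‖gF a - gF b‖ ≤ L * ‖a - b‖) (hLβ : L * β ≤ 1 / 16) (t : ℕ) :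
    F (x (t + 1)) + β / 2 * ‖gF (z t)‖ ^ 2 + 30 / 100 * β * ‖v t‖ ^ 2
      ≤ F (x t) + 3 / 2 * β * ‖v t - gF (z t)‖ ^ 2 + 1 / (96 * β) * ‖y t - x t‖ ^ 2 := by
  have hβ := h.β_pos
  obtain ⟨hl1, hl2⟩ := h.lam_mem t
  have ht : (0 : ℝ) ≤ t := t.cast_nonneg
  -- The worst case is `t = 0`, where `dimMomentum 0 = 2`.
  have hlam3 : lam t ≤ 3 * β := by
    refine hl2.trans ?_
    gcongr
    have : dimMomentum t ≤ 2 := by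
      unfold dimMomentum
      rw [div_le_iff₀ (by positivity)]; linarith
    linarith
  set w := ‖y t - x t‖
  set V := ‖v t‖
  have hw : 0 ≤ w := norm_nonneg _
  have hV : 0 ≤ V := norm_nonneg _
  have hd := hdesc (x t) (x (t + 1))
  have e1 : x (t + 1) - x t = -(lam t • v t) := by rw [h.x_succ]; abel
  rw [e1, inner_neg_right, real_inner_smul_right, norm_neg, norm_smul,
    Real.norm_of_nonneg (by linarith)] at hd
  have e2 : inner ℝ (gF (x t)) (v t) = inner ℝ (gF (z t)) (v t)
      - inner ℝ (gF (z t) - gF (x t)) (v t) := by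
    rw [inner_sub_left]; ring
  have e3 : inner ℝ (gF (z t) - gF (x t)) (v t) ≤ L * (t / ((t : ℝ) + 2) * w) * V := by
    refine (real_inner_le_norm _ _).trans ?_
    gcongr
    refine (hlip _ _).trans (le_of_eq ?_)
    rw [h.z_sub_x, norm_smul, Real.norm_of_nonneg (by positivity)]
  have e4 : inner ℝ (gF (z t)) (v t)
      = 1 / 2 * ‖gF (z t)‖ ^ 2 + 1 / 2 * V ^ 2 - 1 / 2 * ‖v t - gF (z t)‖ ^ 2 := by
    have := norm_sub_sq_real (v t) (gF (z t))
    rw [real_inner_comm] at this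
    simp only [V]; linarith
  -- The contraction of `z t - x t` compensates the enlarged step: `(t + 3) / (t + 1) * t / (t + 2)
  -- ≤ 1`.
  have e5 : lam t * (t / ((t : ℝ) + 2)) ≤ β := by
    calc _ ≤ ((1 + dimMomentum t) * β) * (t / ((t : ℝ) + 2)) := by gcongr
      _ = (t ^ 2 + 3 * t) / (t ^ 2 + 3 * t + 2) * β := by
        unfold dimMomentum
        have : (t : ℝ) ^ 2 + 3 * t + 2 = (t + 1) * (t + 2) := by ring
        rw [this]; field_simp; ring
      _ ≤ 1 * β := by
        gcongr
        rw [div_le_one (by positivity)]; linarith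
      _ = β := one_mul β
  -- Young's inequality. The weight `1 / (96 β)` on the gap turns into `β / 12` once the gaps are
  -- summed. What remains for `‖v t‖²` is `1/2 - 9/96 - 3/32 > 30/100`.
  have e6 : lam t * (L * (t / ((t : ℝ) + 2) * w) * V)
      ≤ 1 / (96 * β) * w ^ 2 + 9 / 96 * β * V ^ 2 := by
    calc lam t * (L * (t / ((t : ℝ) + 2) * w) * V)
        = lam t * (t / ((t : ℝ) + 2)) * (L * w * V) := by ring
      _ ≤ β * (L * w * V) := by gcongr
      _ = L * β * (w * V) := by ring
      _ ≤ 1 / 16 * (w * V) := by gcongr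
      _ ≤ 1 / (96 * β) * w ^ 2 + 9 / 96 * β * V ^ 2 := by
        have : 0 ≤ 1 / (96 * β) * (w - 3 * β * V) ^ 2 := by positivity
        have e : 1 / (96 * β) * (w - 3 * β * V) ^ 2
          = 1 / (96 * β) * w ^ 2 + 9 / 96 * β * V ^ 2 - 1 / 16 * (w * V) := by
            field_simp; ring
        linarith
  have e7 : L / 2 * (lam t * V) ^ 2 ≤ 3 / 32 * (lam t * V ^ 2) := by
    have : L * lam t ≤ 3 / 16 := by nlinarith
    have : L * lam t * (lam t * V ^ 2) ≤ 3 / 16 * (lam t * V ^ 2) := by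
      gcongr
      have : 0 ≤ lam t := by linarith
      positivity
    nlinarith
  have e8 := mul_le_mul_of_nonneg_left e3 (show 0 ≤ lam t by linarith)
  have e9 : β * V ^ 2 ≤ lam t * V ^ 2 := by gcongr
  have e10 : β * ‖gF (z t)‖ ^ 2 ≤ lam t * ‖gF (z t)‖ ^ 2 := by gcongr
  have e11 : lam t * ‖v t - gF (z t)‖ ^ 2 ≤ 3 * β * ‖v t - gF (z t)‖ ^ 2 := by gcongr
  rw [e2, e4] at hd
  nlinarith

/-- The sum of the squared gradients along the scheme, up to the errors of the gradient
estimates and the distances between successive points. -/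
lemma sum_norm_sq_gradient_le (h : IsScheme β lam x y z v) {F : E → ℝ} {gF : E → E} {L G Fs : ℝ}
    (hL0 : 0 ≤ L) (hdesc : ∀ a b, F b ≤ F a + inner ℝ (gF a) (b - a) + L / 2 * ‖b - a‖ ^ 2)
    (hlip : ∀ a b, ‖gF a - gF b‖ ≤ L * ‖a - b‖) (hFs : ∀ a, Fs ≤ F a)
    (hLβ : L * β ≤ 1 / 16) (hG0 : 0 ≤ G) (hGβ : G * β ^ 2 ≤ 1 / 128) (T : ℕ) :
    β / 2 * ∑ t ∈ Finset.range T, ‖gF (z t)‖ ^ 2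
      ≤ F (x 0) - Fs + 3 / 2 * β * (∑ t ∈ Finset.range T, ‖v t - gF (z t)‖ ^ 2
        - G * ∑ t ∈ Finset.range T, ‖z (t + 1) - z t‖ ^ 2) := by
  have hβ := h.β_pos
  set V := ∑ t ∈ Finset.range T, ‖v t‖ ^ 2
  have hV : 0 ≤ V := Finset.sum_nonneg fun _ _ => by positivity
  have h1 : F (x T) + β / 2 * ∑ t ∈ Finset.range T, ‖gF (z t)‖ ^ 2 + 30 / 100 * β * V
      ≤ F (x 0) + 3 / 2 * β * ∑ t ∈ Finset.range T, ‖v t - gF (z t)‖ ^ 2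
        + 1 / (96 * β) * ∑ t ∈ Finset.range T, ‖y t - x t‖ ^ 2 := by
    simp only [V]
    clear_value V
    clear hV V
    induction T with
    | zero => simp
    | succ T ih =>
      simp only [Finset.sum_range_succ, mul_add]
      have := h.objective_succ_le hL0 hdesc hlip hLβ T
      linarith
  have h2 : 1 / (96 * β) * ∑ t ∈ Finset.range T, ‖y t - x t‖ ^ 2 ≤ 1 / 12 * β * V := by
    have := h.sum_norm_sq_y_sub_x_le T
    have h5 : 0 ≤ ((T : ℝ) + 1) * ‖y T - x T‖ ^ 2 := by positivity
    calc _ ≤ 1 / (96 * β) * (8 * β ^ 2 * V) := by gcongr; linarith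
      _ = _ := by field_simp; ring
  have h3 : G * ∑ t ∈ Finset.range T, ‖z (t + 1) - z t‖ ^ 2 ≤ 10 / 128 * V := by
    calc _ ≤ G * (10 * β ^ 2 * V) := by gcongr; exact h.sum_norm_sq_z_succ_sub_z_le T
      _ = G * β ^ 2 * (10 * V) := by ring
      _ ≤ 1 / 128 * (10 * V) := by gcongr
      _ = _ := by ring
  have h4 := hFs (x T)
  have h5 := mul_le_mul_of_nonneg_left h3 hβ.le
  have h6 : 0 ≤ β * V := by positivity
  -- The gained `30/100` exceeds the total cost `1/12 + 3/2 * 10/128` in units of `β V`.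
  nlinarith

end IsScheme

/-- A quantity that is reset to at most `δ` every `τ` steps and grows by at most `G / τ * a t` in
between has sum at most `T * δ + G * ∑ a t`. -/
lemma sum_le_of_epoch_recursion {τ : ℕ} (hτ : 0 < τ) {e a : ℕ → ℝ} {G δ : ℝ} (hG : 0 ≤ G)
    (ha : ∀ t, 0 ≤ a t) (hreset : ∀ t, t % τ = 0 → e t ≤ δ)
    (hrec : ∀ t, (t + 1) % τ ≠ 0 → e (t + 1) ≤ e t + G / τ * a t) (T : ℕ) :
    ∑ t ∈ Finset.range T, e t ≤ T * δ + G * ∑ t ∈ Finset.range T, a t := by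
  have hτ' : (0 : ℝ) < τ := by exact_mod_cast hτ
  -- The growth accumulated since the last reset.
  let U : ℕ → ℝ := fun t => Nat.rec 0 (fun t u => if (t + 1) % τ = 0 then 0 else u + G / τ * a t) t
  have U0 : U 0 = 0 := rfl
  have Us : ∀ t, U (t + 1) = if (t + 1) % τ = 0 then 0 else U t + G / τ * a t := fun t => rfl
  have hU : ∀ t, e t ≤ U t + δ := by
    intro t
    induction t with
    | zero => rw [U0, zero_add]; exact hreset 0 (Nat.zero_mod _)
    | succ t ih =>
      rw [Us]
      split_ifs with h
      · rw [zero_add]; exact hreset _ h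
      · have := hrec t h; linarith
  have U_nonneg : ∀ t, 0 ≤ U t := by
    intro t
    induction t with
    | zero => exact le_rfl
    | succ t ih =>
      rw [Us]
      split_ifs
      · exact le_rfl
      · have := ha t; positivity
  have hmod : ∀ T : ℕ, (T + 1) % τ = (T % τ + 1) % τ := fun T => by simp
  -- The second summand prepays the contribution of the current `U T` to the rest of its epoch. Each
  -- increment `G / τ * a t` is then counted at most `τ` times.
  have key : ∀ T : ℕ, ∑ t ∈ Finset.range (T + 1), U t + (τ - 1 - (T % τ : ℕ)) * U T
      ≤ G * ∑ t ∈ Finset.range T, a t := by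
    intro T
    induction T with
    | zero => simp [U0]
    | succ T ih =>
      rw [Finset.sum_range_succ, Finset.sum_range_succ (fun t => a t), mul_add]
      have hGa := mul_nonneg hG (ha T)
      have h1 := Nat.mod_lt T hτ
      rcases Nat.lt_or_ge (T % τ + 1) τ with h2 | h2
      · have hm : (T + 1) % τ = T % τ + 1 := by rw [hmod, Nat.mod_eq_of_lt h2]
        rw [hm, Us, if_neg (by omega)]
        push_cast
        have h3 : ((τ : ℝ) - 1 - (T % τ : ℕ)) * (G / τ * a T) ≤ τ * (G / τ * a T) := by
          gcongr
          · have := ha T; positivity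
          · have : (0 : ℝ) ≤ (T % τ : ℕ) := Nat.cast_nonneg _
            linarith
        have h4 : τ * (G / τ * a T) = G * a T := by field_simp
        linarith
      · have hm' : T % τ = τ - 1 := by omega
        have hm : (T + 1) % τ = 0 := by rw [hmod, hm', Nat.sub_add_cancel hτ, Nat.mod_self]
        rw [hm', Nat.cast_sub hτ] at ih
        rw [Us, if_pos hm]
        simp at ih ⊢
        linarith
  have hsum : ∑ t ∈ Finset.range T, U t ≤ G * ∑ t ∈ Finset.range T, a t := by
    rcases T with _ | T
    · simp
    · refine le_trans ?_ ((key T).trans ?_)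
      · have h1 : T % τ + 1 ≤ τ := Nat.mod_lt T hτ
        have h2 : ((T % τ : ℕ) : ℝ) + 1 ≤ τ := by exact_mod_cast h1
        have := mul_nonneg (show (0 : ℝ) ≤ τ - 1 - (T % τ : ℕ) by linarith) (U_nonneg T)
        linarith
      · gcongr
        · exact fun i _ _ => ha i
        · exact Nat.le_succ T
  calc ∑ t ∈ Finset.range T, e t ≤ ∑ t ∈ Finset.range T, (U t + δ) :=
        Finset.sum_le_sum fun t _ => hU t
    _ = T * δ + ∑ t ∈ Finset.range T, U t := by
        rw [Finset.sum_add_distrib, Finset.sum_const, Finset.card_range, nsmul_eq_mul, add_comm]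
    _ ≤ _ := by gcongr

end Deterministic

/-! ### Batch laws -/

section BatchLaw

variable {Ξ : Type*} [MeasurableSpace Ξ]

/-- The batch average of a square integrable real function is unbiased, and its variance is at
most `C` times the variance of a single sample. -/
def BatchLaw (D : Measure Ξ) {b : ℕ} (ν : Measure (Fin b → Ξ)) (C : ℝ) : Prop :=
  ∀ h : Ξ → ℝ, Measurable h → MemLp h 2 D →
    MemLp (fun a : Fin b → Ξ => avg fun i => h (a i)) 2 ν ∧
    ∫ a, avg (fun i => h (a i)) ∂ν = ∫ ξ, h ξ ∂D ∧
    Var[fun a : Fin b → Ξ => avg fun i => h (a i); ν] ≤ C * Var[h; D]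

lemma batchLaw_pi (D : Measure Ξ) [IsProbabilityMeasure D] {b : ℕ} (hb : 0 < b) :
    BatchLaw D (Measure.pi fun _ : Fin b => D) (b : ℝ)⁻¹ := by
  intro h hm hL
  have hb' : (b : ℝ) ≠ 0 := by exact_mod_cast hb.ne'
  have hLi : ∀ i : Fin b, MemLp (fun a : Fin b → Ξ => h (a i)) 2 (Measure.pi fun _ => D) :=
    fun i => hL.comp_measurePreserving (measurePreserving_eval (fun _ => D) i)
  refine ⟨?_, ?_, ?_⟩
  · exact (memLp_finsetSum Finset.univ fun i _ => hLi i).const_smul (b : ℝ)⁻¹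
  · simp only [avg]
    rw [integral_smul, integral_finsetSum _ fun i _ => (hLi i).integrable one_le_two]
    have : ∀ i : Fin b, ∫ a : Fin b → Ξ, h (a i) ∂(Measure.pi fun _ => D) = ∫ ξ, h ξ ∂D :=
      fun i => by
        conv_rhs => rw [← (measurePreserving_eval (fun _ : Fin b => D) i).map_eq]
        rw [integral_map (measurable_pi_apply i).aemeasurable hm.aestronglyMeasurable]
    simp [this, hb']
  · simp only [avg]
    have e : (fun a : Fin b → Ξ => (b : ℝ)⁻¹ • ∑ i, h (a i))
        = (b : ℝ)⁻¹ • ∑ i, fun a : Fin b → Ξ => h (a i) := by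
      ext a; simp
    rw [e, variance_smul, variance_sum_pi fun _ => hL]
    simp only [Finset.sum_const, Finset.card_univ, Fintype.card_fin, nsmul_eq_mul]
    rw [← mul_assoc]
    apply le_of_eq
    congr 1
    field_simp

lemma integral_uniformOn_univ_fin_eq_avg {n : ℕ} {V : Type*} [NormedAddCommGroup V]
    [NormedSpace ℝ V] [CompleteSpace V] (h : Fin n → V) :
    ∫ i, h i ∂(uniformOn Set.univ) = avg h := by
  rw [integral_fintype .of_finite, avg, Finset.smul_sum]
  refine Finset.sum_congr rfl fun i _ => ?_
  rw [Measure.real, uniformOn_univ]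
  simp

lemma integral_uniformOn_univ_fin {n : ℕ} (h : Fin n → ℝ) :
    ∫ i, h i ∂(uniformOn Set.univ) = (n : ℝ)⁻¹ * ∑ i, h i :=
  integral_uniformOn_univ_fin_eq_avg h

/-! ### Symmetrization over permutations, for sampling without replacement -/

section Permutations

variable {n : ℕ}

lemma sum_perm_apply_eq (h : Fin n → ℝ) (k l : Fin n) :
    ∑ σ : Equiv.Perm (Fin n), h (σ k) = ∑ σ : Equiv.Perm (Fin n), h (σ l) := by
  rw [← Equiv.sum_comp (Equiv.mulRight (Equiv.swap k l))]
  simp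

lemma mul_sum_perm_apply (h : Fin n → ℝ) (k : Fin n) :
    n * ∑ σ : Equiv.Perm (Fin n), h (σ k) = (n.factorial : ℝ) * ∑ i, h i := by
  have h1 : ∑ l : Fin n, ∑ σ : Equiv.Perm (Fin n), h (σ l)
      = n * ∑ σ : Equiv.Perm (Fin n), h (σ k) := by
    rw [Finset.sum_congr rfl fun l _ => sum_perm_apply_eq h l k]
    simp
  rw [← h1, Finset.sum_comm]
  rw [Finset.sum_congr rfl fun (σ : Equiv.Perm (Fin n)) _ => Equiv.sum_comp σ h]
  simp [Fintype.card_perm]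

/-- By symmetry the sum is the same for every `l ≠ k`. Together with the nonnegative term `l = k`
these sums add up to zero, because `∑ X = 0`. Hence distinct draws are nonpositively correlated. -/
lemma sum_perm_mul_nonpos (X : Fin n → ℝ) (hX : ∑ i, X i = 0) {k l : Fin n} (hkl : k ≠ l) :
    ∑ σ : Equiv.Perm (Fin n), X (σ k) * X (σ l) ≤ 0 := by
  have hc : ∀ j, j ≠ k → ∑ σ : Equiv.Perm (Fin n), X (σ k) * X (σ j)
      = ∑ σ : Equiv.Perm (Fin n), X (σ k) * X (σ l) := by
    intro j hj
    rw [← Equiv.sum_comp (Equiv.mulRight (Equiv.swap j l))]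
    refine Finset.sum_congr rfl fun σ _ => ?_
    simp [Equiv.swap_apply_of_ne_of_ne hj.symm hkl]
  have h0 : ∑ j, ∑ σ : Equiv.Perm (Fin n), X (σ k) * X (σ j) = 0 := by
    rw [Finset.sum_comm]
    refine Finset.sum_eq_zero fun σ _ => ?_
    rw [← Finset.mul_sum, Equiv.sum_comp σ X, hX, mul_zero]
  rw [← Finset.add_sum_erase _ _ (Finset.mem_univ k),
    Finset.sum_congr rfl fun j hj => hc j (Finset.ne_of_mem_erase hj), Finset.sum_const,
    nsmul_eq_mul] at h0
  have hsq : 0 ≤ ∑ σ : Equiv.Perm (Fin n), X (σ k) * X (σ k) :=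
    Finset.sum_nonneg fun σ _ => mul_self_nonneg _
  have hcard : 0 < (((Finset.univ.erase k).card : ℕ) : ℝ) := by
    have : l ∈ Finset.univ.erase k := by simp [hkl.symm]
    exact_mod_cast Finset.card_pos.2 ⟨l, this⟩
  by_contra! hpos
  have := mul_pos hcard hpos
  linarith

lemma integral_uniformOn_injective_comp {b : ℕ} (φ : (Fin b → Fin n) → ℝ)
    (σ : Equiv.Perm (Fin n)) :
    ∫ a, φ (σ ∘ a) ∂(uniformOn {a : Fin b → Fin n | Function.Injective a})
      = ∫ a, φ a ∂(uniformOn {a : Fin b → Fin n | Function.Injective a}) := by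
  rw [integral_fintype .of_finite, integral_fintype .of_finite]
  conv_rhs => rw [← Equiv.sum_comp (Equiv.arrowCongr (Equiv.refl (Fin b)) σ)]
  refine Finset.sum_congr rfl fun a _ => ?_
  have e : Equiv.arrowCongr (Equiv.refl (Fin b)) σ a = σ ∘ a := rfl
  rw [e]
  congr 1
  rw [Measure.real, Measure.real, uniformOn, cond_apply (Set.toFinite _).measurableSet,
    cond_apply (Set.toFinite _).measurableSet]
  congr 2
  by_cases ha : Function.Injective a
  · have ha' : Function.Injective (σ ∘ a) := σ.injective.comp ha
    rw [Set.inter_eq_self_of_subset_right (by simpa using ha),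
      Set.inter_eq_self_of_subset_right (by simpa using ha')]
    simp
  · have ha' : ¬ Function.Injective (σ ∘ a) := fun h => ha h.of_comp
    rw [Set.inter_singleton_eq_empty.2 (by simpa using ha),
      Set.inter_singleton_eq_empty.2 (by simpa using ha')]

/-- The law of an injective tuple is invariant under relabelling of its values. Averaging over all
permutations reduces a moment to a sum that can be treated for each fixed tuple `a`. -/
lemma factorial_mul_integral_uniformOn_injective {b : ℕ} (φ : (Fin b → Fin n) → ℝ) :
    (n.factorial : ℝ) * ∫ a, φ a ∂(uniformOn {a : Fin b → Fin n | Function.Injective a})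
      = ∫ a, ∑ σ : Equiv.Perm (Fin n), φ (σ ∘ a)
          ∂(uniformOn {a : Fin b → Fin n | Function.Injective a}) := by
  rw [integral_finsetSum _ fun σ _ => .of_finite]
  simp [integral_uniformOn_injective_comp φ, Fintype.card_perm]

end Permutations

lemma isProbabilityMeasure_uniformOn_injective {b n : ℕ} (hbn : b ≤ n) :
    IsProbabilityMeasure (uniformOn {a : Fin b → Fin n | Function.Injective a}) :=
  isProbabilityMeasure_uniformOn (Set.toFinite _) ⟨Fin.castLE hbn, Fin.castLE_injective hbn⟩

lemma integral_uniformOn_injective_apply {b n : ℕ} (hbn : b ≤ n) (h : Fin n → ℝ)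
    (i : Fin b) :
    ∫ a, h (a i) ∂(uniformOn {a : Fin b → Fin n | Function.Injective a})
      = ∫ k, h k ∂(uniformOn Set.univ) := by
  have := isProbabilityMeasure_uniformOn_injective hbn
  have hn : (n : ℝ) ≠ 0 := by
    have := i.pos
    exact_mod_cast (by omega : n ≠ 0)
  have hf : (n.factorial : ℝ) ≠ 0 := by exact_mod_cast n.factorial_ne_zero
  have h1 := factorial_mul_integral_uniformOn_injective (n := n) fun a : Fin b → Fin n => h (a i)
  -- After symmetrization the integrand no longer depends on `a`.
  have h2 : ∀ a : Fin b → Fin n, ∑ σ : Equiv.Perm (Fin n), h ((σ ∘ a) i)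
      = (n : ℝ)⁻¹ * ((n.factorial : ℝ) * ∑ i, h i) := by
    intro a
    rw [← mul_sum_perm_apply h (a i), ← mul_assoc, inv_mul_cancel₀ hn, one_mul]
    rfl
  simp only [h2] at h1
  rw [integral_const, probReal_univ, one_smul] at h1
  rw [integral_uniformOn_univ_fin]
  apply mul_left_cancel₀ hf
  rw [h1]; ring

/-- In the expanded variance the diagonal terms are those of independent sampling and the
off-diagonal ones are nonpositive, so the constant `1 / b` of independent samples still serves. -/
lemma batchLaw_uniformOn_injective {b n : ℕ} (hb : 0 < b) (hbn : b ≤ n) :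
    BatchLaw (uniformOn (Set.univ : Set (Fin n)))
      (uniformOn {a : Fin b → Fin n | Function.Injective a}) (b : ℝ)⁻¹ := by
  intro h _ _
  have := isProbabilityMeasure_uniformOn_injective hbn
  have hn : 0 < n := by omega
  have : Nonempty (Fin n) := ⟨⟨0, hn⟩⟩
  have : IsProbabilityMeasure (uniformOn (Set.univ : Set (Fin n))) :=
    isProbabilityMeasure_uniformOn (Set.toFinite _) Set.univ_nonempty
  have hb' : (b : ℝ) ≠ 0 := by exact_mod_cast hb.ne'
  have hn' : (n : ℝ) ≠ 0 := by exact_mod_cast hn.ne'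
  set ν := uniformOn {a : Fin b → Fin n | Function.Injective a} with hν
  set c := ∫ k, h k ∂(uniformOn (Set.univ : Set (Fin n))) with hc
  have hmean : ∫ a, avg (fun i => h (a i)) ∂ν = c := by
    simp only [avg]
    rw [integral_smul, integral_finsetSum _ fun i _ => .of_finite,
      Finset.sum_congr rfl fun i _ => integral_uniformOn_injective_apply hbn h i]
    simp [hb', hc]
  refine ⟨.of_discrete, hmean, ?_⟩
  rw [variance_eq_integral (Measurable.of_discrete.aemeasurable), variance_eq_integral (by fun_prop), hmean, ← hc]
  set X : Fin n → ℝ := fun k => h k - c with hX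
  have hX0 : ∑ k, X k = 0 := by
    rw [integral_uniformOn_univ_fin] at hc
    simp only [hX, Finset.sum_sub_distrib, Finset.sum_const, Finset.card_univ, Fintype.card_fin,
      nsmul_eq_mul]
    rw [hc]; field_simp; ring
  have e1 : ∀ a : Fin b → Fin n, (avg (fun i => h (a i)) - c) ^ 2
      = (b : ℝ)⁻¹ ^ 2 * ∑ i, ∑ j, X (a i) * X (a j) := by
    intro a
    have : avg (fun i => h (a i)) - c = (b : ℝ)⁻¹ * ∑ i, X (a i) := by
      simp only [avg, hX, Finset.sum_sub_distrib, Finset.sum_const, Finset.card_univ,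
        Fintype.card_fin, nsmul_eq_mul, smul_eq_mul]
      field_simp
    rw [this, mul_pow, sq (∑ i, X (a i)), Finset.sum_mul_sum]
  simp only [e1]
  rw [integral_const_mul, integral_finsetSum _ fun i _ => .of_finite,
    Finset.sum_congr rfl fun i _ => integral_finsetSum _ fun i _ => .of_finite]
  have hdiag : ∀ i : Fin b, ∫ a : Fin b → Fin n, X (a i) * X (a i) ∂ν
      = ∫ k, X k ^ 2 ∂(uniformOn (Set.univ : Set (Fin n))) := by
    intro i
    rw [← integral_uniformOn_injective_apply hbn (fun k => X k ^ 2) i]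
    simp only [sq, hν]
  have hoff : ∀ i j : Fin b, i ≠ j → ∫ a : Fin b → Fin n, X (a i) * X (a j) ∂ν ≤ 0 := by
    intro i j hij
    have hf : (0 : ℝ) < n.factorial := by exact_mod_cast n.factorial_pos
    have h1 := factorial_mul_integral_uniformOn_injective (n := n)
      fun a : Fin b → Fin n => X (a i) * X (a j)
    have hae : ∀ᵐ a ∂ν, Function.Injective a := by
      rw [hν, uniformOn]
      exact ae_cond_mem (Set.toFinite _).measurableSet
    have h2 : ∫ a, ∑ σ : Equiv.Perm (Fin n), X ((σ ∘ a) i) * X ((σ ∘ a) j) ∂ν ≤ 0 := by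
      refine integral_nonpos_of_ae ?_
      filter_upwards [hae] with a ha
      exact sum_perm_mul_nonpos X hX0 fun h => hij (ha h)
    rw [← h1] at h2
    exact nonpos_of_mul_nonpos_right h2 hf
  have hsum : ∑ i, ∑ j, ∫ a : Fin b → Fin n, X (a i) * X (a j) ∂ν
      ≤ b * ∫ k, X k ^ 2 ∂(uniformOn (Set.univ : Set (Fin n))) := by
    calc _ ≤ ∑ i : Fin b, ∫ k, X k ^ 2 ∂(uniformOn (Set.univ : Set (Fin n))) := by
          refine Finset.sum_le_sum fun i _ => ?_
          rw [← Finset.add_sum_erase _ _ (Finset.mem_univ i), hdiag]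
          have := Finset.sum_nonpos fun j (hj : j ∈ Finset.univ.erase i) =>
            hoff i j (Finset.ne_of_mem_erase hj).symm
          linarith
      _ = _ := by simp
  calc _ ≤ (b : ℝ)⁻¹ ^ 2 * (b * ∫ k, X k ^ 2 ∂(uniformOn (Set.univ : Set (Fin n)))) := by gcongr
    _ = _ := by
      simp only [hX]
      field_simp

/-- The average over a batch that enumerates the whole sample space is exact. -/
lemma batchLaw_of_bijective {b n : ℕ} {ν : Measure (Fin b → Fin n)}
    [IsProbabilityMeasure ν] (hν : ∀ᵐ a ∂ν, Function.Bijective a) :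
    BatchLaw (uniformOn (Set.univ : Set (Fin n))) ν 0 := by
  intro h _ _
  have hae : (fun a : Fin b → Fin n => avg fun i => h (a i))
      =ᵐ[ν] fun _ => ∫ k, h k ∂(uniformOn Set.univ) := by
    filter_upwards [hν] with a ha
    have hbn : b = n := by simpa using Fintype.card_of_bijective ha
    rw [integral_uniformOn_univ_fin, ← ha.sum_comp h, avg, smul_eq_mul, show (b : ℝ) = n by rw [hbn]]
  refine ⟨.of_discrete, ?_, ?_⟩
  · rw [integral_congr_ae hae]; simp
  · rw [variance_congr hae, variance_eq_integral (by fun_prop)]; simp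

end BatchLaw

/-! ### Products of independent random variables -/

section Independence

lemma integrable_inner_of_memLp {Ω W : Type*} [MeasurableSpace Ω]
    [NormedAddCommGroup W] [InnerProductSpace ℝ W] {μ : Measure Ω} {u w : Ω → W} (hu : MemLp u 2 μ)
    (hw : MemLp w 2 μ) : Integrable (fun ω => inner ℝ (u ω) (w ω)) μ := by
  refine ((hu.integrable_norm_pow two_ne_zero).add (hw.integrable_norm_pow two_ne_zero)).mono'
    (hu.1.inner hw.1) (Filter.Eventually.of_forall fun ω => ?_)
  have h1 := norm_inner_le_norm (𝕜 := ℝ) (u ω) (w ω)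
  simp only [Pi.add_apply]
  nlinarith [sq_nonneg (‖u ω‖ - ‖w ω‖), norm_nonneg (u ω), norm_nonneg (w ω)]

variable {Ω 𝒳 𝒜 W : Type*} [MeasurableSpace Ω] [MeasurableSpace 𝒳] [MeasurableSpace 𝒜]
  [NormedAddCommGroup W] [InnerProductSpace ℝ W] [FiniteDimensional ℝ W] [MeasurableSpace W]
  [BorelSpace W]

/-- Integrating over the second factor with `x` frozen kills the cross term, since `ψ x` is centred.
The integrable majorant `ρ` of the conditional second moments supplies the square integrability that
Fubini needs. -/
lemma memLp_and_integral_norm_sq_add_le_prod {ν₁ : Measure 𝒳} {ν₂ : Measure 𝒜}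
    [IsProbabilityMeasure ν₁] [IsProbabilityMeasure ν₂] {e : 𝒳 → W} {ψ : 𝒳 → 𝒜 → W} {ρ : 𝒳 → ℝ}
    (he : MemLp e 2 ν₁) (hψ : Measurable (Function.uncurry ψ)) (hψL : ∀ x, MemLp (ψ x) 2 ν₂)
    (hmean : ∀ x, ∫ a, ψ x a ∂ν₂ = 0) (hvar : ∀ x, ∫ a, ‖ψ x a‖ ^ 2 ∂ν₂ ≤ ρ x)
    (hρ : Integrable ρ ν₁) :
    MemLp (fun q : 𝒳 × 𝒜 => e q.1 + ψ q.1 q.2) 2 (ν₁.prod ν₂) ∧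
    ∫ q, ‖e q.1 + ψ q.1 q.2‖ ^ 2 ∂(ν₁.prod ν₂) ≤ ∫ x, ‖e x‖ ^ 2 ∂ν₁ + ∫ x, ρ x ∂ν₁ := by
  have hψs : AEStronglyMeasurable (fun q : 𝒳 × 𝒜 => ψ q.1 q.2) (ν₁.prod ν₂) :=
    hψ.aestronglyMeasurable
  have hψsq : Integrable (fun q : 𝒳 × 𝒜 => ‖ψ q.1 q.2‖ ^ 2) (ν₁.prod ν₂) := by
    rw [integrable_prod_iff (f := fun q : 𝒳 × 𝒜 => ‖ψ q.1 q.2‖ ^ 2) (hψs.norm.pow 2)]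
    refine ⟨Filter.Eventually.of_forall fun x => (hψL x).integrable_norm_pow two_ne_zero, ?_⟩
    refine hρ.mono' ?_ (Filter.Eventually.of_forall fun x => ?_)
    · exact (hψs.norm.pow 2).norm.integral_prod_right'
    · rw [Real.norm_of_nonneg (integral_nonneg fun a => norm_nonneg _)]
      refine le_trans (le_of_eq ?_) (hvar x)
      simp
  have hψ2 : MemLp (fun q : 𝒳 × 𝒜 => ψ q.1 q.2) 2 (ν₁.prod ν₂) :=
    (memLp_two_iff_integrable_sq_norm hψs).2 hψsq
  have he2 : MemLp (fun q : 𝒳 × 𝒜 => e q.1) 2 (ν₁.prod ν₂) :=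
    he.comp_measurePreserving measurePreserving_fst
  refine ⟨he2.add hψ2, ?_⟩
  have hin : Integrable (fun q : 𝒳 × 𝒜 => inner ℝ (e q.1) (ψ q.1 q.2)) (ν₁.prod ν₂) :=
    integrable_inner_of_memLp he2 hψ2
  have hesq : Integrable (fun q : 𝒳 × 𝒜 => ‖e q.1‖ ^ 2) (ν₁.prod ν₂) :=
    he2.integrable_norm_pow two_ne_zero
  have hin0 : ∫ q, inner ℝ (e q.1) (ψ q.1 q.2) ∂(ν₁.prod ν₂) = 0 := by
    rw [integral_prod _ hin]
    refine integral_eq_zero_of_ae (Filter.Eventually.of_forall fun x => ?_)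
    have := integral_inner (𝕜 := ℝ) ((hψL x).integrable one_le_two) (e x)
    simp only [Pi.zero_apply]
    rw [this, hmean, inner_zero_right]
  calc ∫ q, ‖e q.1 + ψ q.1 q.2‖ ^ 2 ∂(ν₁.prod ν₂)
      = ∫ q, (‖e q.1‖ ^ 2 + 2 * inner ℝ (e q.1) (ψ q.1 q.2) + ‖ψ q.1 q.2‖ ^ 2) ∂(ν₁.prod ν₂) := by
        simp only [norm_add_sq_real]
    _ = ∫ q, ‖e q.1‖ ^ 2 ∂(ν₁.prod ν₂) + ∫ q, ‖ψ q.1 q.2‖ ^ 2 ∂(ν₁.prod ν₂) := by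
        have h3 : Integrable (fun q : 𝒳 × 𝒜 => ‖e q.1‖ ^ 2 + 2 * inner ℝ (e q.1) (ψ q.1 q.2))
          (ν₁.prod ν₂) := hesq.add (hin.const_mul 2)
        rw [integral_add h3 hψsq, integral_add hesq (hin.const_mul 2),
          integral_const_mul, hin0]
        ring
    _ = ∫ x, ‖e x‖ ^ 2 ∂ν₁ + ∫ x, ∫ a, ‖ψ x a‖ ^ 2 ∂ν₂ ∂ν₁ := by
        rw [integral_prod _ hesq, integral_prod _ hψsq]
        simp
    _ ≤ _ := by
        exact add_le_add_right (integral_mono hψsq.integral_prod_left hρ hvar) _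

/-- Adding a conditionally centred increment to `e (X)`. -/
lemma memLp_and_integral_norm_sq_add_le_of_indepFun {μ : Measure Ω} [IsProbabilityMeasure μ]
    {X : Ω → 𝒳} {A : Ω → 𝒜} (hX : Measurable X) (hA : Measurable A) (hXA : IndepFun X A μ)
    {e : 𝒳 → W} {ψ : 𝒳 → 𝒜 → W} {ρ : 𝒳 → ℝ} (hem : Measurable e)
    (he : MemLp (fun ω => e (X ω)) 2 μ) (hψ : Measurable (Function.uncurry ψ))
    (hψL : ∀ x, MemLp (ψ x) 2 (μ.map A))
    (hmean : ∀ x, ∫ a, ψ x a ∂(μ.map A) = 0) (hvar : ∀ x, ∫ a, ‖ψ x a‖ ^ 2 ∂(μ.map A) ≤ ρ x)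
    (hρm : Measurable ρ) (hρ : Integrable (fun ω => ρ (X ω)) μ) :
    MemLp (fun ω => e (X ω) + ψ (X ω) (A ω)) 2 μ ∧
    ∫ ω, ‖e (X ω) + ψ (X ω) (A ω)‖ ^ 2 ∂μ ≤ ∫ ω, ‖e (X ω)‖ ^ 2 ∂μ + ∫ ω, ρ (X ω) ∂μ := by
  have hmap := (indepFun_iff_map_prod_eq_prod_map_map hX.aemeasurable hA.aemeasurable).1 hXA
  have := Measure.isProbabilityMeasure_map (μ := μ) hX.aemeasurable
  have := Measure.isProbabilityMeasure_map (μ := μ) hA.aemeasurable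
  have hsum : Measurable fun q : 𝒳 × 𝒜 => e q.1 + ψ q.1 q.2 := (hem.comp measurable_fst).add hψ
  obtain ⟨h1, h2⟩ := memLp_and_integral_norm_sq_add_le_prod (ν₁ := μ.map X) (ν₂ := μ.map A)
    (e := e) (ρ := ρ)
    ((memLp_map_measure_iff hem.aestronglyMeasurable hX.aemeasurable).2 he) hψ hψL hmean hvar
    ((integrable_map_measure hρm.aestronglyMeasurable hX.aemeasurable).2 hρ)
  rw [← hmap] at h1 h2
  rw [integral_map (hX.prodMk hA).aemeasurable (hsum.norm.pow_const 2).aestronglyMeasurable,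
    integral_map hX.aemeasurable (hem.norm.pow_const 2).aestronglyMeasurable,
    integral_map hX.aemeasurable hρm.aestronglyMeasurable] at h2
  exact ⟨(memLp_map_measure_iff hsum.aestronglyMeasurable (hX.prodMk hA).aemeasurable).1 h1, h2⟩

end Independence

/-! ### Batch averages of vectors -/

section VectorBatch

lemma avg_apply {ι : Type*} {b : ℕ} (h : Fin b → EuclideanSpace ℝ ι) (i : ι) :
    avg h i = avg fun k => h k i := by
  simp [avg]

variable {Ξ ι : Type*} [MeasurableSpace Ξ] [Fintype ι]

lemma Measurable.avg {α V : Type*} [MeasurableSpace α] [NormedAddCommGroup V] [NormedSpace ℝ V]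
    [FiniteDimensional ℝ V] [MeasurableSpace V] [BorelSpace V] {b : ℕ} {h : α → Fin b → V}
    (hh : ∀ i, Measurable fun x => h x i) : Measurable fun x => MVRC.avg (h x) := by
  unfold MVRC.avg
  exact (Finset.measurable_sum _ fun i _ => hh i).const_smul _

/-- Applied coordinate by coordinate: squared Euclidean norms are sums of squared coordinates, so
the scalar variances add up with the same constant. -/
lemma BatchLaw.vector {D : Measure Ξ} {b : ℕ} {ν : Measure (Fin b → Ξ)} {C : ℝ}
    [IsProbabilityMeasure D] [IsProbabilityMeasure ν]
    (hν : BatchLaw D ν C) {h : Ξ → EuclideanSpace ℝ ι} (hm : Measurable h) (hL : MemLp h 2 D) :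
    MemLp (fun a : Fin b → Ξ => avg fun i => h (a i)) 2 ν ∧
    ∫ a, avg (fun i => h (a i)) ∂ν = ∫ ξ, h ξ ∂D ∧
    ∫ a, ‖avg (fun i => h (a i)) - ∫ ξ, h ξ ∂D‖ ^ 2 ∂ν
      ≤ C * ∫ ξ, ‖h ξ - ∫ ξ, h ξ ∂D‖ ^ 2 ∂D := by
  have hmi : ∀ i, Measurable fun ξ => h ξ i := fun i => by fun_prop
  have hLi : ∀ i, MemLp (fun ξ => h ξ i) 2 D := fun i => hL.eval_piLp i
  have hI := fun i => hν _ (hmi i) (hLi i)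
  have hM : MemLp (fun a : Fin b → Ξ => avg fun i => h (a i)) 2 ν := by
    refine MemLp.of_eval_piLp fun i => ?_
    simp only [avg_apply]
    exact (hI i).1
  have hc : ∀ i, (∫ ξ, h ξ ∂D) i = ∫ ξ, h ξ i ∂D := fun i =>
    eval_integral_piLp (fun i => (hLi i).integrable one_le_two) i
  have hmean : ∫ a, avg (fun i => h (a i)) ∂ν = ∫ ξ, h ξ ∂D := by
    ext i
    rw [hc, eval_integral_piLp]
    · simp only [avg_apply]
      exact (hI i).2.1
    · exact fun i => (hM.eval_piLp i).integrable one_le_two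
  refine ⟨hM, hmean, ?_⟩
  simp only [EuclideanSpace.norm_sq_eq, PiLp.sub_apply, Real.norm_eq_abs, sq_abs, avg_apply, hc]
  rw [integral_finsetSum, integral_finsetSum, Finset.mul_sum]
  · refine Finset.sum_le_sum fun i _ => ?_
    have h3 := (hI i).2.2
    rw [variance_eq_integral (hI i).1.aestronglyMeasurable.aemeasurable,
      variance_eq_integral (hmi i).aemeasurable, (hI i).2.1] at h3
    exact h3
  · exact fun i _ => ((hLi i).sub (memLp_const _)).integrable_sq
  · exact fun i _ => ((hI i).1.sub (memLp_const _)).integrable_sq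

lemma integral_norm_sub_integral_sq_le {D : Measure Ξ} [IsProbabilityMeasure D]
    {h : Ξ → EuclideanSpace ℝ ι} (hL : MemLp h 2 D) :
    ∫ ξ, ‖h ξ - ∫ ξ, h ξ ∂D‖ ^ 2 ∂D ≤ ∫ ξ, ‖h ξ‖ ^ 2 ∂D := by
  set c := ∫ ξ, h ξ ∂D with hc
  have hi := hL.integrable one_le_two
  have hsq : Integrable (fun ξ => ‖h ξ‖ ^ 2) D := hL.integrable_norm_pow two_ne_zero
  have hin : Integrable (fun ξ => inner ℝ c (h ξ)) D := hi.const_inner c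
  have e : ∀ ξ, ‖h ξ - c‖ ^ 2 = ‖h ξ‖ ^ 2 - 2 * inner ℝ c (h ξ) + ‖c‖ ^ 2 := fun ξ => by
    rw [norm_sub_sq_real, real_inner_comm]
  simp only [e]
  have h3 : Integrable (fun ξ => ‖h ξ‖ ^ 2 - 2 * inner ℝ c (h ξ)) D := hsq.sub (hin.const_mul 2)
  rw [integral_add h3 (integrable_const _),
    integral_sub hsq (hin.const_mul 2), integral_const_mul, integral_inner hi, ← hc,
    real_inner_self_eq_norm_sq]
  simp
  nlinarith [sq_nonneg ‖c‖]

end VectorBatch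

/-! ### Variance-reduced estimates of a mean -/

section Estimates

variable {Ω Ξ ι : Type*} {d : ℕ} [MeasurableSpace Ω] [MeasurableSpace Ξ] [Fintype ι]
  {μ : Measure Ω} [IsProbabilityMeasure μ] {D : Measure Ξ} [IsProbabilityMeasure D]
  {H : Ξ → Vec d → EuclideanSpace ℝ ι}

lemma measurable_integral_of_uncurry (hH : Measurable (Function.uncurry H)) :
    Measurable fun x => ∫ ξ, H ξ x ∂D :=
  (hH.stronglyMeasurable.integral_prod_left (μ := D)).measurable

/-- The error of a fresh estimate. -/
lemma memLp_and_integral_norm_sq_refresh_le (hH : Measurable (Function.uncurry H))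
    (hHL : ∀ x, MemLp (fun ξ => H ξ x) 2 D) {b : ℕ} {A : Ω → Fin b → Ξ} (hA : Measurable A)
    {C δ : ℝ} (hC : BatchLaw D (μ.map A) C)
    (hδ : ∀ x, C * ∫ ξ, ‖H ξ x - ∫ ξ, H ξ x ∂D‖ ^ 2 ∂D ≤ δ) {z : Ω → Vec d} (hz : Measurable z)
    (hind : IndepFun z A μ) :
    MemLp (fun ω => (avg fun i => H (A ω i) (z ω)) - ∫ ξ, H ξ (z ω) ∂D) 2 μ ∧
    ∫ ω, ‖(avg fun i => H (A ω i) (z ω)) - ∫ ξ, H ξ (z ω) ∂D‖ ^ 2 ∂μ ≤ δ := by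
  have := Measure.isProbabilityMeasure_map (μ := μ) hA.aemeasurable
  have hHb := measurable_integral_of_uncurry (D := D) hH
  have hHx : ∀ x, Measurable fun ξ => H ξ x := fun x => hH.comp measurable_prodMk_right
  have key := memLp_and_integral_norm_sq_add_le_of_indepFun (W := EuclideanSpace ℝ ι) hz hA hind
    (e := fun _ => 0) (ρ := fun _ => δ)
    (ψ := fun x a => (avg fun i => H (a i) x) - ∫ ξ, H ξ x ∂D) measurable_const
    (memLp_const 0) ?_ ?_ ?_ ?_ measurable_const (integrable_const _)
  · simpa using key
  · refine Measurable.sub (Measurable.avg fun i => ?_) (hHb.comp measurable_fst)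
    exact hH.comp (Measurable.prodMk (by fun_prop) (by fun_prop) :
      Measurable fun q : Vec d × (Fin b → Ξ) => (q.2 i, q.1))
  · exact fun x => (hC.vector (hHx x) (hHL x)).1.sub (memLp_const _)
  · intro x
    rw [integral_sub ((hC.vector (hHx x) (hHL x)).1.integrable one_le_two) (integrable_const _),
      (hC.vector (hHx x) (hHL x)).2.1]
    simp
  · exact fun x => (hC.vector (hHx x) (hHL x)).2.2.trans (hδ x)

/-- The error of an estimate that is updated with a batch average of differences. -/
lemma memLp_and_integral_norm_sq_update_le (hH : Measurable (Function.uncurry H))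
    (hHL : ∀ x, MemLp (fun ξ => H ξ x) 2 D) {G : ℝ}
    (hG : ∀ ξ x y, ‖H ξ x - H ξ y‖ ^ 2 ≤ G * ‖x - y‖ ^ 2)
    {b : ℕ} {A : Ω → Fin b → Ξ} (hA : Measurable A)
    {C : ℝ} (hC0 : 0 ≤ C) (hC : BatchLaw D (μ.map A) C) {z z' : Ω → Vec d}
    {err : Ω → EuclideanSpace ℝ ι} (hz : Measurable z) (hz' : Measurable z')
    (herrm : Measurable err) (herr : MemLp err 2 μ)
    (hzz : Integrable (fun ω => ‖z ω - z' ω‖ ^ 2) μ)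
    (hind : IndepFun (fun ω => (z ω, z' ω, err ω)) A μ) :
    MemLp (fun ω => err ω + ((avg fun i => H (A ω i) (z ω) - H (A ω i) (z' ω))
      - (∫ ξ, H ξ (z ω) ∂D - ∫ ξ, H ξ (z' ω) ∂D))) 2 μ ∧
    ∫ ω, ‖err ω + ((avg fun i => H (A ω i) (z ω) - H (A ω i) (z' ω))
      - (∫ ξ, H ξ (z ω) ∂D - ∫ ξ, H ξ (z' ω) ∂D))‖ ^ 2 ∂μ
      ≤ ∫ ω, ‖err ω‖ ^ 2 ∂μ + C * G * ∫ ω, ‖z ω - z' ω‖ ^ 2 ∂μ := by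
  have := Measure.isProbabilityMeasure_map (μ := μ) hA.aemeasurable
  have hHb := measurable_integral_of_uncurry (D := D) hH
  have hHx : ∀ x, Measurable fun ξ => H ξ x := fun x => hH.comp measurable_prodMk_right
  have hLx : ∀ q : Vec d × Vec d × EuclideanSpace ℝ ι,
      MemLp (fun ξ => H ξ q.1 - H ξ q.2.1) 2 D := fun q => (hHL _).sub (hHL _)
  have hint : ∀ q : Vec d × Vec d × EuclideanSpace ℝ ι,
      ∫ ξ, H ξ q.1 - H ξ q.2.1 ∂D = ∫ ξ, H ξ q.1 ∂D - ∫ ξ, H ξ q.2.1 ∂D := fun q =>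
    integral_sub ((hHL _).integrable one_le_two) ((hHL _).integrable one_le_two)
  have hV := fun q => hC.vector (h := fun ξ => H ξ q.1 - H ξ q.2.1)
    ((hHx _).sub (hHx _)) (hLx q)
  have key := memLp_and_integral_norm_sq_add_le_of_indepFun (W := EuclideanSpace ℝ ι)
    (hz.prodMk (hz'.prodMk herrm)) hA hind
    (e := fun q => q.2.2) (ρ := fun q => C * G * ‖q.1 - q.2.1‖ ^ 2)
    (ψ := fun q a => (avg fun i => H (a i) q.1 - H (a i) q.2.1)
      - (∫ ξ, H ξ q.1 ∂D - ∫ ξ, H ξ q.2.1 ∂D)) (by fun_prop)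
    herr ?_ ?_ ?_ ?_ (by fun_prop) (hzz.const_mul _)
  · rw [integral_const_mul] at key
    exact key
  · refine Measurable.sub (Measurable.avg fun i => ?_) ((hHb.comp ?_).sub (hHb.comp ?_))
    · refine Measurable.sub (hH.comp (Measurable.prodMk ?_ ?_)) (hH.comp (Measurable.prodMk ?_ ?_))
      all_goals fun_prop
    · fun_prop
    · fun_prop
  · exact fun q => (hV q).1.sub (memLp_const _)
  · intro q
    rw [integral_sub ((hV q).1.integrable one_le_two) (integrable_const _), (hV q).2.1, hint]
    simp
  · intro q
    rw [← hint]
    refine (hV q).2.2.trans ?_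
    rw [mul_assoc]
    gcongr
    -- The variance of the sampled difference is at most its second moment, which the Lipschitz
    -- bound `hG` controls by the displacement.
    refine (integral_norm_sub_integral_sq_le (hLx q)).trans ?_
    calc _ ≤ ∫ _ : Ξ, G * ‖q.1 - q.2.1‖ ^ 2 ∂D := by
          exact integral_mono ((hLx q).integrable_norm_pow two_ne_zero) (integrable_const _)
            fun ξ => hG ξ _ _
      _ = _ := by simp

end Estimates

noncomputable section

/-! ### The Frobenius norm -/

section Frobenius

variable {d p : ℕ}

lemma frobNorm_sq (J : Vec d →L[ℝ] Vec p) :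
    frobNorm J ^ 2 = ∑ j : Fin d, ‖J (EuclideanSpace.single j (1 : ℝ))‖ ^ 2 :=
  Real.sq_sqrt (Finset.sum_nonneg fun _ _ => by positivity)

lemma frobNorm_nonneg (J : Vec d →L[ℝ] Vec p) : 0 ≤ frobNorm J := Real.sqrt_nonneg _

lemma sum_smul_single (x : Vec d) : ∑ j, x j • EuclideanSpace.single j (1 : ℝ) = x := by
  ext i
  simp [Finset.sum_apply, Pi.single_apply]

lemma norm_le_frobNorm (J : Vec d →L[ℝ] Vec p) : ‖J‖ ≤ frobNorm J := by
  refine J.opNorm_le_bound (frobNorm_nonneg J) fun x => ?_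
  calc ‖J x‖ = ‖∑ j, x j • J (EuclideanSpace.single j (1 : ℝ))‖ := by
        conv_lhs => rw [← sum_smul_single x]
        simp
    _ ≤ ∑ j, |x j| * ‖J (EuclideanSpace.single j (1 : ℝ))‖ := by
        refine (norm_sum_le _ _).trans (le_of_eq ?_)
        simp [norm_smul]
    _ ≤ √(∑ j, |x j| ^ 2) * √(∑ j, ‖J (EuclideanSpace.single j (1 : ℝ))‖ ^ 2) :=
        Real.sum_mul_le_sqrt_mul_sqrt _ _ _
    _ = frobNorm J * ‖x‖ := by
        rw [EuclideanSpace.norm_eq, mul_comm]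
        rfl

/-- A vector and a matrix, scaled by `c₁` and `c₂` and stacked into one Euclidean vector. -/
def stack (d p : ℕ) (c₁ c₂ : ℝ) :
    (Vec p × (Vec d →L[ℝ] Vec p)) →L[ℝ] EuclideanSpace ℝ (Fin p ⊕ Fin d × Fin p) :=
  LinearMap.toContinuousLinearMap
    { toFun := fun q => WithLp.toLp 2 (Sum.elim (fun i => c₁ * q.1 i)
        fun ji => c₂ * q.2 (EuclideanSpace.single ji.1 (1 : ℝ)) ji.2)
      map_add' := by
        intro q q'
        ext i
        rcases i with i | i <;> simp [mul_add]
      map_smul' := by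
        intro c q
        ext i
        rcases i with i | i <;> simp [mul_left_comm] }

lemma norm_stack_sq (c₁ c₂ : ℝ) (u : Vec p) (J : Vec d →L[ℝ] Vec p) :
    ‖stack d p c₁ c₂ (u, J)‖ ^ 2 = c₁ ^ 2 * ‖u‖ ^ 2 + c₂ ^ 2 * frobNorm J ^ 2 := by
  rw [frobNorm_sq, EuclideanSpace.norm_sq_eq, EuclideanSpace.norm_sq_eq]
  simp [stack, Fintype.sum_prod_type, EuclideanSpace.norm_sq_eq, mul_pow, Finset.mul_sum]

lemma norm_gradient_eq {E : Type*} [NormedAddCommGroup E] [InnerProductSpace ℝ E]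
    [CompleteSpace E] (f : E → ℝ) (x : E) : ‖gradient f x‖ = ‖fderiv ℝ f x‖ := by
  unfold gradient
  exact LinearIsometryEquiv.norm_map _ _

lemma inner_gradient_left {E : Type*} [NormedAddCommGroup E] [InnerProductSpace ℝ E]
    [CompleteSpace E] (f : E → ℝ) (x w : E) : inner ℝ (gradient f x) w = fderiv ℝ f x w := by
  unfold gradient
  exact InnerProductSpace.toDual_symm_apply

lemma norm_adjoint_apply_le {E E' : Type*} [NormedAddCommGroup E] [InnerProductSpace ℝ E]
    [CompleteSpace E] [NormedAddCommGroup E'] [InnerProductSpace ℝ E'] [CompleteSpace E']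
    (J : E →L[ℝ] E') (u : E') : ‖ContinuousLinearMap.adjoint J u‖ ≤ ‖J‖ * ‖u‖ :=
  (ContinuousLinearMap.le_opNorm _ _).trans
    (by rw [LinearIsometryEquiv.norm_map])

end Frobenius

/-! ### The composite objective -/

section Objective

variable {d p : ℕ} {Ξ : Type*} [MeasurableSpace Ξ] {D : Measure Ξ}
  {f : Vec p → ℝ} {g : Ξ → Vec d → Vec p} {lf Lf lg Lg : ℝ≥0}

/-- The data of a problem in the online form, without variance bounds. -/
structure IsProblem (D : Measure Ξ) (f : Vec p → ℝ) (g : Ξ → Vec d → Vec p)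
    (lf Lf lg Lg : ℝ≥0) : Prop where
  smooth : Smooth f g (onlineObj D f g) lf Lf lg Lg
  measurable : ∀ x, Measurable fun ξ => g ξ x
  memLp : ∀ x, MemLp (fun ξ => g ξ x) 2 D

namespace IsProblem

lemma norm_gradient_le (h : IsProblem D f g lf Lf lg Lg) (u : Vec p) : ‖gradient f u‖ ≤ lf := by
  rw [norm_gradient_eq]
  exact norm_fderiv_le_of_lipschitz ℝ h.smooth.f_lip

lemma norm_fderiv_le (h : IsProblem D f g lf Lf lg Lg) (ξ : Ξ) (x : Vec d) :
    ‖fderiv ℝ (g ξ) x‖ ≤ lg :=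
  norm_fderiv_le_of_lipschitz ℝ (h.smooth.g_lip ξ)

lemma continuous_fderiv (h : IsProblem D f g lf Lf lg Lg) (ξ : Ξ) :
    Continuous fun x => fderiv ℝ (g ξ) x := by
  refine (LipschitzWith.of_dist_le_mul (K := Lg) fun x y => ?_).continuous
  rw [dist_eq_norm, dist_eq_norm]
  exact (norm_le_frobNorm _).trans (h.smooth.g_jac_lip ξ x y)

lemma measurable_uncurry (h : IsProblem D f g lf Lf lg Lg) :
    Measurable (Function.uncurry g) := by
  have := measurable_uncurry_of_continuous_of_measurable (u := fun x ξ => g ξ x)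
    (fun ξ => (h.smooth.g_lip ξ).continuous) h.measurable
  exact this.comp measurable_swap

/-- A directional derivative is the limit of the difference quotients with step `1 / k`, each
measurable in `ξ`. -/
lemma measurable_fderiv (h : IsProblem D f g lf Lf lg Lg) (x : Vec d) :
    Measurable fun ξ => fderiv ℝ (g ξ) x := by
  have happ : ∀ w : Vec d, Measurable fun ξ => fderiv ℝ (g ξ) x w := by
    intro w
    refine measurable_of_tendsto_metrizable
      (f := fun (k : ℕ) ξ => ((k : ℝ)) • (g ξ (x + (k : ℝ)⁻¹ • w) - g ξ x)) (fun k => ?_) ?_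
    · exact ((h.measurable _).sub (h.measurable _)).const_smul (k : ℝ)
    · rw [tendsto_pi_nhds]
      intro ξ
      exact (((h.smooth.g_diff ξ) x).hasFDerivAt.lim_real w).comp tendsto_natCast_atTop_atTop
  -- An operator is a continuous function of its columns, so measurability of the columns suffices.
  have e : ∀ J : Vec d →L[ℝ] Vec p, J = ∑ j : Fin d,
      ContinuousLinearMap.smulRightL ℝ (Vec d) (Vec p) (EuclideanSpace.proj j)
        (J (EuclideanSpace.single j 1)) := by
    intro J
    ext1 x
    conv_lhs => rw [← sum_smul_single x]
    simp
  have e' : (fun ξ => fderiv ℝ (g ξ) x) = fun ξ => ∑ j : Fin d,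
      ContinuousLinearMap.smulRightL ℝ (Vec d) (Vec p) (EuclideanSpace.proj j)
        (fderiv ℝ (g ξ) x (EuclideanSpace.single j 1)) := funext fun ξ => e _
  rw [e']
  exact Finset.measurable_sum _ fun j _ =>
    (ContinuousLinearMap.continuous _).measurable.comp (happ _)

lemma measurable_uncurry_fderiv (h : IsProblem D f g lf Lf lg Lg) :
    Measurable (Function.uncurry fun ξ x => fderiv ℝ (g ξ) x) := by
  have := measurable_uncurry_of_continuous_of_measurable (u := fun x ξ => fderiv ℝ (g ξ) x)
    h.continuous_fderiv h.measurable_fderiv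
  exact this.comp measurable_swap

lemma Fstar_le (h : IsProblem D f g lf Lf lg Lg) (x : Vec d) :
    Fstar (onlineObj D f g) ≤ onlineObj D f g x := ciInf_le h.smooth.F_bdd x

/-- The samples of the map and of its Jacobian, stacked with the weights that enter the error of
the gradient estimate. -/
def sampleMap (lf Lf lg : ℝ≥0) (g : Ξ → Vec d → Vec p) (ξ : Ξ) (x : Vec d) :
    EuclideanSpace ℝ (Fin p ⊕ Fin d × Fin p) :=
  stack d p (lg * Lf) lf (g ξ x, fderiv ℝ (g ξ) x)

/-- The error of the estimates `u` of `g z` and `J` of the Jacobian of `g` at `z`. -/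
def estErr (D : Measure Ξ) (lf Lf lg : ℝ≥0) (g : Ξ → Vec d → Vec p) (z : Vec d) (u : Vec p)
    (J : Vec d →L[ℝ] Vec p) : EuclideanSpace ℝ (Fin p ⊕ Fin d × Fin p) :=
  stack d p (lg * Lf) lf (u - meanMap D g z, J - fderiv ℝ (meanMap D g) z)

lemma measurable_sampleMap (h : IsProblem D f g lf Lf lg Lg) :
    Measurable (Function.uncurry (sampleMap lf Lf lg g)) :=
  (ContinuousLinearMap.continuous _).measurable.comp
    (h.measurable_uncurry.prodMk h.measurable_uncurry_fderiv)

lemma norm_sampleMap_sub_sq_le (h : IsProblem D f g lf Lf lg Lg) (ξ : Ξ) (x y : Vec d) :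
    ‖sampleMap lf Lf lg g ξ x - sampleMap lf Lf lg g ξ y‖ ^ 2
      ≤ G0 lf Lf lg Lg / 2 * ‖x - y‖ ^ 2 := by
  unfold sampleMap
  rw [← map_sub, Prod.mk_sub_mk, norm_stack_sq]
  have h1 := (h.smooth.g_lip ξ).norm_sub_le x y
  have h2 := h.smooth.g_jac_lip ξ x y
  have h3 := frobNorm_nonneg (fderiv ℝ (g ξ) x - fderiv ℝ (g ξ) y)
  calc _ ≤ ((lg : ℝ) * Lf) ^ 2 * (lg * ‖x - y‖) ^ 2 + (lf : ℝ) ^ 2 * (Lg * ‖x - y‖) ^ 2 := by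
        gcongr
    _ = _ := by unfold G0; ring

variable [IsProbabilityMeasure D]

lemma integrable_fderiv (h : IsProblem D f g lf Lf lg Lg) (x : Vec d) :
    Integrable (fun ξ => fderiv ℝ (g ξ) x) D :=
  .of_bound (h.measurable_fderiv x).aestronglyMeasurable lg
    (Filter.Eventually.of_forall fun ξ => h.norm_fderiv_le ξ x)

lemma hasFDerivAt_meanMap (h : IsProblem D f g lf Lf lg Lg) (x : Vec d) :
    HasFDerivAt (meanMap D g) (∫ ξ, fderiv ℝ (g ξ) x ∂D) x := by
  unfold meanMap
  exact hasFDerivAt_integral_of_dominated_of_fderiv_le (F := fun x ξ => g ξ x)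
    (F' := fun x ξ => fderiv ℝ (g ξ) x) (bound := fun _ => lg) Filter.univ_mem
    (Filter.Eventually.of_forall fun x => (h.measurable x).aestronglyMeasurable)
    ((h.memLp x).integrable one_le_two) (h.measurable_fderiv x).aestronglyMeasurable
    (Filter.Eventually.of_forall fun ξ x _ => h.norm_fderiv_le ξ x) (integrable_const _)
    (Filter.Eventually.of_forall fun ξ x _ => ((h.smooth.g_diff ξ) x).hasFDerivAt)

lemma fderiv_meanMap (h : IsProblem D f g lf Lf lg Lg) (x : Vec d) :
    fderiv ℝ (meanMap D g) x = ∫ ξ, fderiv ℝ (g ξ) x ∂D :=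
  (h.hasFDerivAt_meanMap x).fderiv

lemma norm_fderiv_meanMap_le (h : IsProblem D f g lf Lf lg Lg) (x : Vec d) :
    ‖fderiv ℝ (meanMap D g) x‖ ≤ lg := by
  rw [h.fderiv_meanMap]
  refine (norm_integral_le_of_norm_le_const
    (Filter.Eventually.of_forall fun ξ => h.norm_fderiv_le ξ x)).trans ?_
  simp

lemma norm_fderiv_meanMap_sub_le (h : IsProblem D f g lf Lf lg Lg) (x y : Vec d) :
    ‖fderiv ℝ (meanMap D g) x - fderiv ℝ (meanMap D g) y‖ ≤ Lg * ‖x - y‖ := by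
  rw [h.fderiv_meanMap, h.fderiv_meanMap,
    ← integral_sub (h.integrable_fderiv x) (h.integrable_fderiv y)]
  refine (norm_integral_le_of_norm_le_const (Filter.Eventually.of_forall fun ξ =>
    (norm_le_frobNorm _).trans (h.smooth.g_jac_lip ξ x y))).trans ?_
  simp

lemma lipschitzWith_meanMap (h : IsProblem D f g lf Lf lg Lg) : LipschitzWith lg (meanMap D g) :=
  lipschitzWith_of_nnnorm_fderiv_le (fun x => (h.hasFDerivAt_meanMap x).differentiableAt)
    fun x => h.norm_fderiv_meanMap_le x

lemma lipschitzWith_obj (h : IsProblem D f g lf Lf lg Lg) :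
    LipschitzWith (lf * lg) (onlineObj D f g) :=
  h.smooth.f_lip.comp h.lipschitzWith_meanMap

lemma differentiable_obj (h : IsProblem D f g lf Lf lg Lg) :
    Differentiable ℝ (onlineObj D f g) := fun x =>
  (h.smooth.f_diff _).comp x (h.hasFDerivAt_meanMap x).differentiableAt

lemma gradient_obj (h : IsProblem D f g lf Lf lg Lg) (x : Vec d) :
    gradient (onlineObj D f g) x
      = ContinuousLinearMap.adjoint (fderiv ℝ (meanMap D g) x) (gradient f (meanMap D g x)) := by
  refine ext_inner_right ℝ fun w => ?_
  rw [inner_gradient_left, ContinuousLinearMap.adjoint_inner_left, inner_gradient_left]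
  have : fderiv ℝ (onlineObj D f g) x
      = (fderiv ℝ f (meanMap D g x)).comp (fderiv ℝ (meanMap D g) x) :=
    fderiv_comp x (h.smooth.f_diff _) (h.hasFDerivAt_meanMap x).differentiableAt
  rw [this]
  rfl

lemma norm_gradient_obj_le (h : IsProblem D f g lf Lf lg Lg) (x : Vec d) :
    ‖gradient (onlineObj D f g) x‖ ≤ lg * lf := by
  rw [h.gradient_obj]
  refine (norm_adjoint_apply_le _ _).trans ?_
  gcongr
  · exact h.norm_fderiv_meanMap_le x
  · exact h.norm_gradient_le _

lemma norm_gradient_obj_sub_le (h : IsProblem D f g lf Lf lg Lg) (x y : Vec d) :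
    ‖gradient (onlineObj D f g) x - gradient (onlineObj D f g) y‖
      ≤ LF lf Lf lg Lg * ‖x - y‖ := by
  rw [h.gradient_obj, h.gradient_obj]
  set J := fderiv ℝ (meanMap D g) x
  set J' := fderiv ℝ (meanMap D g) y
  set u := gradient f (meanMap D g x)
  set u' := gradient f (meanMap D g y)
  have e : ContinuousLinearMap.adjoint J u - ContinuousLinearMap.adjoint J' u'
      = ContinuousLinearMap.adjoint J (u - u') + ContinuousLinearMap.adjoint (J - J') u' := by
    simp
  have h1 : ‖u - u'‖ ≤ Lf * (lg * ‖x - y‖) := by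
    refine (h.smooth.f_grad_lip.norm_sub_le _ _).trans ?_
    gcongr
    exact h.lipschitzWith_meanMap.norm_sub_le _ _
  rw [e]
  calc _ ≤ ‖J‖ * ‖u - u'‖ + ‖J - J'‖ * ‖u'‖ :=
        (norm_add_le _ _).trans (add_le_add (norm_adjoint_apply_le _ _) (norm_adjoint_apply_le _ _))
    _ ≤ lg * (Lf * (lg * ‖x - y‖)) + Lg * ‖x - y‖ * lf := by
        gcongr
        · exact h.norm_fderiv_meanMap_le x
        · exact h.norm_fderiv_meanMap_sub_le x y
        · exact h.norm_gradient_le _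
    _ = _ := by unfold LF; ring

lemma continuous_gradient_obj (h : IsProblem D f g lf Lf lg Lg) :
    Continuous (gradient (onlineObj D f g)) := by
  have h0 : 0 ≤ LF lf Lf lg Lg := by unfold LF; positivity
  refine (LipschitzWith.of_dist_le_mul (K := ⟨_, h0⟩) fun x y => ?_).continuous
  rw [dist_eq_norm, dist_eq_norm]
  exact h.norm_gradient_obj_sub_le x y

lemma integral_sampleMap (h : IsProblem D f g lf Lf lg Lg) (x : Vec d) :
    ∫ ξ, sampleMap lf Lf lg g ξ x ∂D
      = stack d p (lg * Lf) lf (meanMap D g x, fderiv ℝ (meanMap D g) x) := by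
  have hi := (h.memLp x).integrable one_le_two
  have hi' := h.integrable_fderiv x
  unfold sampleMap
  rw [ContinuousLinearMap.integral_comp_comm _ (hi.prodMk hi'), integral_pair hi hi',
    h.fderiv_meanMap]
  rfl

lemma integrable_frobNorm_sub_sq (h : IsProblem D f g lf Lf lg Lg) (x : Vec d)
    (J : Vec d →L[ℝ] Vec p) : Integrable (fun ξ => frobNorm (fderiv ℝ (g ξ) x - J) ^ 2) D := by
  simp only [frobNorm_sq]
  refine integrable_finsetSum _ fun j _ => ?_
  have hI : MemLp (fun ξ => fderiv ℝ (g ξ) x - J) 2 D :=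
    (MemLp.of_bound (h.measurable_fderiv x).aestronglyMeasurable lg
      (Filter.Eventually.of_forall fun ξ => h.norm_fderiv_le ξ x)).sub (memLp_const _)
  exact (ContinuousLinearMap.comp_memLp' (ContinuousLinearMap.apply ℝ (Vec p)
    (EuclideanSpace.single j (1 : ℝ))) hI).integrable_norm_pow two_ne_zero

lemma memLp_sampleMap (h : IsProblem D f g lf Lf lg Lg) (x : Vec d) :
    MemLp (fun ξ => sampleMap lf Lf lg g ξ x) 2 D := by
  refine (memLp_two_iff_integrable_sq_norm
    (h.measurable_sampleMap.comp measurable_prodMk_right).aestronglyMeasurable).2 ?_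
  simp only [Function.comp_def, Function.uncurry, sampleMap, norm_stack_sq]
  have h1 := h.integrable_frobNorm_sub_sq x 0
  simp only [sub_zero] at h1
  exact (((h.memLp x).integrable_norm_pow two_ne_zero).const_mul _).add (h1.const_mul _)

/-- The gradient estimate inherits the error of the estimates of `g` and its Jacobian. -/
lemma norm_gradEst_sub_sq_le (h : IsProblem D f g lf Lf lg Lg) (z : Vec d) (u : Vec p)
    (J : Vec d →L[ℝ] Vec p) :
    ‖ContinuousLinearMap.adjoint J (gradient f u) - gradient (onlineObj D f g) z‖ ^ 2
      ≤ 2 * ‖estErr D lf Lf lg g z u J‖ ^ 2 := by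
  rw [h.gradient_obj, estErr, norm_stack_sq]
  set J' := fderiv ℝ (meanMap D g) z
  set u' := meanMap D g z
  -- The splitting pairs the true Jacobian `J'`, of norm at most `lg`, with the difference of
  -- gradients, and `J - J'` with `gradient f u`, bounded by `lf` at any point. No uniform bound on
  -- the estimate `J` is required.
  have e : ContinuousLinearMap.adjoint J (gradient f u) - ContinuousLinearMap.adjoint J'
      (gradient f u') = ContinuousLinearMap.adjoint J' (gradient f u - gradient f u')
        + ContinuousLinearMap.adjoint (J - J') (gradient f u) := by
    simp
  have h1 := h.smooth.f_grad_lip.norm_sub_le u u'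
  have h2 := frobNorm_nonneg (J - J')
  have h3 : ‖ContinuousLinearMap.adjoint J (gradient f u) - ContinuousLinearMap.adjoint J'
      (gradient f u')‖ ≤ lg * Lf * ‖u - u'‖ + lf * frobNorm (J - J') := by
    rw [e]
    calc _ ≤ ‖J'‖ * ‖gradient f u - gradient f u'‖ + ‖J - J'‖ * ‖gradient f u‖ :=
          (norm_add_le _ _).trans
            (add_le_add (norm_adjoint_apply_le _ _) (norm_adjoint_apply_le _ _))
      _ ≤ lg * (Lf * ‖u - u'‖) + frobNorm (J - J') * lf := by
          gcongr
          · exact h.norm_fderiv_meanMap_le z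
          · exact norm_le_frobNorm _
          · exact h.norm_gradient_le _
      _ = _ := by ring
  calc _ ≤ ((lg : ℝ) * Lf * ‖u - u'‖ + lf * frobNorm (J - J')) ^ 2 := by gcongr
    _ ≤ _ := by
      nlinarith [sq_nonneg ((lg : ℝ) * Lf * ‖u - u'‖ - lf * frobNorm (J - J'))]

lemma integral_norm_sampleMap_sub_sq (h : IsProblem D f g lf Lf lg Lg) (x : Vec d) :
    ∫ ξ, ‖sampleMap lf Lf lg g ξ x - ∫ ξ, sampleMap lf Lf lg g ξ x ∂D‖ ^ 2 ∂D
      = ((lg : ℝ) * Lf) ^ 2 * ∫ ξ, ‖g ξ x - meanMap D g x‖ ^ 2 ∂D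
        + (lf : ℝ) ^ 2 * ∫ ξ, frobNorm (fderiv ℝ (g ξ) x - fderiv ℝ (meanMap D g) x) ^ 2 ∂D := by
  have e : ∀ ξ, ‖sampleMap lf Lf lg g ξ x - ∫ ξ, sampleMap lf Lf lg g ξ x ∂D‖ ^ 2
      = ((lg : ℝ) * Lf) ^ 2 * ‖g ξ x - meanMap D g x‖ ^ 2
        + (lf : ℝ) ^ 2 * frobNorm (fderiv ℝ (g ξ) x - fderiv ℝ (meanMap D g) x) ^ 2 := by
    intro ξ
    rw [h.integral_sampleMap, sampleMap, ← map_sub, Prod.mk_sub_mk, norm_stack_sq]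
  simp only [e]
  rw [integral_add, integral_const_mul, integral_const_mul]
  · exact (((h.memLp x).sub (memLp_const _)).integrable_norm_pow two_ne_zero).const_mul _
  · exact (h.integrable_frobNorm_sub_sq x _).const_mul _

end IsProblem

end Objective

/-! ### The proximal mapping of the zero function -/

/-- As `prox` is a choice of minimizer, the value is forced by two facts: `x` is a minimizer, so the
choice is one too, and no other point is. -/
lemma prox_zero {d : ℕ} {lam : ℝ} (hlam : 0 < lam) (x : Vec d) :
    prox (fun _ => 0) lam x = x := by
  have hx : IsMinOn (fun u : Vec d => (0 : ℝ) + 1 / (2 * lam) * ‖u - x‖ ^ 2) Set.univ x := by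
    intro u _
    simp only [Set.mem_ofPred_eq, sub_self, norm_zero]
    have : 0 ≤ 1 / (2 * lam) * ‖u - x‖ ^ 2 := by positivity
    simpa using this
  have h := Classical.epsilon_spec (p := fun y : Vec d =>
    IsMinOn (fun u : Vec d => (0 : ℝ) + 1 / (2 * lam) * ‖u - x‖ ^ 2) Set.univ y) ⟨x, hx⟩
  have h' := h (Set.mem_univ x)
  simp only [Set.mem_ofPred_eq, sub_self, norm_zero, zero_add] at h'
  have hpos : 0 < 1 / (2 * lam) := by positivity
  have h0 : 1 / (2 * lam) * ‖prox (fun _ => 0) lam x - x‖ ^ 2 ≤ 0 := by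
    unfold prox
    simpa using h'
  have h1 : ‖prox (fun _ => 0) lam x - x‖ ^ 2 ≤ 0 := by
    by_contra! hc
    have := mul_pos hpos hc
    linarith
  have h2 : ‖prox (fun _ => 0) lam x - x‖ = 0 := by nlinarith [norm_nonneg (prox (fun _ => 0) lam x - x)]
  exact sub_eq_zero.1 (norm_eq_zero.1 h2)

lemma gradMap_zero {d : ℕ} (F : Vec d → ℝ) {η : ℝ} (hη : 0 < η) (x : Vec d) :
    gradMap (fun _ => 0) F η x = gradient F x := by
  rw [gradMap, prox_zero hη, sub_sub_cancel, smul_smul, inv_mul_cancel₀ hη.ne', one_smul]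

/-! ### The iterates of a run -/

section Run

variable {d p : ℕ} {Ξ : Type*} {P : Params d} {f : Vec p → ℝ} {g : Ξ → Vec d → Vec p}

lemma map_avg {V V' : Type*} [AddCommGroup V] [Module ℝ V] [AddCommGroup V'] [Module ℝ V']
    {Φ : Type*} [FunLike Φ V V'] [LinearMapClass Φ ℝ V V'] (L : Φ) {k : ℕ} (h : Fin k → V) :
    L (avg h) = avg fun i => L (h i) := by
  simp [avg, map_sum, map_smul]

lemma avg_prodMk {V V' : Type*} [AddCommGroup V] [Module ℝ V] [AddCommGroup V'] [Module ℝ V']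
    {k : ℕ} (h : Fin k → V) (h' : Fin k → V') :
    ((avg h, avg h') : V × V') = avg fun i => (h i, h' i) := by
  ext1 <;> simp [avg, Prod.fst_sum, Prod.snd_sum]

lemma norm_avg_le {V : Type*} [NormedAddCommGroup V] [NormedSpace ℝ V] {k : ℕ} {h : Fin k → V}
    {c : ℝ} (hc : 0 ≤ c) (hh : ∀ i, ‖h i‖ ≤ c) : ‖avg h‖ ≤ c := by
  unfold avg
  rw [norm_smul, norm_inv, Real.norm_natCast]
  have h1 : ‖∑ i, h i‖ ≤ k * c := by
    refine (norm_sum_le_of_le _ fun i _ => hh i).trans ?_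
    simp
  -- An empty batch has average `0`, since `0⁻¹ = 0`.
  rcases Nat.eq_zero_or_pos k with rfl | hk
  · simpa using hc
  · have : (0 : ℝ) < k := by exact_mod_cast hk
    rw [inv_mul_le_iff₀ this]
    exact h1

/-- The gradient estimate made in iteration `t`. -/
def gradEst (P : Params d) (f : Vec p → ℝ) (g : Ξ → Vec d → Vec p)
    (a : (t : ℕ) → Fin (P.b t) → Ξ) (x₀ : Vec d) (t : ℕ) : Vec d :=
  ContinuousLinearMap.adjoint (run P f g a x₀ (t + 1)).Jt (gradient f (run P f g a x₀ (t + 1)).gt)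

/-- Parameters of MVRC-1 without regularizer, with momentum `2 / (t + 1)` and constant `β`. -/
structure Params.IsPlain (P : Params d) (β : ℝ) : Prop where
  r_eq : P.r = fun _ => 0
  α_eq : P.α = dimMomentum
  β_eq : P.β = fun _ => β
  β_pos : 0 < β
  lam_mem : ∀ t, P.lam t ∈ Set.Icc β ((1 + dimMomentum t) * β)
  τ_pos : 0 < P.τ

lemma zIter_eq (a : (t : ℕ) → Fin (P.b t) → Ξ) (x₀ : Vec d) (t : ℕ) :
    zIter P f g a x₀ t = (1 - P.α (t + 1)) • (run P f g a x₀ t).y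
      + P.α (t + 1) • (run P f g a x₀ t).x := rfl

lemma Params.IsPlain.run_succ_x {β : ℝ} (hP : P.IsPlain β) (a : (t : ℕ) → Fin (P.b t) → Ξ)
    (x₀ : Vec d) (t : ℕ) : (run P f g a x₀ (t + 1)).x
      = (run P f g a x₀ t).x - P.lam t • gradEst P f g a x₀ t := by
  have hlam : 0 < P.lam t := hP.β_pos.trans_le (hP.lam_mem t).1
  have : (run P f g a x₀ (t + 1)).x = prox P.r (P.lam t)
      ((run P f g a x₀ t).x - P.lam t • gradEst P f g a x₀ t) := rfl
  rw [this, hP.r_eq, prox_zero hlam]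

lemma Params.IsPlain.isScheme {β : ℝ} (hP : P.IsPlain β) (a : (t : ℕ) → Fin (P.b t) → Ξ)
    (x₀ : Vec d) : IsScheme β P.lam (fun t => (run P f g a x₀ t).x) (fun t => (run P f g a x₀ t).y)
      (zIter P f g a x₀) (gradEst P f g a x₀) where
  init := rfl
  z_eq t := by rw [zIter_eq, hP.α_eq]
  x_succ t := hP.run_succ_x a x₀ t
  y_succ t := by
    have hlam : P.lam t ≠ 0 := (hP.β_pos.trans_le (hP.lam_mem t).1).ne'
    have : (run P f g a x₀ (t + 1)).y = zIter P f g a x₀ t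
        + (P.β t / P.lam t) • ((run P f g a x₀ (t + 1)).x - (run P f g a x₀ t).x) := rfl
    rw [this, hP.run_succ_x, sub_sub_cancel_left, hP.β_eq, smul_neg, smul_smul,
      div_mul_cancel₀ _ hlam, sub_eq_add_neg]
  β_pos := hP.β_pos
  lam_mem := hP.lam_mem

/-! ### Deterministic a priori bounds on the iterates -/

section Bounds

variable [MeasurableSpace Ξ] {D : Measure Ξ} {lf Lf lg Lg : ℝ≥0}

/-- A crude bound, growing with `t`, that holds for every choice of batches. Through the bounds on
the iterates it serves integrability only and enters no rate. -/
lemma norm_run_Jt_le (h : IsProblem D f g lf Lf lg Lg) (a : (t : ℕ) → Fin (P.b t) → Ξ)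
    (x₀ : Vec d) (t : ℕ) : ‖(run P f g a x₀ t).Jt‖ ≤ 2 * lg * t := by
  have hlg : (0 : ℝ) ≤ lg := lg.2
  induction t with
  | zero => simp [run]
  | succ t ih =>
    have e : (run P f g a x₀ (t + 1)).Jt = if t % P.τ = 0
        then avg fun i => fderiv ℝ (g (a t i)) (zIter P f g a x₀ t)
        else (run P f g a x₀ t).Jt + avg fun i => fderiv ℝ (g (a t i)) (zIter P f g a x₀ t)
          - fderiv ℝ (g (a t i)) (run P f g a x₀ t).z := rfl
    rw [e]
    push_cast
    split_ifs
    · have h1 : ‖avg fun i => fderiv ℝ (g (a t i)) (zIter P f g a x₀ t)‖ ≤ lg :=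
        norm_avg_le hlg fun i => h.norm_fderiv_le _ _
      have h2 : 0 ≤ 2 * (lg : ℝ) * t := by positivity
      linarith
    · have h1 : ‖avg fun i => fderiv ℝ (g (a t i)) (zIter P f g a x₀ t)
          - fderiv ℝ (g (a t i)) (run P f g a x₀ t).z‖ ≤ 2 * lg := by
        refine norm_avg_le (by positivity) fun i => ?_
        have h2 := norm_sub_le (fderiv ℝ (g (a t i)) (zIter P f g a x₀ t))
          (fderiv ℝ (g (a t i)) (run P f g a x₀ t).z)
        have h3 := h.norm_fderiv_le (a t i) (zIter P f g a x₀ t)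
        have h4 := h.norm_fderiv_le (a t i) (run P f g a x₀ t).z
        linarith
      refine (norm_add_le _ _).trans ?_
      linarith

lemma norm_gradEst_le (h : IsProblem D f g lf Lf lg Lg) (a : (t : ℕ) → Fin (P.b t) → Ξ)
    (x₀ : Vec d) (t : ℕ) : ‖gradEst P f g a x₀ t‖ ≤ 2 * lg * (t + 1 : ℕ) * lf := by
  refine (norm_adjoint_apply_le _ _).trans ?_
  gcongr
  · exact norm_run_Jt_le h a x₀ (t + 1)
  · exact h.norm_gradient_le _

/-- The iterates stay within a distance of the starting point that depends only on `t`. -/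
lemma exists_norm_run_sub_le (h : IsProblem D f g lf Lf lg Lg) {β : ℝ} (hP : P.IsPlain β)
    (t : ℕ) : ∃ R : ℝ, 0 ≤ R ∧ ∀ (a : (t : ℕ) → Fin (P.b t) → Ξ) (x₀ : Vec d),
      ‖(run P f g a x₀ t).x - x₀‖ ≤ R ∧ ‖(run P f g a x₀ t).y - x₀‖ ≤ R := by
  induction t with
  | zero => exact ⟨0, le_rfl, fun a x₀ => by simp [run]⟩
  | succ t ih =>
    obtain ⟨R, hR0, hR⟩ := ih
    set B : ℝ := 2 * lg * (t + 1 : ℕ) * lf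
    have hB : 0 ≤ B := by positivity
    have hβ := hP.β_pos
    have hlam : 0 ≤ P.lam t := (hβ.trans_le (hP.lam_mem t).1).le
    refine ⟨|1 - P.α (t + 1)| * R + |P.α (t + 1)| * R + R + P.lam t * B + β * B,
      by positivity, fun a x₀ => ?_⟩
    obtain ⟨hx, hy⟩ := hR a x₀
    have hv := norm_gradEst_le (P := P) h a x₀ t
    have hS := hP.isScheme (f := f) (g := g) a x₀
    have hRα : 0 ≤ |1 - P.α (t + 1)| * R + |P.α (t + 1)| * R := by positivity
    have hlB : 0 ≤ P.lam t * B := by positivity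
    have hβB : 0 ≤ β * B := by positivity
    constructor
    · have e : (run P f g a x₀ (t + 1)).x - x₀ = ((run P f g a x₀ t).x - x₀)
          - P.lam t • gradEst P f g a x₀ t := by rw [hS.x_succ]; abel
      rw [e]
      refine (norm_sub_le _ _).trans ?_
      rw [norm_smul, Real.norm_of_nonneg hlam]
      have : P.lam t * ‖gradEst P f g a x₀ t‖ ≤ P.lam t * B := by gcongr
      linarith
    · have e : (run P f g a x₀ (t + 1)).y - x₀ =
          (1 - P.α (t + 1)) • ((run P f g a x₀ t).y - x₀)
          + P.α (t + 1) • ((run P f g a x₀ t).x - x₀) - β • gradEst P f g a x₀ t := by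
        rw [hS.y_succ, zIter_eq]; module
      rw [e]
      refine (norm_sub_le _ _).trans ((add_le_add_left (norm_add_le _ _) _).trans ?_)
      rw [norm_smul, norm_smul, norm_smul, Real.norm_of_nonneg hβ.le, Real.norm_eq_abs,
        Real.norm_eq_abs]
      have h1 : β * ‖gradEst P f g a x₀ t‖ ≤ β * B := by gcongr
      have h2 : |1 - P.α (t + 1)| * ‖(run P f g a x₀ t).y - x₀‖ ≤ |1 - P.α (t + 1)| * R := by
        gcongr
      have h3 : |P.α (t + 1)| * ‖(run P f g a x₀ t).x - x₀‖ ≤ |P.α (t + 1)| * R := by gcongr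
      linarith

lemma exists_norm_zIter_sub_le (h : IsProblem D f g lf Lf lg Lg) {β : ℝ} (hP : P.IsPlain β)
    (T : ℕ) : ∃ R : ℝ, 0 ≤ R ∧ ∀ (a : (t : ℕ) → Fin (P.b t) → Ξ) (x₀ : Vec d), ∀ t < T,
      ‖zIter P f g a x₀ t - x₀‖ ≤ R := by
  choose R hR0 hR using fun t => exists_norm_run_sub_le (f := f) (g := g) h hP t
  have hnn : ∀ t, 0 ≤ |1 - P.α (t + 1)| * R t + |P.α (t + 1)| * R t := fun t => by
    have := hR0 t; positivity
  refine ⟨∑ t ∈ Finset.range T, (|1 - P.α (t + 1)| * R t + |P.α (t + 1)| * R t),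
    Finset.sum_nonneg fun t _ => hnn t, fun a x₀ t ht => ?_⟩
  refine le_trans ?_ (Finset.single_le_sum (fun t _ => hnn t) (Finset.mem_range.2 ht))
  obtain ⟨hx, hy⟩ := hR t a x₀
  have e : zIter P f g a x₀ t - x₀ = (1 - P.α (t + 1)) • ((run P f g a x₀ t).y - x₀)
      + P.α (t + 1) • ((run P f g a x₀ t).x - x₀) := by
    rw [zIter_eq]; module
  rw [e]
  refine (norm_add_le _ _).trans ?_
  rw [norm_smul, norm_smul, Real.norm_eq_abs, Real.norm_eq_abs]
  gcongr

end Bounds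

/-! ### The errors of the estimates -/

section Errors

variable [MeasurableSpace Ξ] {D : Measure Ξ} {lf Lf lg Lg : ℝ≥0}

/-- The error of the estimates made in iteration `t`. -/
def runErr (D : Measure Ξ) (lf Lf lg : ℝ≥0) (P : Params d) (f : Vec p → ℝ)
    (g : Ξ → Vec d → Vec p) (a : (t : ℕ) → Fin (P.b t) → Ξ) (x₀ : Vec d) (t : ℕ) :
    EuclideanSpace ℝ (Fin p ⊕ Fin d × Fin p) :=
  IsProblem.estErr D lf Lf lg g (zIter P f g a x₀ t) (run P f g a x₀ (t + 1)).gt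
    (run P f g a x₀ (t + 1)).Jt

variable [IsProbabilityMeasure D]

lemma runErr_of_checkpoint (h : IsProblem D f g lf Lf lg Lg) (a : (t : ℕ) → Fin (P.b t) → Ξ)
    (x₀ : Vec d) {t : ℕ} (ht : t % P.τ = 0) : runErr D lf Lf lg P f g a x₀ t
      = (avg fun i => IsProblem.sampleMap lf Lf lg g (a t i) (zIter P f g a x₀ t))
        - ∫ ξ, IsProblem.sampleMap lf Lf lg g ξ (zIter P f g a x₀ t) ∂D := by
  have e : (run P f g a x₀ (t + 1)).Jt = if t % P.τ = 0
      then avg fun i => fderiv ℝ (g (a t i)) (zIter P f g a x₀ t)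
      else (run P f g a x₀ t).Jt + avg fun i => fderiv ℝ (g (a t i)) (zIter P f g a x₀ t)
        - fderiv ℝ (g (a t i)) (run P f g a x₀ t).z := rfl
  have e' : (run P f g a x₀ (t + 1)).gt = if t % P.τ = 0
      then avg fun i => g (a t i) (zIter P f g a x₀ t)
      else (run P f g a x₀ t).gt + avg fun i => g (a t i) (zIter P f g a x₀ t)
        - g (a t i) (run P f g a x₀ t).z := rfl
  rw [if_pos ht] at e e'
  rw [runErr, IsProblem.estErr, e, e', h.integral_sampleMap, ← Prod.mk_sub_mk, map_sub,
    avg_prodMk, map_avg]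
  rfl

/-- The martingale form of the recursion: the previous error plus a batch average of differences
minus its mean. It is an exact identity because the two means telescope with the estimates. -/
lemma runErr_succ (h : IsProblem D f g lf Lf lg Lg) (a : (t : ℕ) → Fin (P.b t) → Ξ)
    (x₀ : Vec d) {t : ℕ} (ht : (t + 1) % P.τ ≠ 0) : runErr D lf Lf lg P f g a x₀ (t + 1)
      = runErr D lf Lf lg P f g a x₀ t
        + ((avg fun i => IsProblem.sampleMap lf Lf lg g (a (t + 1) i) (zIter P f g a x₀ (t + 1))
            - IsProblem.sampleMap lf Lf lg g (a (t + 1) i) (zIter P f g a x₀ t))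
          - (∫ ξ, IsProblem.sampleMap lf Lf lg g ξ (zIter P f g a x₀ (t + 1)) ∂D
            - ∫ ξ, IsProblem.sampleMap lf Lf lg g ξ (zIter P f g a x₀ t) ∂D)) := by
  have e : (run P f g a x₀ (t + 1 + 1)).Jt = if (t + 1) % P.τ = 0
      then avg fun i => fderiv ℝ (g (a (t + 1) i)) (zIter P f g a x₀ (t + 1))
      else (run P f g a x₀ (t + 1)).Jt
        + avg fun i => fderiv ℝ (g (a (t + 1) i)) (zIter P f g a x₀ (t + 1))
        - fderiv ℝ (g (a (t + 1) i)) (zIter P f g a x₀ t) := rfl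
  have e' : (run P f g a x₀ (t + 1 + 1)).gt = if (t + 1) % P.τ = 0
      then avg fun i => g (a (t + 1) i) (zIter P f g a x₀ (t + 1))
      else (run P f g a x₀ (t + 1)).gt + avg fun i => g (a (t + 1) i) (zIter P f g a x₀ (t + 1))
        - g (a (t + 1) i) (zIter P f g a x₀ t) := rfl
  rw [if_neg ht] at e e'
  have e'' : (fun i => IsProblem.sampleMap lf Lf lg g (a (t + 1) i) (zIter P f g a x₀ (t + 1))
      - IsProblem.sampleMap lf Lf lg g (a (t + 1) i) (zIter P f g a x₀ t))
      = fun i => stack d p (lg * Lf) lf (g (a (t + 1) i) (zIter P f g a x₀ (t + 1))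
        - g (a (t + 1) i) (zIter P f g a x₀ t),
        fderiv ℝ (g (a (t + 1) i)) (zIter P f g a x₀ (t + 1))
        - fderiv ℝ (g (a (t + 1) i)) (zIter P f g a x₀ t)) := by
    ext1 i
    rw [IsProblem.sampleMap, IsProblem.sampleMap, ← map_sub, Prod.mk_sub_mk]
  rw [runErr, runErr, IsProblem.estErr, IsProblem.estErr, e, e', e'', h.integral_sampleMap,
    h.integral_sampleMap, ← map_avg, ← map_sub, ← map_sub, ← map_add, ← avg_prodMk,
    Prod.mk_sub_mk, Prod.mk_sub_mk, Prod.mk_add_mk]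
  have hc : ∀ {V : Type} [AddCommGroup V] (u a w w' : V), u + a - w = u - w' + (a - (w - w')) :=
    fun u a w w' => by abel
  congr 2
  · exact hc _ _ _ _
  · exact hc _ _ _ _

end Errors

/-! ### Measurability -/

section Measurability

variable [MeasurableSpace Ξ] {D : Measure Ξ} {lf Lf lg Lg : ℝ≥0} {Ω : Type*} [MeasurableSpace Ω]

lemma Measurable.gradEst_apply {J : Ω → Vec d →L[ℝ] Vec p} {u : Ω → Vec p}
    (hf : Continuous (gradient f)) (hJ : Measurable J) (hu : Measurable u) :
    Measurable fun ω => ContinuousLinearMap.adjoint (J ω) (gradient f (u ω)) := by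
  have hadj : Continuous fun J : Vec d →L[ℝ] Vec p => ContinuousLinearMap.adjoint J :=
    LinearIsometryEquiv.continuous _
  have happ : Continuous fun q : (Vec p →L[ℝ] Vec d) × Vec p => q.1 q.2 :=
    isBoundedBilinearMap_apply.continuous
  exact happ.measurable.comp ((hadj.measurable.comp hJ).prodMk (hf.measurable.comp hu))

/-- The σ-algebra on `Ω` is arbitrary and only the batches before `t` have to be measurable. Taking
it to be generated by the past therefore yields adaptedness, and from it independence of the next
batch. -/
lemma measurable_run (h : IsProblem D f g lf Lf lg Lg) {β : ℝ} (hP : P.IsPlain β)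
    {A : (t : ℕ) → Ω → Fin (P.b t) → Ξ} {X : Ω → Vec d} (hX : Measurable X) (t : ℕ)
    (hA : ∀ s < t, Measurable (A s)) :
    Measurable (fun ω => (run P f g (fun s => A s ω) (X ω) t).x) ∧
    Measurable (fun ω => (run P f g (fun s => A s ω) (X ω) t).y) ∧
    Measurable (fun ω => (run P f g (fun s => A s ω) (X ω) t).z) ∧
    Measurable (fun ω => (run P f g (fun s => A s ω) (X ω) t).gt) ∧
    Measurable (fun ω => (run P f g (fun s => A s ω) (X ω) t).Jt) := by
  induction t with
  | zero => exact ⟨hX, hX, hX, measurable_const, measurable_const⟩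
  | succ t ih =>
    obtain ⟨hx, hy, hz, hgt, hJt⟩ := ih fun s hs => hA s (by omega)
    have hAt := hA t (Nat.lt_succ_self t)
    have hz' : Measurable fun ω => (run P f g (fun s => A s ω) (X ω) (t + 1)).z :=
      (hy.const_smul (1 - P.α (t + 1))).add (hx.const_smul (P.α (t + 1)))
    have hAi : ∀ i, Measurable fun ω => A t ω i := fun i => (measurable_pi_apply i).comp hAt
    have hG : ∀ {w : Ω → Vec d} (_ : Measurable w) (i), Measurable fun ω => g (A t ω i) (w ω) :=
      fun hw i => h.measurable_uncurry.comp ((hAi i).prodMk hw)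
    have hJ : ∀ {w : Ω → Vec d} (_ : Measurable w) (i),
        Measurable fun ω => fderiv ℝ (g (A t ω i)) (w ω) :=
      fun hw i => h.measurable_uncurry_fderiv.comp ((hAi i).prodMk hw)
    have hgt' : Measurable fun ω => (run P f g (fun s => A s ω) (X ω) (t + 1)).gt := by
      have e : (fun ω => (run P f g (fun s => A s ω) (X ω) (t + 1)).gt) = fun ω =>
          if t % P.τ = 0
          then avg fun i => g (A t ω i) (run P f g (fun s => A s ω) (X ω) (t + 1)).z
          else (run P f g (fun s => A s ω) (X ω) t).gt
            + avg fun i => g (A t ω i) (run P f g (fun s => A s ω) (X ω) (t + 1)).z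
            - g (A t ω i) (run P f g (fun s => A s ω) (X ω) t).z := rfl
      rw [e]
      split_ifs
      · exact Measurable.avg fun i => hG hz' i
      · exact hgt.add (Measurable.avg fun i => (hG hz' i).sub (hG hz i))
    have hJt' : Measurable fun ω => (run P f g (fun s => A s ω) (X ω) (t + 1)).Jt := by
      have e : (fun ω => (run P f g (fun s => A s ω) (X ω) (t + 1)).Jt) = fun ω =>
          if t % P.τ = 0
          then avg fun i => fderiv ℝ (g (A t ω i)) (run P f g (fun s => A s ω) (X ω) (t + 1)).z
          else (run P f g (fun s => A s ω) (X ω) t).Jt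
            + avg fun i => fderiv ℝ (g (A t ω i)) (run P f g (fun s => A s ω) (X ω) (t + 1)).z
            - fderiv ℝ (g (A t ω i)) (run P f g (fun s => A s ω) (X ω) t).z := rfl
      rw [e]
      split_ifs
      · exact Measurable.avg fun i => hJ hz' i
      · exact hJt.add (Measurable.avg fun i => (hJ hz' i).sub (hJ hz i))
    have hv : Measurable fun ω => gradEst P f g (fun s => A s ω) (X ω) t :=
      Measurable.gradEst_apply h.smooth.f_grad_lip.continuous hJt' hgt'
    refine ⟨?_, ?_, hz', hgt', hJt'⟩
    · simp only [hP.run_succ_x]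
      exact hx.sub (hv.const_smul (P.lam t))
    · have e : (fun ω => (run P f g (fun s => A s ω) (X ω) (t + 1)).y) = fun ω =>
          (run P f g (fun s => A s ω) (X ω) (t + 1)).z
          - β • gradEst P f g (fun s => A s ω) (X ω) t :=
        funext fun ω => (hP.isScheme (f := f) (g := g) (fun s => A s ω) (X ω)).y_succ t
      rw [e]
      exact hz'.sub (hv.const_smul β)

lemma measurable_zIter (h : IsProblem D f g lf Lf lg Lg) {β : ℝ} (hP : P.IsPlain β)
    {A : (t : ℕ) → Ω → Fin (P.b t) → Ξ} {X : Ω → Vec d} (hX : Measurable X) (t : ℕ)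
    (hA : ∀ s < t, Measurable (A s)) :
    Measurable fun ω => zIter P f g (fun s => A s ω) (X ω) t := by
  obtain ⟨hx, hy, -⟩ := measurable_run h hP hX t hA
  exact (hy.const_smul (1 - P.α (t + 1))).add (hx.const_smul (P.α (t + 1)))

lemma measurable_runErr [IsProbabilityMeasure D] (h : IsProblem D f g lf Lf lg Lg) {β : ℝ}
    (hP : P.IsPlain β)
    {A : (t : ℕ) → Ω → Fin (P.b t) → Ξ} {X : Ω → Vec d} (hX : Measurable X) (t : ℕ)
    (hA : ∀ s < t + 1, Measurable (A s)) :
    Measurable fun ω => runErr D lf Lf lg P f g (fun s => A s ω) (X ω) t := by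
  obtain ⟨-, -, hz, hgt, hJt⟩ := measurable_run h hP hX (t + 1) hA
  have h1 : Continuous (meanMap D g) := h.lipschitzWith_meanMap.continuous
  have h2 : Continuous fun x => fderiv ℝ (meanMap D g) x := by
    refine (LipschitzWith.of_dist_le_mul (K := Lg) fun x y => ?_).continuous
    rw [dist_eq_norm, dist_eq_norm]
    exact h.norm_fderiv_meanMap_sub_le x y
  exact (ContinuousLinearMap.continuous _).measurable.comp
    ((hgt.sub (h1.measurable.comp hz)).prodMk (hJt.sub (h2.measurable.comp hz)))

lemma measurable_apply_nat {V : Type*} [MeasurableSpace V] {Z : ℕ → Ω → V} {ζ : Ω → ℕ}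
    (hZ : ∀ t, Measurable (Z t)) (hζ : Measurable ζ) : Measurable fun ω => Z (ζ ω) ω := by
  have : Measurable (Function.uncurry Z) := measurable_from_prod_countable_right hZ
  exact this.comp (hζ.prodMk measurable_id)

lemma measurable_restart (h : IsProblem D f g lf Lf lg Lg) {β : ℝ} (hP : P.IsPlain β)
    {A : ℕ → (t : ℕ) → Ω → Fin (P.b t) → Ξ} {ζ : ℕ → Ω → ℕ} (x₀ : Vec d) (m : ℕ)
    (hA : ∀ k < m, ∀ t, Measurable (A k t)) (hζ : ∀ k < m, Measurable (ζ k)) :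
    Measurable fun ω => restart P f g (fun k t => A k t ω) (fun k => ζ k ω) x₀ m := by
  induction m with
  | zero => exact measurable_const
  | succ m ih =>
    have hm := ih (fun k hk => hA k (by omega)) (fun k hk => hζ k (by omega))
    exact measurable_apply_nat (fun t => measurable_zIter h hP hm t
      fun s _ => hA m (Nat.lt_succ_self m) s) (hζ m (Nat.lt_succ_self m))

end Measurability

end Run

/-! ### Selecting a random index -/

section RandomIndex

variable {Ω : Type*} [MeasurableSpace Ω] {μ : Measure Ω}

lemma uniformOn_Iio_singleton {T t : ℕ} (ht : t < T) :
    uniformOn (Set.Iio T) {t} = (T : ENNReal)⁻¹ := by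
  rw [uniformOn, cond_apply measurableSet_Iio,
    Set.inter_eq_self_of_subset_right (by simpa using ht), Measure.count_singleton, mul_one,
    ← Finset.coe_Iio, Measure.count_apply_finset]
  simp

lemma ae_lt_of_map_eq_uniformOn {T : ℕ} {ζ : Ω → ℕ} (hζ : Measurable ζ)
    (hlaw : μ.map ζ = uniformOn (Set.Iio T)) : ∀ᵐ ω ∂μ, ζ ω < T := by
  have h : ∀ᵐ t ∂(μ.map ζ), t ∈ Set.Iio T := by
    rw [hlaw, uniformOn]
    exact ae_cond_mem measurableSet_Iio
  exact ae_of_ae_map hζ.aemeasurable h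

/-- The mean of a family at an independent uniform index. -/
lemma integral_apply_uniform_index [IsProbabilityMeasure μ] {T : ℕ} {ζ : Ω → ℕ} (hζ : Measurable ζ)
    (hlaw : μ.map ζ = uniformOn (Set.Iio T)) {φ : ℕ → Ω → ℝ}
    (hint : ∀ t < T, Integrable (φ t) μ) (hind : ∀ t, IndepFun (φ t) ζ μ) :
    ∫ ω, φ (ζ ω) ω ∂μ = (T : ℝ)⁻¹ * ∑ t ∈ Finset.range T, ∫ ω, φ t ω ∂μ := by
  have hmeas : ∀ t, MeasurableSet (ζ ⁻¹' {t}) := fun t => hζ (measurableSet_singleton t)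
  have hae : (fun ω => φ (ζ ω) ω) =ᵐ[μ] fun ω =>
      ∑ t ∈ Finset.range T, φ t ω * (if ζ ω = t then 1 else 0) := by
    filter_upwards [ae_lt_of_map_eq_uniformOn hζ hlaw] with ω hω
    simp [hω]
  have hind' : ∀ t, IndepFun (φ t) (fun ω => if ζ ω = t then (1 : ℝ) else 0) μ := fun t =>
    (hind t).comp (φ := id) (ψ := fun k => if k = t then (1 : ℝ) else 0) measurable_id
      (measurable_of_countable _)
  have hite : ∀ t, (fun ω => if ζ ω = t then (1 : ℝ) else 0) = (ζ ⁻¹' {t}).indicator 1 := by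
    intro t
    ext ω
    by_cases hω : ζ ω = t <;> simp [hω]
  have hi : ∀ t, Integrable (fun ω => if ζ ω = t then (1 : ℝ) else 0) μ := fun t => by
    rw [hite]
    exact (integrable_indicator_iff (hmeas t)).2 (integrable_const _).integrableOn
  rw [integral_congr_ae hae, integral_finsetSum, Finset.mul_sum]
  · refine Finset.sum_congr rfl fun t ht => ?_
    have htT := Finset.mem_range.1 ht
    rw [(hind' t).integral_fun_mul_eq_mul_integral (hint t htT).1 (hi t).1, mul_comm]
    congr 1
    rw [hite, integral_indicator_one (hmeas t), Measure.real,
      ← Measure.map_apply hζ (measurableSet_singleton t), hlaw, uniformOn_Iio_singleton htT]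
    simp
  · intro t ht
    exact (hind' t).integrable_mul (hint t (Finset.mem_range.1 ht)) (hi t)

end RandomIndex

/-! ### One run -/

/-- Sampling with a batch law of constant `C₀` at checkpoints and `1 / τ` in between. -/
structure IsReducedSampling {Ω Ξ : Type*} [MeasurableSpace Ω] [MeasurableSpace Ξ] (μ : Measure Ω)
    (D : Measure Ξ) (τ : ℕ) (C₀ : ℝ)
    {b : ℕ → ℕ} (A : ℕ → (t : ℕ) → Ω → Fin (b t) → Ξ) (ζ : ℕ → Ω → ℕ) (T : ℕ) :
    Prop extends IsSampling μ A ζ T where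
  checkpoint : ∀ m t, t % τ = 0 → BatchLaw D (μ.map (A m t)) C₀
  mini : ∀ m t, t % τ ≠ 0 → BatchLaw D (μ.map (A m t)) (τ : ℝ)⁻¹

namespace IsSampling

variable {Ω Ξ : Type*} [MeasurableSpace Ξ]
  {b : ℕ → ℕ} {A : ℕ → (t : ℕ) → Ω → Fin (b t) → Ξ} {ζ : ℕ → Ω → ℕ} {T : ℕ}

/-- The σ-algebra of a batch or of an index. -/
@[reducible]
def sig (A : ℕ → (t : ℕ) → Ω → Fin (b t) → Ξ) (ζ : ℕ → Ω → ℕ) (i : (ℕ × ℕ) ⊕ ℕ) :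
    MeasurableSpace Ω :=
  Sum.elim (fun q : ℕ × ℕ => MeasurableSpace.comap (A q.1 q.2) inferInstance)
    (fun m : ℕ => MeasurableSpace.comap (ζ m) inferInstance) i

/-- The σ-algebra of a set of batches and indices. -/
@[reducible]
def sigSup (A : ℕ → (t : ℕ) → Ω → Fin (b t) → Ξ) (ζ : ℕ → Ω → ℕ) (I : Set ((ℕ × ℕ) ⊕ ℕ)) :
    MeasurableSpace Ω := ⨆ i ∈ I, sig A ζ i

lemma measurable_A_sigSup {I : Set ((ℕ × ℕ) ⊕ ℕ)} {m t : ℕ} (hi : Sum.inl (m, t) ∈ I) :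
    Measurable[sigSup A ζ I] (A m t) := by
  have h1 : sig A ζ (Sum.inl (m, t)) ≤ sigSup A ζ I := le_iSup₂_of_le _ hi le_rfl
  exact Measurable.mono (comap_measurable (A m t)) h1 le_rfl

lemma measurable_ζ_sigSup {I : Set ((ℕ × ℕ) ⊕ ℕ)} {m : ℕ} (hi : Sum.inr m ∈ I) :
    Measurable[sigSup A ζ I] (ζ m) := by
  have h1 : sig A ζ (Sum.inr m) ≤ sigSup A ζ I := le_iSup₂_of_le _ hi le_rfl
  exact Measurable.mono (comap_measurable (ζ m)) h1 le_rfl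

variable [mΩ : MeasurableSpace Ω] {μ : Measure Ω}

lemma sig_le (h : IsSampling μ A ζ T) (i : (ℕ × ℕ) ⊕ ℕ) : sig A ζ i ≤ mΩ := by
  rcases i with q | m
  · exact (h.measurable_A q.1 q.2).comap_le
  · exact (h.measurable_ζ m).comap_le

lemma sigSup_le (h : IsSampling μ A ζ T) (I : Set ((ℕ × ℕ) ⊕ ℕ)) : sigSup A ζ I ≤ mΩ :=
  iSup₂_le fun i _ => h.sig_le i

lemma indep_sigSup_sig (h : IsSampling μ A ζ T) {I : Set ((ℕ × ℕ) ⊕ ℕ)} {i : (ℕ × ℕ) ⊕ ℕ}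
    (hi : i ∉ I) : Indep (sigSup A ζ I) (sig A ζ i) μ := by
  have := indep_iSup_of_disjoint (m := sig A ζ) h.sig_le h.indep (S := I) (T := {i})
    (Set.disjoint_singleton_right.2 hi)
  simpa [sigSup] using this

lemma indepFun_A (h : IsSampling μ A ζ T) {I : Set ((ℕ × ℕ) ⊕ ℕ)} {m t : ℕ}
    (hi : Sum.inl (m, t) ∉ I) {𝒳 : Type*} [MeasurableSpace 𝒳] {X : Ω → 𝒳}
    (hX : Measurable[sigSup A ζ I] X) : IndepFun X (A m t) μ := by
  rw [IndepFun_iff_Indep]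
  exact indep_of_indep_of_le_left (h.indep_sigSup_sig hi) (measurable_iff_comap_le.1 hX)

lemma indepFun_ζ (h : IsSampling μ A ζ T) {I : Set ((ℕ × ℕ) ⊕ ℕ)} {m : ℕ}
    (hi : Sum.inr m ∉ I) {𝒳 : Type*} [MeasurableSpace 𝒳] {X : Ω → 𝒳}
    (hX : Measurable[sigSup A ζ I] X) : IndepFun X (ζ m) μ := by
  rw [IndepFun_iff_Indep]
  exact indep_of_indep_of_le_left (h.indep_sigSup_sig hi) (measurable_iff_comap_le.1 hX)

/-- The batches and indices of the runs before run `m`, and the batches of run `m` before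
iteration `t`. -/
def before (m t : ℕ) : Set ((ℕ × ℕ) ⊕ ℕ) :=
  {i | Sum.elim (fun q : ℕ × ℕ => q.1 < m ∨ (q.1 = m ∧ q.2 < t)) (fun k : ℕ => k < m) i}

end IsSampling

/-- The root is at least `4 L_F`, so the step-size condition gives `16 L_F β ≤ 1`. Moreover `G₀ ≤ 2
L_F²`, from `a² + b² ≤ (a + b)²` with `a = l_g² L_f` and `b = l_f L_g`, whence `2 / 16² = 1 / 128`.
-/
lemma mul_LF_le_and_G0_mul_sq_le {lf Lf lg Lg : ℝ≥0} {β : ℝ} {lam : ℕ → ℝ}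
    (h : StepSizes lf Lf lg Lg β lam) :
    LF lf Lf lg Lg * β ≤ 1 / 16 ∧ G0 lf Lf lg Lg * β ^ 2 ≤ 1 / 128 := by
  have hβ := h.pos
  have hL : 0 ≤ LF lf Lf lg Lg := by unfold LF; positivity
  have hG : 0 ≤ G0 lf Lf lg Lg := by unfold G0; positivity
  have hGL : G0 lf Lf lg Lg ≤ 2 * LF lf Lf lg Lg ^ 2 := by
    unfold G0 LF
    have : 0 ≤ (lg : ℝ) ^ 2 * Lf * (lf * Lg) := by positivity
    nlinarith
  have hs : 4 * LF lf Lf lg Lg ≤ √(16 * LF lf Lf lg Lg ^ 2 + 6 * G0 lf Lf lg Lg) := by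
    apply Real.le_sqrt_of_sq_le
    nlinarith
  have h1 : LF lf Lf lg Lg * β ≤ 1 / 16 := by
    have := h.le
    nlinarith [mul_le_mul_of_nonneg_left hs hβ.le]
  refine ⟨h1, ?_⟩
  have h2 : 0 ≤ LF lf Lf lg Lg * β := by positivity
  calc G0 lf Lf lg Lg * β ^ 2 ≤ 2 * LF lf Lf lg Lg ^ 2 * β ^ 2 := by gcongr
    _ = 2 * (LF lf Lf lg Lg * β) ^ 2 := by ring
    _ ≤ 2 * (1 / 16) ^ 2 := by gcongr
    _ = _ := by norm_num

section OneRun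

variable {d p : ℕ} {Ξ Ω : Type*} [MeasurableSpace Ξ] {D : Measure Ξ}
  {f : Vec p → ℝ} {g : Ξ → Vec d → Vec p} {lf Lf lg Lg : ℝ≥0} {P : Params d} {β : ℝ}
  {A : ℕ → (t : ℕ) → Ω → Fin (P.b t) → Ξ} {ζ : ℕ → Ω → ℕ} {T : ℕ} {C₀ δ : ℝ} (x₀ : Vec d)

open IsSampling in
lemma measurable_restart_before (h : IsProblem D f g lf Lf lg Lg) (hP : P.IsPlain β) (m t : ℕ) :
    Measurable[sigSup A ζ (before m t)]
      fun ω => restart P f g (fun k t => A k t ω) (fun k => ζ k ω) x₀ m := by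
  let _ := sigSup A ζ (before m t)
  exact measurable_restart h hP x₀ m
    (fun k hk s => measurable_A_sigSup (by simp [before, hk]))
    (fun k hk => measurable_ζ_sigSup (by simp [before, hk]))

-- The point `z_s` is fixed before batch `s` is drawn. It is therefore independent of every batch of
-- the same run from iteration `t ≥ s` on, and of the index of that run.
open IsSampling in
lemma measurable_zRestart_before (h : IsProblem D f g lf Lf lg Lg) (hP : P.IsPlain β)
    {m t s : ℕ} (hst : s ≤ t) : Measurable[sigSup A ζ (before m t)]
      fun ω => zRestart P f g (fun k t => A k t ω) (fun k => ζ k ω) x₀ m s := by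
  have hX := measurable_restart_before (A := A) (ζ := ζ) x₀ h hP m t
  let _ := sigSup A ζ (before m t)
  exact measurable_zIter h hP hX s
    (fun r hr => measurable_A_sigSup (by simp [before]; omega))

-- The error of iteration `t` involves batch `t` itself, hence the past up to `t + 1`.
open IsSampling in
lemma measurable_runErr_before [IsProbabilityMeasure D] (h : IsProblem D f g lf Lf lg Lg) (hP : P.IsPlain β)
    (m t : ℕ) : Measurable[sigSup A ζ (before m (t + 1))]
      fun ω => runErr D lf Lf lg P f g (fun t => A m t ω)
        (restart P f g (fun k t => A k t ω) (fun k => ζ k ω) x₀ m) t := by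
  have hX := measurable_restart_before (A := A) (ζ := ζ) x₀ h hP m (t + 1)
  let _ := sigSup A ζ (before m (t + 1))
  exact measurable_runErr h hP hX t
    (fun r hr => measurable_A_sigSup (by simp [before]; omega))

variable [MeasurableSpace Ω] {μ : Measure Ω}

lemma IsSampling.measurable_restart (hs : IsSampling μ A ζ T) (h : IsProblem D f g lf Lf lg Lg)
    (hP : P.IsPlain β) (m : ℕ) :
    Measurable fun ω => restart P f g (fun k t => A k t ω) (fun k => ζ k ω) x₀ m :=
  MVRC.measurable_restart h hP x₀ m (fun k _ t => hs.measurable_A k t)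
    (fun k _ => hs.measurable_ζ k)

lemma IsSampling.measurable_zRestart (hs : IsSampling μ A ζ T) (h : IsProblem D f g lf Lf lg Lg)
    (hP : P.IsPlain β) (m t : ℕ) :
    Measurable fun ω => zRestart P f g (fun k t => A k t ω) (fun k => ζ k ω) x₀ m t :=
  measurable_zIter h hP (hs.measurable_restart x₀ h hP m) t fun s _ => hs.measurable_A m s

/-- Almost surely, the outputs of the runs stay within a bounded distance of the first starting
point. -/
lemma IsSampling.exists_ae_norm_restart_sub_le (hs : IsSampling μ A ζ T)
    (h : IsProblem D f g lf Lf lg Lg) (hP : P.IsPlain β) (m : ℕ) :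
    ∃ R : ℝ, ∀ᵐ ω ∂μ,
      ‖restart P f g (fun k t => A k t ω) (fun k => ζ k ω) x₀ m - x₀‖ ≤ R := by
  induction m with
  | zero => exact ⟨0, Filter.Eventually.of_forall fun ω => by simp [restart]⟩
  | succ m ih =>
    obtain ⟨R, hR⟩ := ih
    obtain ⟨R', -, hR'⟩ := exists_norm_zIter_sub_le (f := f) (g := g) h hP T
    refine ⟨R' + R, ?_⟩
    filter_upwards [hR, ae_lt_of_map_eq_uniformOn (hs.measurable_ζ m) (hs.law_ζ m)] with ω h1 h2
    refine (norm_sub_le_norm_sub_add_norm_sub _ _ _).trans (add_le_add ?_ h1)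
    exact hR' (fun t => A m t ω) _ _ h2

variable [IsProbabilityMeasure μ] [IsProbabilityMeasure D]

lemma integrable_obj_of_ae_norm_sub_le (h : IsProblem D f g lf Lf lg Lg) {X : Ω → Vec d}
    (hX : Measurable X) {R : ℝ} (hR : ∀ᵐ ω ∂μ, ‖X ω - x₀‖ ≤ R) :
    Integrable (fun ω => onlineObj D f g (X ω)) μ := by
  have hc := h.lipschitzWith_obj
  refine .of_bound (hc.continuous.measurable.comp hX).aestronglyMeasurable
    (‖onlineObj D f g x₀‖ + lf * lg * R) ?_
  filter_upwards [hR] with ω hω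
  have h1 := hc.norm_sub_le (X ω) x₀
  have h2 := norm_le_norm_add_norm_sub' (onlineObj D f g (X ω)) (onlineObj D f g x₀)
  have h3 : ((lf * lg : ℝ≥0) : ℝ) * ‖X ω - x₀‖ ≤ lf * lg * R := by push_cast; gcongr
  linarith

lemma IsSampling.integrable_obj_restart (hs : IsSampling μ A ζ T)
    (h : IsProblem D f g lf Lf lg Lg) (hP : P.IsPlain β) (m : ℕ) :
    Integrable (fun ω => onlineObj D f g
      (restart P f g (fun k t => A k t ω) (fun k => ζ k ω) x₀ m)) μ := by
  obtain ⟨R, hR⟩ := hs.exists_ae_norm_restart_sub_le x₀ h hP m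
  exact integrable_obj_of_ae_norm_sub_le x₀ h (hs.measurable_restart x₀ h hP m) hR

lemma integrable_norm_gradient_obj_pow (h : IsProblem D f g lf Lf lg Lg) {X : Ω → Vec d}
    (hX : Measurable X) (k : ℕ) :
    Integrable (fun ω => ‖gradient (onlineObj D f g) (X ω)‖ ^ k) μ := by
  refine .of_bound ((h.continuous_gradient_obj.measurable.comp hX).norm.pow_const
    k).aestronglyMeasurable (((lg : ℝ) * lf) ^ k) (Filter.Eventually.of_forall fun ω => ?_)
  rw [norm_pow, norm_norm]
  gcongr
  exact h.norm_gradient_obj_le _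

open IsSampling in
/-- The mean squared errors of the estimates along run `m`. -/
lemma IsReducedSampling.sum_integral_norm_runErr_sq_le
    (hs : IsReducedSampling μ D P.τ C₀ A ζ T) (h : IsProblem D f g lf Lf lg Lg)
    (hP : P.IsPlain β)
    (hδ : ∀ x, C₀ * ∫ ξ, ‖IsProblem.sampleMap lf Lf lg g ξ x
      - ∫ ξ, IsProblem.sampleMap lf Lf lg g ξ x ∂D‖ ^ 2 ∂D ≤ δ / 2) (m : ℕ) :
    (∀ t, Integrable (fun ω => ‖zRestart P f g (fun k t => A k t ω) (fun k => ζ k ω) x₀ m (t + 1)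
        - zRestart P f g (fun k t => A k t ω) (fun k => ζ k ω) x₀ m t‖ ^ 2) μ) ∧
    (∀ t, Integrable (fun ω => ‖runErr D lf Lf lg P f g (fun t => A m t ω)
        (restart P f g (fun k t => A k t ω) (fun k => ζ k ω) x₀ m) t‖ ^ 2) μ) ∧
    ∑ t ∈ Finset.range T, ∫ ω, ‖runErr D lf Lf lg P f g (fun t => A m t ω)
        (restart P f g (fun k t => A k t ω) (fun k => ζ k ω) x₀ m) t‖ ^ 2 ∂μ
      ≤ T * (δ / 2) + G0 lf Lf lg Lg / 2 * ∑ t ∈ Finset.range T,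
        ∫ ω, ‖zRestart P f g (fun k t => A k t ω) (fun k => ζ k ω) x₀ m (t + 1)
          - zRestart P f g (fun k t => A k t ω) (fun k => ζ k ω) x₀ m t‖ ^ 2 ∂μ := by
  set z : ℕ → Ω → Vec d := fun t ω =>
    zRestart P f g (fun k t => A k t ω) (fun k => ζ k ω) x₀ m t with hz
  set err : ℕ → Ω → EuclideanSpace ℝ (Fin p ⊕ Fin d × Fin p) := fun t ω =>
    runErr D lf Lf lg P f g (fun t => A m t ω)
      (restart P f g (fun k t => A k t ω) (fun k => ζ k ω) x₀ m) t with herr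
  have hzm : ∀ t, Measurable (z t) := hs.toIsSampling.measurable_zRestart x₀ h hP m
  have hem : ∀ t, Measurable (err t) := fun t =>
    (measurable_runErr_before x₀ h hP m t).mono (hs.sigSup_le _) le_rfl
  have hzz : ∀ t, Integrable (fun ω => ‖z (t + 1) ω - z t ω‖ ^ 2) μ := by
    intro t
    -- Both points lie within `R` of the starting point of run `m`, wherever that random point is,
    -- so no moment of it is needed. The argument `t + 2` covers the indices `t` and `t + 1`.
    obtain ⟨R, -, hR⟩ := exists_norm_zIter_sub_le (P := P) (f := f) (g := g) h hP (t + 2)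
    refine .of_bound (((hzm (t + 1)).sub (hzm t)).norm.pow_const 2).aestronglyMeasurable
      ((R + R) ^ 2) (Filter.Eventually.of_forall fun ω => ?_)
    rw [norm_pow, norm_norm]
    gcongr
    have h1 := hR (fun t => A m t ω) (restart P f g (fun k t => A k t ω) (fun k => ζ k ω) x₀ m)
      (t + 1) (by omega)
    have h2 := hR (fun t => A m t ω) (restart P f g (fun k t => A k t ω) (fun k => ζ k ω) x₀ m)
      t (by omega)
    have h3 := norm_sub_le_norm_sub_add_norm_sub (z (t + 1) ω)
      (restart P f g (fun k t => A k t ω) (fun k => ζ k ω) x₀ m) (z t ω)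
    rw [norm_sub_rev] at h2
    exact h3.trans (add_le_add h1 h2)
  have hcheck : ∀ t, t % P.τ = 0 → MemLp (err t) 2 μ ∧ ∫ ω, ‖err t ω‖ ^ 2 ∂μ ≤ δ / 2 := by
    intro t ht
    have e : err t = fun ω => (avg fun i => IsProblem.sampleMap lf Lf lg g (A m t ω i) (z t ω))
        - ∫ ξ, IsProblem.sampleMap lf Lf lg g ξ (z t ω) ∂D :=
      funext fun ω => runErr_of_checkpoint h _ _ ht
    rw [e]
    exact memLp_and_integral_norm_sq_refresh_le h.measurable_sampleMap h.memLp_sampleMap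
      (hs.measurable_A m t) (hs.checkpoint m t ht) hδ (hzm t)
      (hs.indepFun_A (I := before m t) (by simp [before])
        (measurable_zRestart_before x₀ h hP le_rfl))
  have hupd : ∀ t, (t + 1) % P.τ ≠ 0 → MemLp (err t) 2 μ → MemLp (err (t + 1)) 2 μ ∧
      ∫ ω, ‖err (t + 1) ω‖ ^ 2 ∂μ ≤ ∫ ω, ‖err t ω‖ ^ 2 ∂μ
        + (P.τ : ℝ)⁻¹ * (G0 lf Lf lg Lg / 2) * ∫ ω, ‖z (t + 1) ω - z t ω‖ ^ 2 ∂μ := by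
    intro t ht hL
    have e : err (t + 1) = fun ω => err t ω
        + ((avg fun i => IsProblem.sampleMap lf Lf lg g (A m (t + 1) ω i) (z (t + 1) ω)
            - IsProblem.sampleMap lf Lf lg g (A m (t + 1) ω i) (z t ω))
          - (∫ ξ, IsProblem.sampleMap lf Lf lg g ξ (z (t + 1) ω) ∂D
            - ∫ ξ, IsProblem.sampleMap lf Lf lg g ξ (z t ω) ∂D)) :=
      funext fun ω => runErr_succ h _ _ ht
    rw [e]
    refine memLp_and_integral_norm_sq_update_le h.measurable_sampleMap h.memLp_sampleMap
      h.norm_sampleMap_sub_sq_le (hs.measurable_A m (t + 1)) (by positivity)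
      (hs.mini m (t + 1) ht) (hzm (t + 1)) (hzm t) (hem t) hL (hzz t)
      (hs.indepFun_A (I := before m (t + 1)) (by simp [before]) ?_)
    -- Joint measurability is taken with respect to the past of batch `t + 1`, which makes the whole
    -- triple independent of that batch.
    let _ := sigSup A ζ (before m (t + 1))
    exact (measurable_zRestart_before x₀ h hP le_rfl).prodMk
      ((measurable_zRestart_before x₀ h hP (Nat.le_succ t)).prodMk
        (measurable_runErr_before x₀ h hP m t))
  have hL : ∀ t, MemLp (err t) 2 μ := by
    intro t
    induction t with
    | zero => exact (hcheck 0 (Nat.zero_mod _)).1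
    | succ t ih =>
      by_cases ht : (t + 1) % P.τ = 0
      · exact (hcheck _ ht).1
      · exact (hupd t ht ih).1
  refine ⟨hzz, fun t => (hL t).integrable_norm_pow two_ne_zero, ?_⟩
  refine sum_le_of_epoch_recursion hP.τ_pos (e := fun t => ∫ ω, ‖err t ω‖ ^ 2 ∂μ)
    (a := fun t => ∫ ω, ‖z (t + 1) ω - z t ω‖ ^ 2 ∂μ) (by unfold G0; positivity)
    (fun t => integral_nonneg fun ω => by positivity) (fun t ht => (hcheck t ht).2)
    (fun t ht => ?_) T
  refine (hupd t ht (hL t)).2.trans (le_of_eq ?_)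
  rw [mul_comm (P.τ : ℝ)⁻¹, ← div_eq_mul_inv]

open IsSampling in
/-- One run: the mean squared gradient at the output is controlled by the mean optimality gap at
the starting point. -/
theorem IsReducedSampling.integral_norm_gradient_sq_restart_succ_le
    (hs : IsReducedSampling μ D P.τ C₀ A ζ T) (h : IsProblem D f g lf Lf lg Lg)
    (hP : P.IsPlain β) (hstep : StepSizes lf Lf lg Lg β P.lam) (hT : 0 < T)
    (hδ : ∀ x, C₀ * ∫ ξ, ‖IsProblem.sampleMap lf Lf lg g ξ x
      - ∫ ξ, IsProblem.sampleMap lf Lf lg g ξ x ∂D‖ ^ 2 ∂D ≤ δ / 2) (m : ℕ) :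
    ∫ ω, ‖gradient (onlineObj D f g)
        (restart P f g (fun k t => A k t ω) (fun k => ζ k ω) x₀ (m + 1))‖ ^ 2 ∂μ
      ≤ 2 / (T * β) * (∫ ω, onlineObj D f g
        (restart P f g (fun k t => A k t ω) (fun k => ζ k ω) x₀ m) ∂μ - Fstar (onlineObj D f g))
        + 3 * δ := by
  have hβ := hP.β_pos
  have hT' : (0 : ℝ) < T := by exact_mod_cast hT
  obtain ⟨hLβ, hGβ⟩ := mul_LF_le_and_G0_mul_sq_le hstep
  have hL0 : 0 ≤ LF lf Lf lg Lg := by unfold LF; positivity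
  have hG0 : 0 ≤ G0 lf Lf lg Lg := by unfold G0; positivity
  obtain ⟨hzz, hee, hsum⟩ := hs.sum_integral_norm_runErr_sq_le x₀ h hP hδ m
  set F := onlineObj D f g with hF
  set X : Ω → Vec d := fun ω => restart P f g (fun k t => A k t ω) (fun k => ζ k ω) x₀ m with hX
  set z : ℕ → Ω → Vec d := fun t ω =>
    zRestart P f g (fun k t => A k t ω) (fun k => ζ k ω) x₀ m t with hz
  set err : ℕ → Ω → EuclideanSpace ℝ (Fin p ⊕ Fin d × Fin p) := fun t ω =>
    runErr D lf Lf lg P f g (fun t => A m t ω) (X ω) t with herr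
  have hzm : ∀ t, Measurable (z t) := hs.toIsSampling.measurable_zRestart x₀ h hP m
  have hgint : ∀ t, Integrable (fun ω => ‖gradient F (z t ω)‖ ^ 2) μ := fun t =>
    integrable_norm_gradient_obj_pow h (hzm t) 2
  have hFint : Integrable (fun ω => F (X ω)) μ := hs.integrable_obj_restart x₀ h hP m
  have hpt : ∀ ω, β / 2 * ∑ t ∈ Finset.range T, ‖gradient F (z t ω)‖ ^ 2
      ≤ (F (X ω) - Fstar F) + 3 / 2 * β * (2 * ∑ t ∈ Finset.range T, ‖err t ω‖ ^ 2
        - G0 lf Lf lg Lg * ∑ t ∈ Finset.range T, ‖z (t + 1) ω - z t ω‖ ^ 2) := by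
    intro ω
    refine ((hP.isScheme (f := f) (g := g) (fun t => A m t ω) (X ω)).sum_norm_sq_gradient_le
      (F := F) (gF := gradient F) hL0
      (le_add_inner_add_of_gradient_lipschitz h.differentiable_obj h.norm_gradient_obj_sub_le)
      h.norm_gradient_obj_sub_le h.Fstar_le hLβ hG0 hGβ T).trans ?_
    gcongr
    · exact le_rfl
    · rw [Finset.mul_sum]
      exact Finset.sum_le_sum fun t _ => h.norm_gradEst_sub_sq_le _ _ _
    · exact le_rfl
  have hI1 : Integrable (fun ω => ∑ t ∈ Finset.range T, ‖err t ω‖ ^ 2) μ :=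
    integrable_finsetSum _ fun t _ => hee t
  have hI2 : Integrable (fun ω => ∑ t ∈ Finset.range T, ‖z (t + 1) ω - z t ω‖ ^ 2) μ :=
    integrable_finsetSum _ fun t _ => hzz t
  have hI3 : Integrable (fun ω => ∑ t ∈ Finset.range T, ‖gradient F (z t ω)‖ ^ 2) μ :=
    integrable_finsetSum _ fun t _ => hgint t
  have hI4 : Integrable (fun ω => F (X ω) - Fstar F) μ := hFint.sub (integrable_const _)
  have hI5 : Integrable (fun ω => 2 * ∑ t ∈ Finset.range T, ‖err t ω‖ ^ 2
        - G0 lf Lf lg Lg * ∑ t ∈ Finset.range T, ‖z (t + 1) ω - z t ω‖ ^ 2) μ :=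
    (hI1.const_mul _).sub (hI2.const_mul _)
  have hmono := integral_mono (hI3.const_mul _) (hI4.add (hI5.const_mul _)) hpt
  simp only [Pi.add_apply] at hmono
  rw [integral_const_mul, integral_add hI4 (hI5.const_mul _), integral_const_mul,
    integral_sub (hI1.const_mul _) (hI2.const_mul _), integral_const_mul, integral_const_mul,
    integral_sub hFint (integrable_const _), integral_const, probReal_univ, one_smul,
    integral_finsetSum _ fun t _ => hee t, integral_finsetSum _ fun t _ => hzz t,
    integral_finsetSum _ fun t _ => hgint t] at hmono
  have hsel : ∫ ω, ‖gradient F (z (ζ m ω) ω)‖ ^ 2 ∂μ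
      = (T : ℝ)⁻¹ * ∑ t ∈ Finset.range T, ∫ ω, ‖gradient F (z t ω)‖ ^ 2 ∂μ := by
    refine integral_apply_uniform_index (φ := fun t ω => ‖gradient F (z t ω)‖ ^ 2)
      (hs.measurable_ζ m) (hs.law_ζ m)
      (fun t _ => hgint t) fun t => ?_
    have h1 : IndepFun (z t) (ζ m) μ := hs.indepFun_ζ (I := before m t) (by simp [before])
      (measurable_zRestart_before x₀ h hP le_rfl)
    exact h1.comp (φ := fun x => ‖gradient F x‖ ^ 2) (ψ := id)
      (h.continuous_gradient_obj.measurable.norm.pow_const 2) measurable_id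
  have hgoal : ∫ ω, ‖gradient F
      (restart P f g (fun k t => A k t ω) (fun k => ζ k ω) x₀ (m + 1))‖ ^ 2 ∂μ
      = ∫ ω, ‖gradient F (z (ζ m ω) ω)‖ ^ 2 ∂μ := rfl
  rw [hgoal, hsel]
  set SG := ∑ t ∈ Finset.range T, ∫ ω, ‖gradient F (z t ω)‖ ^ 2 ∂μ
  set gap := ∫ ω, F (X ω) ∂μ - Fstar F
  -- Twice the bound `hsum` cancels the term with `G0` exactly and leaves `T * δ`.
  have h1 : β / 2 * SG ≤ gap + 3 / 2 * β * (T * δ) := by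
    refine hmono.trans ?_
    gcongr
    linarith
  calc (T : ℝ)⁻¹ * SG = 2 / (T * β) * (β / 2 * SG) := by field_simp
    _ ≤ 2 / (T * β) * (gap + 3 / 2 * β * (T * δ)) := by gcongr
    _ = _ := by field_simp

end OneRun

/-! ### Restarts -/

section Restarts

variable {d p : ℕ} {Ξ Ω : Type*} [MeasurableSpace Ξ] {D : Measure Ξ} [IsProbabilityMeasure D]
  {f : Vec p → ℝ} {g : Ξ → Vec d → Vec p} {lf Lf lg Lg : ℝ≥0} {P : Params d} {β : ℝ}
  [MeasurableSpace Ω] {μ : Measure Ω} [IsProbabilityMeasure μ]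
  {A : ℕ → (t : ℕ) → Ω → Fin (P.b t) → Ξ} {ζ : ℕ → Ω → ℕ} {T : ℕ} {C₀ δ v : ℝ}
  {S : Set (Vec d)} (x₀ : Vec d)

/-- The optimality gap after one more run. -/
lemma IsReducedSampling.gap_restart_succ_le
    (hs : IsReducedSampling μ D P.τ C₀ A ζ T) (h : IsProblem D f g lf Lf lg Lg)
    (hP : P.IsPlain β) (hstep : StepSizes lf Lf lg Lg β P.lam) (hT : 0 < T)
    (hδ : ∀ x, C₀ * ∫ ξ, ‖IsProblem.sampleMap lf Lf lg g ξ x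
      - ∫ ξ, IsProblem.sampleMap lf Lf lg g ξ x ∂D‖ ^ 2 ∂D ≤ δ / 2)
    (hdom : GradDominantOn (onlineObj D f g) S v) (m : ℕ)
    (hS : ∀ᵐ ω ∂μ, ∀ t < T,
      zRestart P f g (fun k t => A k t ω) (fun k => ζ k ω) x₀ m t ∈ S) :
    ∫ ω, onlineObj D f g (restart P f g (fun k t => A k t ω) (fun k => ζ k ω) x₀ (m + 1)) ∂μ
        - Fstar (onlineObj D f g)
      ≤ v / (T * β) * (∫ ω, onlineObj D f g
        (restart P f g (fun k t => A k t ω) (fun k => ζ k ω) x₀ m) ∂μ - Fstar (onlineObj D f g))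
        + 3 / 2 * (v * δ) := by
  have hv := hdom.1
  have key := hs.integral_norm_gradient_sq_restart_succ_le x₀ h hP hstep hT hδ m
  have hI := hs.integrable_obj_restart x₀ h hP (m + 1)
  have hG := integrable_norm_gradient_obj_pow (μ := μ) h (hs.measurable_restart x₀ h hP (m + 1)) 2
  have hae : ∀ᵐ ω ∂μ,
      onlineObj D f g (restart P f g (fun k t => A k t ω) (fun k => ζ k ω) x₀ (m + 1))
        - Fstar (onlineObj D f g) ≤ v / 2 * ‖gradient (onlineObj D f g)
          (restart P f g (fun k t => A k t ω) (fun k => ζ k ω) x₀ (m + 1))‖ ^ 2 := by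
    filter_upwards [hS, ae_lt_of_map_eq_uniformOn (hs.measurable_ζ m) (hs.law_ζ m)] with ω h1 h2
    exact hdom.2 _ (h1 _ h2)
  have h1 := integral_mono_ae (hI.sub (integrable_const _)) (hG.const_mul _) hae
  simp only [Pi.sub_apply] at h1
  rw [integral_sub hI (integrable_const _), integral_const, probReal_univ, one_smul,
    integral_const_mul] at h1
  refine h1.trans ((mul_le_mul_of_nonneg_left key (by positivity)).trans (le_of_eq ?_))
  ring

/-- The optimality gap after `M` runs. -/
lemma IsReducedSampling.gap_restart_le
    (hs : IsReducedSampling μ D P.τ C₀ A ζ T) (h : IsProblem D f g lf Lf lg Lg)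
    (hP : P.IsPlain β) (hstep : StepSizes lf Lf lg Lg β P.lam) (hT : 0 < T)
    (hδ : ∀ x, C₀ * ∫ ξ, ‖IsProblem.sampleMap lf Lf lg g ξ x
      - ∫ ξ, IsProblem.sampleMap lf Lf lg g ξ x ∂D‖ ^ 2 ∂D ≤ δ / 2)
    (hδ0 : 0 ≤ δ) (hTv : 2 * v ≤ T * β)
    (hdom : GradDominantOn (onlineObj D f g) S v) (M : ℕ)
    (hS : ∀ᵐ ω ∂μ, ∀ m < M, ∀ t < T,
      zRestart P f g (fun k t => A k t ω) (fun k => ζ k ω) x₀ m t ∈ S) :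
    ∫ ω, onlineObj D f g (restart P f g (fun k t => A k t ω) (fun k => ζ k ω) x₀ M) ∂μ
        - Fstar (onlineObj D f g)
      ≤ (1 / 2) ^ M * (onlineObj D f g x₀ - Fstar (onlineObj D f g)) + 3 * (v * δ) := by
  have hv := hdom.1
  have hβ := hP.β_pos
  have hT' : (0 : ℝ) < T := by exact_mod_cast hT
  induction M with
  | zero =>
    simp only [restart, integral_const, probReal_univ, one_smul, pow_zero, one_mul]
    have : 0 ≤ v * δ := by positivity
    linarith
  | succ M ih =>
    have ih' := ih (hS.mono fun ω hω m hm => hω m (by omega))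
    have h1 := hs.gap_restart_succ_le x₀ h hP hstep hT hδ hdom M
      (hS.mono fun ω hω => hω M (Nat.lt_succ_self M))
    have hgap : 0 ≤ ∫ ω, onlineObj D f g
        (restart P f g (fun k t => A k t ω) (fun k => ζ k ω) x₀ M) ∂μ
        - Fstar (onlineObj D f g) := by
      have := integral_mono (integrable_const (Fstar (onlineObj D f g)))
        (hs.integrable_obj_restart x₀ h hP M) fun ω => h.Fstar_le _
      rw [integral_const, probReal_univ, one_smul] at this
      linarith
    have h2 : v / (T * β) ≤ 1 / 2 := by
      rw [div_le_div_iff₀ (by positivity) two_pos]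
      linarith
    -- The offset `3 v δ` is the fixed point of `r ↦ r / 2 + 3 / 2 * (v δ)`, so it does not
    -- accumulate over the runs.
    have h3 := mul_le_mul_of_nonneg_right h2 hgap
    rw [pow_succ]
    linarith

/-- The mean squared gradient after `M + 1` runs. -/
lemma IsReducedSampling.integral_norm_gradient_sq_restart_le
    (hs : IsReducedSampling μ D P.τ C₀ A ζ T) (h : IsProblem D f g lf Lf lg Lg)
    (hP : P.IsPlain β) (hstep : StepSizes lf Lf lg Lg β P.lam) (hT : 0 < T)
    (hδ : ∀ x, C₀ * ∫ ξ, ‖IsProblem.sampleMap lf Lf lg g ξ x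
      - ∫ ξ, IsProblem.sampleMap lf Lf lg g ξ x ∂D‖ ^ 2 ∂D ≤ δ / 2)
    (hδ0 : 0 ≤ δ) (hTv : 2 * v ≤ T * β)
    (hdom : GradDominantOn (onlineObj D f g) S v) (M : ℕ)
    (hS : ∀ᵐ ω ∂μ, ∀ m < M, ∀ t < T,
      zRestart P f g (fun k t => A k t ω) (fun k => ζ k ω) x₀ m t ∈ S) :
    ∫ ω, ‖gradient (onlineObj D f g)
        (restart P f g (fun k t => A k t ω) (fun k => ζ k ω) x₀ (M + 1))‖ ^ 2 ∂μ
      ≤ (1 / 2) ^ M * (onlineObj D f g x₀ - Fstar (onlineObj D f g)) / v + 6 * δ := by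
  have hv := hdom.1
  have hβ := hP.β_pos
  have hT' : (0 : ℝ) < T := by exact_mod_cast hT
  have h1 := hs.integral_norm_gradient_sq_restart_succ_le x₀ h hP hstep hT hδ M
  have h2 := hs.gap_restart_le x₀ h hP hstep hT hδ hδ0 hTv hdom M hS
  -- The offset `3 v δ` in the gap then contributes `3 δ`, and the last run adds its own `3 δ`.
  have h3 : 2 / (T * β) ≤ 1 / v := by
    rw [div_le_div_iff₀ (by positivity) hv]
    linarith
  have hΔ := h.Fstar_le x₀
  have hnn : 0 ≤ (1 / 2) ^ M * (onlineObj D f g x₀ - Fstar (onlineObj D f g)) + 3 * (v * δ) := by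
    have : 0 ≤ onlineObj D f g x₀ - Fstar (onlineObj D f g) := by linarith
    positivity
  calc _ ≤ 2 / (T * β) * ((1 / 2) ^ M * (onlineObj D f g x₀ - Fstar (onlineObj D f g))
        + 3 * (v * δ)) + 3 * δ := by
        refine h1.trans ?_
        gcongr
    _ ≤ 1 / v * ((1 / 2) ^ M * (onlineObj D f g x₀ - Fstar (onlineObj D f g))
        + 3 * (v * δ)) + 3 * δ := by gcongr
    _ = _ := by field_simp; ring

/-- The passage from second to first moment integrates the pointwise bound `G ≤ ε / 2 + G² / (2 ε)`.
-/
lemma accurate_of_integral_norm_gradient_sq_le (h : IsProblem D f g lf Lf lg Lg) {X : Ω → Vec d}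
    (hX : Measurable X) {ε : ℝ} (hε : 0 < ε)
    (hle : ∫ ω, ‖gradient (onlineObj D f g) (X ω)‖ ^ 2 ∂μ ≤ ε ^ 2) :
    Accurate μ (onlineObj D f g) X ε := by
  intro η hη
  simp only [gradMap_zero _ hη]
  have h1 := integrable_norm_gradient_obj_pow (μ := μ) h hX 1
  have h2 := integrable_norm_gradient_obj_pow (μ := μ) h hX 2
  simp only [pow_one] at h1
  refine ⟨h1, ?_⟩
  have hpt : ∀ ω, ‖gradient (onlineObj D f g) (X ω)‖
      ≤ ε / 2 + 1 / (2 * ε) * ‖gradient (onlineObj D f g) (X ω)‖ ^ 2 := by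
    intro ω
    set G := ‖gradient (onlineObj D f g) (X ω)‖
    have : ε / 2 + 1 / (2 * ε) * G ^ 2 - G = 1 / (2 * ε) * (G - ε) ^ 2 := by field_simp; ring
    have : 0 ≤ 1 / (2 * ε) * (G - ε) ^ 2 := by positivity
    linarith
  have h3 := integral_mono h1 ((integrable_const (ε / 2)).add (h2.const_mul _)) hpt
  simp only [Pi.add_apply] at h3
  rw [integral_add (integrable_const _) (h2.const_mul _), integral_const, probReal_univ, one_smul,
    integral_const_mul] at h3
  refine h3.trans ?_
  calc _ ≤ ε / 2 + 1 / (2 * ε) * ε ^ 2 := by gcongr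
    _ = ε := by field_simp; ring

end Restarts

/-! ### Counting evaluations -/

section Evals

variable {d p : ℕ} {Ξ : Type*} {P : Params d} {f : Vec p → ℝ} {g : Ξ → Vec d → Vec p}

lemma run_evals (a : (t : ℕ) → Fin (P.b t) → Ξ) (x₀ : Vec d) (T : ℕ) :
    (run P f g a x₀ T).evals
      = ∑ t ∈ Finset.range T, if t % P.τ = 0 then 2 * P.b t else 4 * P.b t := by
  induction T with
  | zero => rfl
  | succ T ih =>
    rw [Finset.sum_range_succ, ← ih]
    rfl

/-- Division by `τ` is injective on multiples of `τ`. The extra `τ` on the right accounts for the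
checkpoint at `0`. -/
lemma card_filter_mod_eq_zero_mul_le (τ T : ℕ) :
    ((Finset.range T).filter fun t => t % τ = 0).card * τ ≤ T + τ := by
  have h1 : ((Finset.range T).filter fun t => t % τ = 0).card ≤ (Finset.range (T / τ + 1)).card := by
    refine Finset.card_le_card_of_injOn (fun t => t / τ) ?_ ?_
    · intro t ht
      simp only [Finset.coe_filter, Finset.mem_range, Set.mem_ofPred_eq] at ht
      simp only [Finset.coe_range, Set.mem_Iio]
      exact Nat.lt_succ_of_le (Nat.div_le_div_right ht.1.le)
    · intro t ht s hs hts
      simp only [Finset.coe_filter, Finset.mem_range, Set.mem_ofPred_eq] at ht hs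
      simp only at hts
      rw [← Nat.div_add_mod t τ, ← Nat.div_add_mod s τ, ht.2, hs.2, hts]
  rw [Finset.card_range] at h1
  calc _ ≤ (T / τ + 1) * τ := Nat.mul_le_mul_right _ h1
    _ = T / τ * τ + τ := by ring
    _ ≤ T + τ := by gcongr; exact Nat.div_mul_le_self T τ

/-- The evaluations of one run whose checkpoint batches have size at most `8 τ²`. -/
lemma run_evals_le (a : (t : ℕ) → Fin (P.b t) → Ξ) (x₀ : Vec d) {T B : ℕ} (hτ : 0 < P.τ)
    (hτT : P.τ ≤ T) (hb : ∀ t, P.b t = if t % P.τ = 0 then B else P.τ)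
    (hB : B ≤ 8 * P.τ ^ 2) : (run P f g a x₀ T).evals ≤ 36 * (P.τ * T) := by
  rw [run_evals]
  have h1 := card_filter_mod_eq_zero_mul_le P.τ T
  set c := ((Finset.range T).filter fun t => t % P.τ = 0).card with hc
  calc _ ≤ ∑ t ∈ Finset.range T, ((if t % P.τ = 0 then 2 * B else 0) + 4 * P.τ) := by
        refine Finset.sum_le_sum fun t _ => ?_
        rw [hb]
        split_ifs <;> omega
    _ = c * (2 * B) + T * (4 * P.τ) := by
        rw [Finset.sum_add_distrib, ← Finset.sum_filter, Finset.sum_const, Finset.sum_const,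
          Finset.card_range, smul_eq_mul, smul_eq_mul]
    _ ≤ c * (2 * (8 * P.τ ^ 2)) + T * (4 * P.τ) := by gcongr
    _ = c * P.τ * (16 * P.τ) + T * (4 * P.τ) := by ring
    _ ≤ (T + P.τ) * (16 * P.τ) + T * (4 * P.τ) := by gcongr
    -- An epoch fits into the run, `τ ≤ T`, so the first checkpoint costs no more than the rest; `36
    -- = 2 * 16 + 4`.
    _ ≤ (T + T) * (16 * P.τ) + T * (4 * P.τ) := by gcongr
    _ = _ := by ring

lemma totalEvals_le (a : ℕ → (t : ℕ) → Fin (P.b t) → Ξ) (ζ : ℕ → ℕ) (x₀ : Vec d) {T B : ℕ}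
    (hτ : 0 < P.τ) (hτT : P.τ ≤ T) (hb : ∀ t, P.b t = if t % P.τ = 0 then B else P.τ)
    (hB : B ≤ 8 * P.τ ^ 2) (M : ℕ) :
    totalEvals P f g a ζ x₀ T M ≤ M * (36 * (P.τ * T)) := by
  unfold totalEvals
  refine (Finset.sum_le_sum fun m _ => run_evals_le (a m) _ hτ hτT hb hB).trans (le_of_eq ?_)
  simp

end Evals

/-! ### Numerical bounds for the number of runs and of iterations -/

section Numerics

lemma log_one_div_pos {ε : ℝ} (hε : 0 < ε) (hε2 : ε ≤ 1 / 2) :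
    Real.log 2 ≤ Real.log (1 / ε) := by
  apply Real.log_le_log two_pos
  rw [le_div_iff₀ hε]; linarith

/-- The fifth power is what the accuracy claim consumes: one factor `ε` for the hypothesis `ε Δ ≤
v`, two for the target `ε²`, and two, through `ε ≤ 1 / 2`, to absorb numerical constants. -/
lemma half_pow_ceil_le {ε : ℝ} (hε : 0 < ε) {M : ℕ}
    (hM : M = ⌈5 / Real.log 2 * Real.log (1 / ε)⌉₊) : (1 / 2 : ℝ) ^ M ≤ ε ^ 5 := by
  have hlog : 0 < Real.log 2 := Real.log_pos one_lt_two
  have h1 : 5 / Real.log 2 * Real.log (1 / ε) ≤ M := by rw [hM]; exact Nat.le_ceil _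
  have h2 : 5 * Real.log (1 / ε) ≤ M * Real.log 2 := by
    rw [div_mul_eq_mul_div, div_le_iff₀ hlog] at h1
    exact h1
  rw [← Real.log_le_log_iff (by positivity) (by positivity), Real.log_pow, Real.log_pow]
  rw [one_div, Real.log_inv] at h2
  rw [one_div, Real.log_inv]
  push_cast
  linarith

lemma ceil_pos_and_le {ε : ℝ} (hε : 0 < ε) (hε2 : ε ≤ 1 / 2) {M : ℕ}
    (hM : M = ⌈5 / Real.log 2 * Real.log (1 / ε)⌉₊) :
    0 < M ∧ (M : ℝ) ≤ 9 * Real.log (1 / ε) := by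
  have hlog : 0 < Real.log 2 := Real.log_pos one_lt_two
  have h2 := log_one_div_pos hε hε2
  have hpos : 0 < 5 / Real.log 2 * Real.log (1 / ε) := by
    have : 0 < Real.log (1 / ε) := by linarith
    positivity
  refine ⟨by rw [hM]; exact Nat.ceil_pos.2 hpos, ?_⟩
  have h3 : (M : ℝ) < 5 / Real.log 2 * Real.log (1 / ε) + 1 := by
    rw [hM]; exact Nat.ceil_lt_add_one hpos.le
  -- The `1` lost to the ceiling is absorbed since `ε ≤ 1 / 2`, which turns `5 / log 2` into `6 /
  -- log 2 < 9`.
  have h4 : 1 ≤ Real.log (1 / ε) / Real.log 2 := by rwa [le_div_iff₀ hlog, one_mul]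
  have h5 : 6 / Real.log 2 ≤ 9 := by
    rw [div_le_iff₀ hlog]
    have := Real.log_two_gt_d9
    linarith
  have h6 : 5 / Real.log 2 * Real.log (1 / ε) + Real.log (1 / ε) / Real.log 2
      = 6 / Real.log 2 * Real.log (1 / ε) := by field_simp; norm_num
  have h7 : 6 / Real.log 2 * Real.log (1 / ε) ≤ 9 * Real.log (1 / ε) := by gcongr; linarith
  linarith

/-- An upper bound for the epoch length times the number of iterations. -/
lemma mul_max_ceil_le {τ T : ℕ} {x N : ℝ} (hx : 0 ≤ x) (hτN : (τ : ℝ) ^ 2 ≤ N)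
    (hT : T = max ⌈x⌉₊ τ) : (τ * T : ℝ) ≤ τ * x + 2 * N := by
  have h1 : (T : ℝ) ≤ x + 1 + τ := by
    rw [hT, Nat.cast_max]
    have := (Nat.ceil_lt_add_one hx).le
    have h2 : (0 : ℝ) ≤ τ := Nat.cast_nonneg _
    exact max_le (by linarith) (by linarith)
  have h3 : (τ : ℝ) ≤ (τ : ℝ) ^ 2 := by exact_mod_cast Nat.le_self_pow two_ne_zero τ
  calc (τ * T : ℝ) ≤ τ * (x + 1 + τ) := by gcongr
    _ = τ * x + (τ + τ ^ 2) := by ring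
    _ ≤ _ := by linarith

end Numerics

/-! ### The finite-sum problem -/

section FiniteSum

variable {d p n : ℕ} {f : Vec p → ℝ} {g : Fin n → Vec d → Vec p} {lf Lf lg Lg : ℝ≥0}

/-- The reduction of the finite sum to the online form, with the uniform law on `Fin n`. -/
lemma onlineObj_uniformOn_univ (f : Vec p → ℝ) (g : Fin n → Vec d → Vec p) :
    onlineObj (uniformOn Set.univ) f g = finiteSumObj f g := by
  ext x
  rw [onlineObj, meanMap, integral_uniformOn_univ_fin_eq_avg, finiteSumObj]

lemma isProbabilityMeasure_uniformOn_univ_fin (hn : 0 < n) :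
    IsProbabilityMeasure (uniformOn (Set.univ : Set (Fin n))) :=
  have : Nonempty (Fin n) := ⟨⟨0, hn⟩⟩
  isProbabilityMeasure_uniformOn (Set.toFinite _) Set.univ_nonempty

lemma Smooth.isProblem_finiteSum (h : Smooth f g (finiteSumObj f g) lf Lf lg Lg) (hn : 0 < n) :
    IsProblem (uniformOn Set.univ) f g lf Lf lg Lg where
  smooth := by rwa [onlineObj_uniformOn_univ]
  measurable _ := .of_discrete
  memLp _ :=
    have := isProbabilityMeasure_uniformOn_univ_fin hn
    .of_discrete

lemma isPlain_finiteSumParams (d : ℕ) {β : ℝ} {lam : ℕ → ℝ} (h : StepSizes lf Lf lg Lg β lam)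
    (hn : 0 < n) : (finiteSumParams d n β lam).IsPlain β where
  r_eq := rfl
  α_eq := rfl
  β_eq := rfl
  β_pos := h.pos
  lam_mem := h.lam_mem
  τ_pos := Nat.sqrt_pos.2 hn

lemma IsFiniteSumSampling.isReducedSampling {Ω : Type*} [MeasurableSpace Ω] {μ : Measure Ω}
    [IsProbabilityMeasure μ] {β : ℝ} {lam : ℕ → ℝ}
    {A : ℕ → (t : ℕ) → Ω → Fin ((finiteSumParams d n β lam).b t) → Fin n} {ζ : ℕ → Ω → ℕ} {T : ℕ}
    (h : IsFiniteSumSampling μ (finiteSumParams d n β lam).τ A ζ T) (hn : 0 < n) :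
    IsReducedSampling μ (uniformOn Set.univ) (finiteSumParams d n β lam).τ 0 A ζ T where
  toIsSampling := h.toIsSampling
  checkpoint m t ht := by
    have := Measure.isProbabilityMeasure_map (μ := μ) (h.measurable_A m t).aemeasurable
    refine batchLaw_of_bijective ?_
    rw [ae_map_iff (h.measurable_A m t).aemeasurable (Set.toFinite _).measurableSet]
    exact Filter.Eventually.of_forall (h.full m t ht)
  mini m t ht := by
    have hb : (finiteSumParams d n β lam).b t = (finiteSumParams d n β lam).τ := if_neg ht
    have hτ : 0 < (finiteSumParams d n β lam).τ := Nat.sqrt_pos.2 hn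
    have := isProbabilityMeasure_uniformOn_univ_fin hn
    rw [← hb]
    rcases h.mini m t ht with h1 | h1
    · rw [h1]
      exact batchLaw_pi _ (hb ▸ hτ)
    · rw [h1]
      exact batchLaw_uniformOn_injective (hb ▸ hτ) (hb.trans_le (Nat.sqrt_le_self n))

end FiniteSum

/-! ### The online problem -/

section Online

variable {d p : ℕ} {Ξ : Type*} [MeasurableSpace Ξ] {D : Measure Ξ}
  {f : Vec p → ℝ} {g : Ξ → Vec d → Vec p} {lf Lf lg Lg : ℝ≥0} {σg σg' ε s β : ℝ} {lam : ℕ → ℝ}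

lemma one_le_ratio (hε : 0 < ε) (hεs : ε ^ 2 ≤ 2 * s) : 1 ≤ 2 * s / ε ^ 2 := by
  rwa [le_div_iff₀ (by positivity), one_mul]

lemma onlineTau_pos (hε : 0 < ε) (hεs : ε ^ 2 ≤ 2 * s) : 0 < onlineTau s ε :=
  Nat.floor_pos.2 (Real.one_le_sqrt.2 (one_le_ratio hε hεs))

lemma onlineTau_sq_le (hε : 0 < ε) (hεs : ε ^ 2 ≤ 2 * s) :
    (onlineTau s ε : ℝ) ^ 2 ≤ 2 * s / ε ^ 2 := by
  have h1 := one_le_ratio hε hεs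
  have h2 : (onlineTau s ε : ℝ) ≤ √(2 * s / ε ^ 2) := Nat.floor_le (Real.sqrt_nonneg _)
  calc _ ≤ √(2 * s / ε ^ 2) ^ 2 := by gcongr
    _ = _ := Real.sq_sqrt (by linarith)

/-- With `q = 2 s / ε²`, rounding down loses at most a factor two in the root: `√q < τ + 1 ≤ 2 τ`.
Then `⌈q⌉ ≤ 4 τ² + 1 ≤ 8 τ²`. -/
lemma ceil_ratio_le (hε : 0 < ε) (hεs : ε ^ 2 ≤ 2 * s) :
    ⌈2 * s / ε ^ 2⌉₊ ≤ 8 * onlineTau s ε ^ 2 := by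
  have h1 := one_le_ratio hε hεs
  have h2 := Nat.ceil_lt_add_one (zero_le_one.trans h1)
  have h3 : √(2 * s / ε ^ 2) < onlineTau s ε + 1 := Nat.lt_floor_add_one _
  have h4 : (1 : ℝ) ≤ onlineTau s ε := by exact_mod_cast onlineTau_pos hε hεs
  have h5 : 2 * s / ε ^ 2 ≤ (2 * onlineTau s ε) ^ 2 := by
    rw [← Real.sqrt_le_left (by positivity)]
    linarith
  have h6 : (⌈2 * s / ε ^ 2⌉₊ : ℝ) ≤ 8 * (onlineTau s ε : ℝ) ^ 2 := by linarith
  exact_mod_cast h6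

lemma BoundedVariance.isProblem (hV : BoundedVariance D g σg σg')
    (h : Smooth f g (onlineObj D f g) lf Lf lg Lg) : IsProblem D f g lf Lf lg Lg where
  smooth := h
  measurable := hV.measurable
  memLp := hV.memLp

lemma isPlain_onlineParams (d : ℕ) (h : StepSizes lf Lf lg Lg β lam) (hε : 0 < ε)
    (hεs : ε ^ 2 ≤ 2 * s) : (onlineParams d s ε β lam).IsPlain β where
  r_eq := rfl
  α_eq := rfl
  β_eq := rfl
  β_pos := h.pos
  lam_mem := h.lam_mem
  τ_pos := onlineTau_pos hε hεs

lemma IsOnlineSampling.isReducedSampling [IsProbabilityMeasure D]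
    {Ω : Type*} [MeasurableSpace Ω] {μ : Measure Ω}
    {A : ℕ → (t : ℕ) → Ω → Fin ((onlineParams d s ε β lam).b t) → Ξ} {ζ : ℕ → Ω → ℕ} {T : ℕ}
    (h : IsOnlineSampling μ D A ζ T) (hε : 0 < ε) (hεs : ε ^ 2 ≤ 2 * s) :
    IsReducedSampling μ D (onlineParams d s ε β lam).τ (⌈2 * s / ε ^ 2⌉₊ : ℝ)⁻¹ A ζ T where
  toIsSampling := h.toIsSampling
  checkpoint m t ht := by
    have hb : (onlineParams d s ε β lam).b t = ⌈2 * s / ε ^ 2⌉₊ := if_pos ht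
    rw [h.law_A, ← hb]
    exact batchLaw_pi _ (hb ▸ Nat.ceil_pos.2 (zero_lt_one.trans_le (one_le_ratio hε hεs)))
  mini m t ht := by
    have hb : (onlineParams d s ε β lam).b t = (onlineParams d s ε β lam).τ := if_neg ht
    rw [h.law_A, ← hb]
    exact batchLaw_pi _ (hb ▸ onlineTau_pos hε hεs)

/-- The weights in `sampleMap` make its variance at most `σ₀² / 2`. Division by a batch of at least
`2 σ₀² / ε²` samples gives `ε² / 4`, so the online problem runs with `δ = ε² / 2`. -/
lemma BoundedVariance.inv_ceil_mul_le [IsProbabilityMeasure D] (hV : BoundedVariance D g σg σg')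
    (h : Smooth f g (onlineObj D f g) lf Lf lg Lg) (hε : 0 < ε)
    (hεs : ε ^ 2 ≤ 2 * sigma0Sq lf Lf lg σg σg') (x : Vec d) :
    (⌈2 * sigma0Sq lf Lf lg σg σg' / ε ^ 2⌉₊ : ℝ)⁻¹ *
      ∫ ξ, ‖IsProblem.sampleMap lf Lf lg g ξ x
        - ∫ ξ, IsProblem.sampleMap lf Lf lg g ξ x ∂D‖ ^ 2 ∂D ≤ ε ^ 2 / 2 / 2 := by
  rw [(hV.isProblem h).integral_norm_sampleMap_sub_sq]
  have h1 := one_le_ratio hε hεs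
  have h2 := Nat.le_ceil (2 * sigma0Sq lf Lf lg σg σg' / ε ^ 2)
  have hs : 0 < sigma0Sq lf Lf lg σg σg' := by
    have : 0 < ε ^ 2 := by positivity
    linarith
  have h3 : ((lg : ℝ) * Lf) ^ 2 * ∫ ξ, ‖g ξ x - meanMap D g x‖ ^ 2 ∂D
      + (lf : ℝ) ^ 2 * ∫ ξ, frobNorm (fderiv ℝ (g ξ) x - fderiv ℝ (meanMap D g) x) ^ 2 ∂D
      ≤ sigma0Sq lf Lf lg σg σg' / 2 := by
    calc _ ≤ ((lg : ℝ) * Lf) ^ 2 * σg ^ 2 + (lf : ℝ) ^ 2 * σg' ^ 2 := by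
          gcongr
          · exact hV.var_g x
          · exact hV.var_jac x
      _ = _ := by unfold sigma0Sq; ring
  calc _ ≤ (2 * sigma0Sq lf Lf lg σg σg' / ε ^ 2)⁻¹ * (sigma0Sq lf Lf lg σg σg' / 2) := by
        gcongr
    _ = _ := by field_simp

end Online

/-- A point that is not a minimizer forces the gradient dominance constant to be at least the
step size. -/
lemma GradDominantOn.le_of_not_minimizer {d p : ℕ} {Ξ : Type*} [MeasurableSpace Ξ]
    {D : Measure Ξ} [IsProbabilityMeasure D] {f : Vec p → ℝ} {g : Ξ → Vec d → Vec p}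
    {lf Lf lg Lg : ℝ≥0} {S : Set (Vec d)} {v β : ℝ} {lam : ℕ → ℝ}
    (hdom : GradDominantOn (onlineObj D f g) S v) (h : IsProblem D f g lf Lf lg Lg)
    (hstep : StepSizes lf Lf lg Lg β lam) {x : Vec d} (hx : x ∈ S)
    (hFx : Fstar (onlineObj D f g) < onlineObj D f g x) : β ≤ v := by
  have hLβ := (mul_LF_le_and_G0_mul_sq_le hstep).1
  -- This lower bound and gradient dominance enclose the gap between `β / 2` and `v / 2` times the
  -- squared gradient, which is nonzero because the gap is.
  have h1 := mul_norm_gradient_sq_le h.differentiable_obj h.norm_gradient_obj_sub_le h.Fstar_le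
    hstep.pos (by linarith) x
  have h2 := hdom.2 x hx
  by_contra! hlt
  have hG : 0 ≤ ‖gradient (onlineObj D f g) x‖ ^ 2 := by positivity
  have h3 : 0 < ‖gradient (onlineObj D f g) x‖ ^ 2 := by
    by_contra! hc
    have : ‖gradient (onlineObj D f g) x‖ ^ 2 = 0 := le_antisymm hc hG
    rw [this] at h2
    linarith
  have h4 := mul_lt_mul_of_pos_right hlt h3
  linarith

end

/-- With `ε ^ 5` in place of `2 ^ (-M)`, the mean squared gradient of the last run is at most
`ε ^ 2`. -/
lemma half_pow_mul_div_add_le {ε v Δ e : ℝ} {N : ℕ} (hε : 0 < ε) (hε2 : ε ≤ 1 / 2) (hv : 0 < v)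
    (hpow : (1 / 2 : ℝ) ^ (N + 1) ≤ ε ^ 5) (hεΔ : ε * Δ ≤ v) (he : e ≤ ε ^ 2 / 2) :
    (1 / 2) ^ N * Δ / v + e ≤ ε ^ 2 := by
  have h1 : (1 / 2 : ℝ) ^ N ≤ 2 * ε ^ 5 := by rw [pow_succ] at hpow; linarith
  have h2 : (1 / 2) ^ N * Δ ≤ ε ^ 2 / 2 * v := by
    rcases le_or_gt Δ 0 with hΔ | hΔ
    · have : (1 / 2) ^ N * Δ ≤ 0 := mul_nonpos_of_nonneg_of_nonpos (by positivity) hΔ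
      have : 0 ≤ ε ^ 2 / 2 * v := by positivity
      linarith
    · calc (1 / 2) ^ N * Δ ≤ 2 * ε ^ 5 * Δ := by gcongr
        _ = 2 * ε ^ 4 * (ε * Δ) := by ring
        _ ≤ 2 * ε ^ 4 * v := by gcongr
        _ = 2 * ε ^ 2 * ε ^ 2 * v := by ring
        _ ≤ 2 * (1 / 2) ^ 2 * ε ^ 2 * v := by gcongr
        _ = _ := by ring
  have h3 : (1 / 2) ^ N * Δ / v ≤ ε ^ 2 / 2 := by rwa [div_le_iff₀ hv]
  linarith

/-- A real bound for the number of evaluations from a bound for its factors. -/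
lemma cast_evals_le {E M τ T : ℕ} {l w a C : ℝ} (hE : E ≤ M * (36 * (τ * T)))
    (hM : (M : ℝ) ≤ 9 * l) (hτT : (τ * T : ℝ) ≤ a * w) (hw : 0 ≤ w) (hl : 0 ≤ l)
    (hC : 324 * a ≤ C) : (E : ℝ) ≤ C * (w * l) := by
  have h1 : (E : ℝ) ≤ M * (36 * (τ * T)) := by exact_mod_cast hE
  calc (E : ℝ) ≤ M * (36 * (τ * T)) := h1
    _ ≤ (9 * l) * (36 * (a * w)) := by gcongr
    _ = 324 * a * (w * l) := by ring
    _ ≤ C * (w * l) := by gcongr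

end MVRC

/-! ### The theorem for both problems -/

theorem theorem3 :
    ∃ c K κ C : ℝ, 0 < c ∧ 0 < K ∧ 0 < κ ∧ κ ≤ 1 ∧ 0 < C ∧
    -- the finite-sum problem
    (∀ (d p n : ℕ) (f : MVRC.Vec p → ℝ) (g : Fin n → MVRC.Vec d → MVRC.Vec p)
        (lf Lf lg Lg : NNReal) (S : Set (MVRC.Vec d)) (v β : ℝ) (lam : ℕ → ℝ) (x₀ : MVRC.Vec d),
      let F := MVRC.finiteSumObj f g
      let P := MVRC.finiteSumParams d n β lam
      let Δ := F x₀ - MVRC.Fstar F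
      0 < n → MVRC.Smooth f g F lf Lf lg Lg → MVRC.GradDominantOn F S v →
      MVRC.StepSizes lf Lf lg Lg β lam →
      -- one run
      (∀ (T : ℕ) (Ω : Type*) [MeasurableSpace Ω] (μ : MeasureTheory.Measure Ω)
          [MeasureTheory.IsProbabilityMeasure μ]
          (A : ℕ → (t : ℕ) → Ω → Fin (P.b t) → Fin n) (ζ : ℕ → Ω → ℕ),
        0 < T → MVRC.IsFiniteSumSampling μ P.τ A ζ T →
        (∀ᵐ ω ∂μ, ∀ t < T, MVRC.zIter P f g (fun t => A 0 t ω) x₀ t ∈ S) →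
        MVRC.GapLE μ F (fun ω => MVRC.zIter P f g (fun t => A 0 t ω) x₀ (ζ 0 ω))
          (C * (v * Δ / (T * β)))) ∧
      -- restarts
      (∀ (T M : ℕ) (Ω : Type*) [MeasurableSpace Ω] (μ : MeasureTheory.Measure Ω)
          [MeasureTheory.IsProbabilityMeasure μ]
          (A : ℕ → (t : ℕ) → Ω → Fin (P.b t) → Fin n) (ζ : ℕ → Ω → ℕ),
        T = max ⌈c * v / β⌉₊ P.τ → MVRC.IsFiniteSumSampling μ P.τ A ζ T →
        (∀ᵐ ω ∂μ, ∀ m < M, ∀ t < T,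
          MVRC.zRestart P f g (fun m t => A m t ω) (fun m => ζ m ω) x₀ m t ∈ S) →
        let out := fun ω => MVRC.restart P f g (fun m t => A m t ω) (fun m => ζ m ω) x₀ M
        MVRC.GapLE μ F out ((1 / 2) ^ M * Δ) ∧
        ∀ ε : ℝ, 0 < ε → ε ≤ 1 / 2 → M = ⌈K * Real.log (1 / ε)⌉₊ →
          MVRC.GapLE μ F out (ε ^ 2 * Δ) ∧
          (ε * Δ ≤ v → MVRC.Accurate μ F out ε) ∧
          ∀ ω, (MVRC.totalEvals P f g (fun m t => A m t ω) (fun m => ζ m ω) x₀ T M : ℝ)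
            ≤ C * ((n + √n * (v / β)) * Real.log (1 / ε)))) ∧
    -- the online problem
    (∀ (d p : ℕ) (Ξ : Type*) [MeasurableSpace Ξ] (D : MeasureTheory.Measure Ξ)
        [MeasureTheory.IsProbabilityMeasure D]
        (f : MVRC.Vec p → ℝ) (g : Ξ → MVRC.Vec d → MVRC.Vec p)
        (lf Lf lg Lg : NNReal) (σg σg' : ℝ) (S : Set (MVRC.Vec d)) (v β : ℝ) (lam : ℕ → ℝ)
        (x₀ : MVRC.Vec d),
      let F := MVRC.onlineObj D f g
      let s := MVRC.sigma0Sq lf Lf lg σg σg'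
      let Δ := F x₀ - MVRC.Fstar F
      MVRC.Smooth f g F lf Lf lg Lg → MVRC.BoundedVariance D g σg σg' →
      MVRC.GradDominantOn F S v → MVRC.StepSizes lf Lf lg Lg β lam →
      ∀ ε : ℝ, 0 < ε → ε ^ 2 ≤ 2 * s →
      -- one run
      (let P := MVRC.onlineParams d s ε β lam
        ∀ (T : ℕ) (Ω : Type*) [MeasurableSpace Ω] (μ : MeasureTheory.Measure Ω)
          [MeasureTheory.IsProbabilityMeasure μ]
          (A : ℕ → (t : ℕ) → Ω → Fin (P.b t) → Ξ) (ζ : ℕ → Ω → ℕ),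
        0 < T → MVRC.IsOnlineSampling μ D A ζ T →
        (∀ᵐ ω ∂μ, ∀ t < T, MVRC.zIter P f g (fun t => A 0 t ω) x₀ t ∈ S) →
        MVRC.GapLE μ F (fun ω => MVRC.zIter P f g (fun t => A 0 t ω) x₀ (ζ 0 ω))
          (C * (v * ε ^ 2 + v * Δ / (T * β)))) ∧
      -- restarts: linear convergence
      (let P := MVRC.onlineParams d s ε β lam
        ∀ (T M : ℕ) (Ω : Type*) [MeasurableSpace Ω] (μ : MeasureTheory.Measure Ω)
          [MeasureTheory.IsProbabilityMeasure μ]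
          (A : ℕ → (t : ℕ) → Ω → Fin (P.b t) → Ξ) (ζ : ℕ → Ω → ℕ),
        T = max ⌈c * v / β⌉₊ P.τ → MVRC.IsOnlineSampling μ D A ζ T →
        (∀ᵐ ω ∂μ, ∀ m < M, ∀ t < T,
          MVRC.zRestart P f g (fun m t => A m t ω) (fun m => ζ m ω) x₀ m t ∈ S) →
        MVRC.GapLE μ F
          (fun ω => MVRC.restart P f g (fun m t => A m t ω) (fun m => ζ m ω) x₀ M)
          (C * (v * ε ^ 2) + (1 / 2) ^ M * Δ)) ∧
      -- restarts: accuracy and sample complexity, with batch sizes for the accuracy `κ * ε`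
      (let P := MVRC.onlineParams d s (κ * ε) β lam
        ∀ (T M : ℕ) (Ω : Type*) [MeasurableSpace Ω] (μ : MeasureTheory.Measure Ω)
          [MeasureTheory.IsProbabilityMeasure μ]
          (A : ℕ → (t : ℕ) → Ω → Fin (P.b t) → Ξ) (ζ : ℕ → Ω → ℕ),
        T = max ⌈c * v / β⌉₊ P.τ → MVRC.IsOnlineSampling μ D A ζ T →
        (∀ᵐ ω ∂μ, ∀ m < M, ∀ t < T,
          MVRC.zRestart P f g (fun m t => A m t ω) (fun m => ζ m ω) x₀ m t ∈ S) →
        let out := fun ω => MVRC.restart P f g (fun m t => A m t ω) (fun m => ζ m ω) x₀ M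
        ε ≤ 1 / 2 → M = ⌈K * Real.log (1 / ε)⌉₊ →
          MVRC.GapLE μ F out (ε ^ 2 * (v + Δ)) ∧
          (ε * Δ ≤ v → MVRC.Accurate μ F out ε) ∧
          ((∃ x ∈ S, MVRC.Fstar F < F x) →
            ∀ ω, (MVRC.totalEvals P f g (fun m t => A m t ω) (fun m => ζ m ω) x₀ T M : ℝ)
              ≤ C * (s / β * v * (1 / ε ^ 2) * Real.log (1 / ε))))) := by
  have hlog2 : 0 < Real.log 2 := Real.log_pos one_lt_two
  -- `c = 2` gives `T β ≥ 2 v`, so a run halves the gap. `K = 5 / log 2` gives `2 ^ (-M) ≤ ε ^ 5`.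
  -- `κ = 1 / 3` gives `δ = ε² / 18`, so that `6 δ ≤ ε² / 2`. The largest demand on `C` is the
  -- online evaluation count `324 * 72 = 23328`.
  refine ⟨2, 5 / Real.log 2, 1 / 3, 30000, by norm_num, by positivity, by norm_num, by norm_num,
    by norm_num, ?_, ?_⟩
  · intro d p n f g lf Lf lg Lg S v β lam x₀ F P Δ hn hsm hdom hstep
    have := MVRC.isProbabilityMeasure_uniformOn_univ_fin hn
    have hpr := hsm.isProblem_finiteSum hn
    have hP : P.IsPlain β := MVRC.isPlain_finiteSumParams d hstep hn
    have hF : MVRC.onlineObj (uniformOn Set.univ) f g = F := MVRC.onlineObj_uniformOn_univ f g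
    have hv := hdom.1
    have hβ := hstep.pos
    have hΔ : 0 ≤ Δ := by
      have := hpr.Fstar_le x₀
      rw [hF] at this
      simp only [Δ]; linarith
    have hδ : ∀ x, (0 : ℝ) * ∫ ξ, ‖MVRC.IsProblem.sampleMap lf Lf lg g ξ x
        - ∫ ξ, MVRC.IsProblem.sampleMap lf Lf lg g ξ x ∂(uniformOn Set.univ)‖ ^ 2
          ∂(uniformOn Set.univ) ≤ 0 / 2 := fun x => by simp
    rw [← hF] at hdom
    refine ⟨?_, ?_⟩
    · intro T Ω _ μ _ A ζ hT hsamp hS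
      have hs := hsamp.isReducedSampling hn
      have hT' : (0 : ℝ) < T := by exact_mod_cast hT
      -- The output of a single run is by definition `restart` at `1`, so the lemmas on restarts
      -- apply with run number `0`.
      have hI := hs.integrable_obj_restart x₀ hpr hP 1
      have key := hs.gap_restart_succ_le x₀ hpr hP hstep hT hδ hdom 0 hS
      rw [hF] at hI key
      refine ⟨hI, key.trans ?_⟩
      simp only [MVRC.restart, MeasureTheory.integral_const, MeasureTheory.probReal_univ, one_smul,
        mul_zero, add_zero]
      have : 0 ≤ v / (T * β) * Δ := by positivity
      calc v / (T * β) * Δ ≤ 30000 * (v / (T * β) * Δ) := by linarith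
        _ = _ := by ring
    · intro T M Ω _ μ _ A ζ hTeq hsamp hS out
      have hs := hsamp.isReducedSampling hn
      have hτT : P.τ ≤ T := by rw [hTeq]; exact le_max_right _ _
      have hT : 0 < T := hP.τ_pos.trans_le hτT
      have hTv : 2 * v ≤ T * β := by
        rw [← div_le_iff₀ hβ, hTeq]
        exact (Nat.le_ceil _).trans (by exact_mod_cast le_max_left _ _)
      have hI := hs.integrable_obj_restart x₀ hpr hP M
      have key := hs.gap_restart_le x₀ hpr hP hstep hT hδ le_rfl hTv hdom M hS
      have hgrad := fun N hN => hs.integral_norm_gradient_sq_restart_le x₀ hpr hP hstep hT hδ le_rfl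
        hTv hdom N (hS.mono fun ω hω m hm => hω m (hm.trans_le hN))
      have hacc := fun ε hε => MVRC.accurate_of_integral_norm_gradient_sq_le (μ := μ) hpr
        (hs.measurable_restart x₀ hpr hP M) (ε := ε) hε
      rw [hF] at hI key hacc
      simp only [hF] at hgrad
      have key' : ∫ ω, F (out ω) ∂μ - MVRC.Fstar F ≤ (1 / 2) ^ M * Δ := by
        refine key.trans (le_of_eq ?_)
        simp [Δ]
      refine ⟨⟨hI, key'⟩, ?_⟩
      intro ε hε hε2 hM
      have hpow := MVRC.half_pow_ceil_le hε hM
      obtain ⟨hM0, hM9⟩ := MVRC.ceil_pos_and_le hε hε2 hM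
      refine ⟨⟨hI, key'.trans ?_⟩, ?_, ?_⟩
      · have : ε ^ 5 ≤ ε ^ 2 := pow_le_pow_of_le_one hε.le (by linarith) (by norm_num)
        exact mul_le_mul_of_nonneg_right (hpow.trans this) hΔ
      · intro hεΔ
        refine hacc ε hε ?_
        -- The first `N` runs reduce the gap, and the last one turns the remaining gap into a
        -- gradient bound.
        obtain ⟨N, rfl⟩ := Nat.exists_eq_succ_of_ne_zero hM0.ne'
        refine (hgrad N (Nat.le_succ N)).trans ?_
        exact MVRC.half_pow_mul_div_add_le hε hε2 hv hpow hεΔ (by linarith [sq_nonneg ε])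
      · intro ω
        have hev := MVRC.totalEvals_le (P := P) (f := f) (g := g) (fun m t => A m t ω)
          (fun m => ζ m ω) x₀ hP.τ_pos hτT (B := n) (fun t => rfl) ?_ M
        · have hτn : (P.τ : ℝ) ^ 2 ≤ n := by exact_mod_cast Nat.sqrt_le' n
          have hτn' : (P.τ : ℝ) ≤ √n := Real.le_sqrt_of_sq_le hτn
          have h1 := MVRC.mul_max_ceil_le (x := 2 * v / β) (by positivity) hτn hTeq
          have h2 : (P.τ * T : ℝ) ≤ 2 * (n + √n * (v / β)) := by
            have : (P.τ : ℝ) * (2 * v / β) ≤ √n * (2 * v / β) := by gcongr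
            calc _ ≤ √n * (2 * v / β) + 2 * n := by linarith
              _ = _ := by ring
          exact MVRC.cast_evals_le hev hM9 h2 (by positivity)
            (by have := MVRC.log_one_div_pos hε hε2; linarith) (by norm_num)
        · have h1 : n < (P.τ + 1) ^ 2 := Nat.lt_succ_sqrt' n
          have h2 : 1 ≤ P.τ := hP.τ_pos
          nlinarith
  · intro d p Ξ _ D _ f g lf Lf lg Lg σg σg' S v β lam x₀ F s Δ hsm hvar hdom hstep ε hε hεs
    have hpr := hvar.isProblem hsm
    have hv := hdom.1
    have hβ := hstep.pos
    have hΔ : 0 ≤ Δ := sub_nonneg.2 (hpr.Fstar_le x₀)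
    refine ⟨?_, ?_, ?_⟩
    · intro P T Ω _ μ _ A ζ hT hsamp hS
      have hP : P.IsPlain β := MVRC.isPlain_onlineParams d hstep hε hεs
      have hδ := hvar.inv_ceil_mul_le hsm hε hεs
      have hs := hsamp.isReducedSampling hε hεs
      have hT' : (0 : ℝ) < T := by exact_mod_cast hT
      have key := hs.gap_restart_succ_le x₀ hpr hP hstep hT hδ hdom 0 hS
      refine ⟨hs.integrable_obj_restart x₀ hpr hP 1, key.trans ?_⟩
      simp only [MVRC.restart, MeasureTheory.integral_const, MeasureTheory.probReal_univ, one_smul]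
      have h1 : 0 ≤ v / (T * β) * Δ := by positivity
      have h2 : 0 ≤ v * ε ^ 2 := by positivity
      calc v / (T * β) * Δ + 3 / 2 * (v * (ε ^ 2 / 2))
          ≤ 30000 * (v * ε ^ 2 + v / (T * β) * Δ) := by linarith
        _ = _ := by ring
    · intro P T M Ω _ μ _ A ζ hTeq hsamp hS
      have hP : P.IsPlain β := MVRC.isPlain_onlineParams d hstep hε hεs
      have hδ := hvar.inv_ceil_mul_le hsm hε hεs
      have hs := hsamp.isReducedSampling hε hεs
      have hτT : P.τ ≤ T := by rw [hTeq]; exact le_max_right _ _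
      have hT : 0 < T := hP.τ_pos.trans_le hτT
      have hTv : 2 * v ≤ T * β := by
        rw [← div_le_iff₀ hβ, hTeq]
        exact (Nat.le_ceil _).trans (by exact_mod_cast le_max_left _ _)
      have key := hs.gap_restart_le x₀ hpr hP hstep hT hδ (by positivity) hTv hdom M hS
      refine ⟨hs.integrable_obj_restart x₀ hpr hP M, key.trans ?_⟩
      have h2 : 0 ≤ v * ε ^ 2 := by positivity
      simp only [F, Δ]
      linarith
    · intro P T M Ω _ μ _ A ζ hTeq hsamp hS out hε2 hM
      have hε' : 0 < 1 / 3 * ε := by positivity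
      have hεs' : (1 / 3 * ε) ^ 2 ≤ 2 * s := by nlinarith
      have hP : P.IsPlain β := MVRC.isPlain_onlineParams d hstep hε' hεs'
      have hδ := hvar.inv_ceil_mul_le hsm hε' hεs'
      have hs := hsamp.isReducedSampling hε' hεs'
      have hτT : P.τ ≤ T := by rw [hTeq]; exact le_max_right _ _
      have hT : 0 < T := hP.τ_pos.trans_le hτT
      have hTv : 2 * v ≤ T * β := by
        rw [← div_le_iff₀ hβ, hTeq]
        exact (Nat.le_ceil _).trans (by exact_mod_cast le_max_left _ _)
      have key := hs.gap_restart_le x₀ hpr hP hstep hT hδ (by positivity) hTv hdom M hS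
      have hpow := MVRC.half_pow_ceil_le hε hM
      obtain ⟨hM0, hM9⟩ := MVRC.ceil_pos_and_le hε hε2 hM
      refine ⟨⟨hs.integrable_obj_restart x₀ hpr hP M, key.trans ?_⟩, ?_, ?_⟩
      · have h1 : ε ^ 5 ≤ ε ^ 2 := pow_le_pow_of_le_one hε.le (by linarith) (by norm_num)
        have h2 := mul_le_mul_of_nonneg_right (hpow.trans h1) hΔ
        have h3 : 0 ≤ v * ε ^ 2 := by positivity
        simp only [Δ, F] at h2 ⊢
        linarith
      · intro hεΔ
        refine MVRC.accurate_of_integral_norm_gradient_sq_le (μ := μ) hpr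
          (hs.measurable_restart x₀ hpr hP M) hε ?_
        obtain ⟨N, rfl⟩ := Nat.exists_eq_succ_of_ne_zero hM0.ne'
        refine (hs.integral_norm_gradient_sq_restart_le x₀ hpr hP hstep hT hδ (by positivity)
          hTv hdom N (hS.mono fun ω hω m hm => hω m (hm.trans_le (Nat.le_succ N)))).trans ?_
        refine MVRC.half_pow_mul_div_add_le hε hε2 hv hpow hεΔ ?_
        have h3 : 0 ≤ ε ^ 2 := by positivity
        linarith
      · rintro ⟨x, hxS, hx⟩ ω
        have hβv := hdom.le_of_not_minimizer hpr hstep hxS hx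
        have hs0 : 0 < s := by
          have : 0 < ε ^ 2 := by positivity
          linarith
        have hev := MVRC.totalEvals_le (P := P) (f := f) (g := g) (fun m t => A m t ω)
          (fun m => ζ m ω) x₀ hP.τ_pos hτT (B := ⌈2 * s / (1 / 3 * ε) ^ 2⌉₊) (fun t => rfl)
          (MVRC.ceil_ratio_le hε' hεs') M
        have hτQ : (P.τ : ℝ) ^ 2 ≤ 2 * s / (1 / 3 * ε) ^ 2 := MVRC.onlineTau_sq_le hε' hεs'
        have hQ : 2 * s / (1 / 3 * ε) ^ 2 = 18 * (s * (1 / ε ^ 2)) := by field_simp; norm_num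
        rw [hQ] at hτQ
        have hτ1 : (P.τ : ℝ) ≤ (P.τ : ℝ) ^ 2 := by
          exact_mod_cast Nat.le_self_pow two_ne_zero P.τ
        have h1 := MVRC.mul_max_ceil_le (x := 2 * v / β) (by positivity) hτQ hTeq
        -- This is where a non-minimizer in `S` matters: it lets the cost `36 s / ε²`, which carries
        -- no factor `v / β`, be absorbed into the main term.
        have hr : 1 ≤ v / β := by rwa [le_div_iff₀ hβ, one_mul]
        have hq : 0 ≤ s * (1 / ε ^ 2) := by positivity
        have h2 : (P.τ * T : ℝ) ≤ 72 * (s / β * v * (1 / ε ^ 2)) := by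
          have h3 : (P.τ : ℝ) * (2 * v / β) ≤ 18 * (s * (1 / ε ^ 2)) * (2 * v / β) := by
            gcongr
            linarith
          have h4 : s * (1 / ε ^ 2) * 1 ≤ s * (1 / ε ^ 2) * (v / β) := by gcongr
          calc (P.τ * T : ℝ) ≤ 36 * (s * (1 / ε ^ 2) * (v / β)) + 36 * (s * (1 / ε ^ 2)) := by
                linarith [show 18 * (s * (1 / ε ^ 2)) * (2 * v / β)
                  = 36 * (s * (1 / ε ^ 2) * (v / β)) by ring]
            _ ≤ 72 * (s * (1 / ε ^ 2) * (v / β)) := by linarith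
            _ = _ := by ring
        exact MVRC.cast_evals_le hev hM9 h2 (by positivity)
          (by have := MVRC.log_one_div_pos hε hε2; linarith) (by norm_num)
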